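/- Let $B_3$ be the braid group on three strands with standard generators $\sigma_1,\sigma_2$, let $b=\sigma_1\sigma_2^{-1}\sigma_1\sigma_2^{-1}\sigma_1$ and let $b^*=\sigma_2^{-1}\sigma_1\sigma_2^{-1}\sigma_1\sigma_2^{-1}$ be the braid obtained from $b$ by the correspondence $\sigma_1^{\pm1}\mapsto\sigma_2^{\mp1}$, $\sigma_2^{\pm1}\mapsto\sigma_1^{\mp1}$. The closure of $bb^*$ in $S^3$ is the knot $10_{123}$, that is, the Turk's head knot $Th(3,5)$, the closure of $(\sigma_1\sigma_2^{-1})^5$. For a group $\Gamma$ let $\mathcal X(\Gamma)=\mathrm{Hom}(\Gamma,\mathrm{SL}_2(\mathbb C))/\!/\mathrm{SL}_2(\mathbb C)$ be its character variety, and write $[G_1,G_2,G_3]\in\mathcal X(F_3)$ for the point given by the representation of the free group $F_3$ that sends the free generators to $G_1,G_2,G_3\in\mathrm{SL}_2(\mathbb C)$. If the Wirtinger generators on the left end of the braid $b$ are labelled by $G_1,G_2,G_3$, let $H_1,H_2,H_3$ be the labels that are induced on its right end; here, from left to right along the braid, a letter $\sigma_i$ replaces the pair of labels $(g_i,g_{i+1})$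 by $(g_{i+1},\,g_{i+1}^{-1}g_ig_{i+1})$ and a letter $\sigma_i^{-1}$ replaces it by $(g_ig_{i+1}g_i^{-1},\,g_i)$. Then there is a Zariski locally closed subset $U\subset\mathcal X(F_3)$ of dimension at least $2$, consisting of characters of irreducible representations, such that every $[G_1,G_2,G_3]\in U$ has the following properties. 1. $\mathrm{tr}\,G_1=\mathrm{tr}\,G_2=\mathrm{tr}\,G_3$ and $\mathrm{tr}\,G_1G_2G_3\neq\pm2$. 2. There is $A\in\mathrm{SL}_2(\mathbb C)$ with $(H_1,H_2,H_3)=A(G_3^{-1},G_2^{-1},G_1^{-1})A^{-1}$, and every such $A$ satisfies $A^2=-I$. 3. $(G_1,G_2,G_3)$ induces a representation of the knot group of $10_{123}$: there is a homomorphism $\rho:\pi_1(S^3\setminus 10_{123})\to\mathrm{SL}_2(\mathbb C)$ that sends the three Wirtinger generators on the left end of the closed braid $bb^*$ to $G_1,G_2,G_3$. Moreover, $10_{123}$ is $\mathcal X$-large: it is a knot, and the character variety $\mathcal X(\pi_1(S^3\setminus 10_{123}))$ has dimension (the dimension of a component of maximal dimension) greater than $1$. -/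

import Mathlib

open scoped Matrix

noncomputable section

/-! ### Representation varieties and character varieties in `SL₂(ℂ)` -/

/-- The group `SL₂(ℂ)`. -/
abbrev SL2C : Type := Matrix.SpecialLinearGroup (Fin 2) ℂ

/-- The set `Hom(Γ, SL₂(ℂ))` of representations of a group `Γ`. -/
abbrev RepVar (Γ : Type) [Group Γ] : Type := Γ →* SL2C

/-- The representation `γ ↦ g ρ(γ) g⁻¹`. -/
def RepVar.conj {Γ : Type} [Group Γ] (g : SL2C) (ρ : RepVar Γ) : RepVar Γ :=
  (MulAut.conj g).toMonoidHom.comp ρ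

/-- A representation on `ℂ²` is irreducible if it has no invariant subspaces except `0`, `ℂ²`. -/
def RepVar.IsIrred {Γ : Type} [Group Γ] (ρ : RepVar Γ) : Prop :=
  ∀ W : Submodule ℂ (Fin 2 → ℂ),
    (∀ γ : Γ, ∀ v ∈ W, (ρ γ : Matrix (Fin 2) (Fin 2) ℂ) *ᵥ v ∈ W) → W = ⊥ ∨ W = ⊤

/-- The ring of regular functions on the variety `Hom(Γ, SL₂(ℂ))`: the algebra of functions
generated by the matrix entries `ρ ↦ ρ(γ)ᵢⱼ`. -/
def repCoordRing (Γ : Type) [Group Γ] : Subalgebra ℂ (RepVar Γ → ℂ) :=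
  Algebra.adjoin ℂ
    {f | ∃ (γ : Γ) (i j : Fin 2), f = fun ρ => (ρ γ : Matrix (Fin 2) (Fin 2) ℂ) i j}

/-- The ring of regular functions on `Hom(Γ, SL₂(ℂ))` that are invariant under conjugation
by `SL₂(ℂ)`. It is the ring of regular functions of the GIT quotient. -/
def invariantRing (Γ : Type) [Group Γ] : Subalgebra ℂ (RepVar Γ → ℂ) where
  carrier := {f | f ∈ repCoordRing Γ ∧ ∀ (g : SL2C) (ρ : RepVar Γ), f (ρ.conj g) = f ρ}
  mul_mem' := fun {a b} ha hb => ⟨mul_mem ha.1 hb.1, fun g ρ => by simp [ha.2 g ρ, hb.2 g ρ]⟩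
  add_mem' := fun {a b} ha hb => ⟨add_mem ha.1 hb.1, fun g ρ => by simp [ha.2 g ρ, hb.2 g ρ]⟩
  algebraMap_mem' := fun c => ⟨Subalgebra.algebraMap_mem _ c, fun _ _ => rfl⟩

/-- Two representations define the same point of the GIT quotient if no invariant regular
function separates them. -/
def charSetoid (Γ : Type) [Group Γ] : Setoid (RepVar Γ) where
  r ρ ρ' := ∀ f ∈ invariantRing Γ, f ρ = f ρ'
  iseqv := ⟨fun _ _ _ => rfl, fun h f hf => (h f hf).symm,
    fun h h' f hf => (h f hf).trans (h' f hf)⟩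

/-- The (points of the) character variety `𝒳(Γ) = Hom(Γ, SL₂(ℂ)) // SL₂(ℂ)`. -/
def CharVar (Γ : Type) [Group Γ] : Type := Quotient (charSetoid Γ)

/-- The point `[ρ]` of the character variety. -/
def CharVar.mk {Γ : Type} [Group Γ] (ρ : RepVar Γ) : CharVar Γ :=
  Quotient.mk (charSetoid Γ) ρ

/-- The Zariski topology of the character variety: a basis of open sets is given by the
non-vanishing loci of the invariant regular functions. -/
instance (Γ : Type) [Group Γ] : TopologicalSpace (CharVar Γ) :=
  TopologicalSpace.generateFrom
    {D | ∃ f ∈ invariantRing Γ, D = CharVar.mk '' {ρ : RepVar Γ | f ρ ≠ 0}}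

/-! ### Knots in the 3-sphere -/

/-- The unit sphere `S³ ⊂ ℂ²`; its points are written `(z, w)`. -/
abbrev S3 : Type := Metric.sphere (0 : EuclideanSpace ℂ (Fin 2)) 1

/-- A subset of `S³` is a knot if it is an embedded circle (so it has a single component). -/
def IsKnot (K : Set S3) : Prop :=
  ∃ γ : Circle → S3, Topology.IsEmbedding γ ∧ Set.range γ = K

/-- The group `π₁(S³ ∖ K, q)`. -/
abbrev KnotGroup (K : Set S3) (q : ↥Kᶜ) : Type := FundamentalGroup ↥Kᶜ q

/-- `K` is an `𝒳`-large knot: it is a knot and the `SL₂(ℂ)`-character variety of `π₁(S³ ∖ K, q)`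
has dimension greater than one. The dimension is the Krull dimension of the Zariski topology,
i.e. the dimension of a component of maximal dimension. -/
def IsXLarge (K : Set S3) (q : ↥Kᶜ) : Prop :=
  IsKnot K ∧ 1 < topologicalKrullDim (CharVar (KnotGroup K q))

/-! ### Braids on three strands -/

/-- The letters `σ₁, σ₂` (first component `0, 1`, second component `true`) and
`σ₁⁻¹, σ₂⁻¹` (second component `false`). -/
abbrev BraidLetter : Type := Fin 2 × Bool

/-- Words in the standard generators of the braid group `B₃` and their inverses. -/
abbrev BraidWord : Type := List BraidLetter

/-- The action of a letter on triples (the labels of the Wirtinger generators before and after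
the crossing): `σᵢ` replaces `(gᵢ, gᵢ₊₁)` by `(gᵢ₊₁, gᵢ₊₁⁻¹ gᵢ gᵢ₊₁)` and `σᵢ⁻¹` replaces
`(gᵢ, gᵢ₊₁)` by `(gᵢ gᵢ₊₁ gᵢ⁻¹, gᵢ)`. -/
def letterAct {M : Type} [Group M] : BraidLetter → (Fin 3 → M) → (Fin 3 → M)
  | (0, true), g => ![g 1, (g 1)⁻¹ * g 0 * g 1, g 2]
  | (0, false), g => ![g 0 * g 1 * (g 0)⁻¹, g 0, g 2]
  | (1, true), g => ![g 0, g 2, (g 2)⁻¹ * g 1 * g 2]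
  | (1, false), g => ![g 0, g 1 * g 2 * (g 1)⁻¹, g 1]

/-- The triple on the right end of a braid word that is determined by the triple `g` on its left
end: the letters act one after the other, from left to right. -/
def braidAct {M : Type} [Group M] (w : BraidWord) (g : Fin 3 → M) : Fin 3 → M :=
  w.foldl (fun h l => letterAct l h) g

/-- The correspondence `σ₁^{±1} ↦ σ₂^{∓1}`, `σ₂^{±1} ↦ σ₁^{∓1}`. -/
def braidStar (w : BraidWord) : BraidWord :=
  w.map fun l => (Fin.rev l.1, !l.2)

/-- `b = σ₁ σ₂⁻¹ σ₁ σ₂⁻¹ σ₁`. -/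
def braidB : BraidWord := [(0, true), (1, false), (0, true), (1, false), (0, true)]

/-! ### Closed braids in the 3-sphere

The complement of the circle `{w = 0}` in `S³` is an open solid torus, and it is fibred by the
discs `arg w = θ`, each of which has the coordinate `z` with `|z| < 1`. A closed braid meets the
disc of angle `θ` in three points, which move in the unit disc as `θ` runs from `0` to `2π`. -/

/-- The three points `-1/2, 0, 1/2` of the unit disc. -/
def puncture (j : Fin 3) : ℂ := ((j : ℕ) - 1 : ℂ) / 2

/-- The position at time `s ∈ [0, 1]` of the strand that starts at the `j`-th point, along the
letter `l = σᵢ^{±1}`: the points `i` and `i + 1` are exchanged by a half turn about their midpoint,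
counterclockwise for `σᵢ` and clockwise for `σᵢ⁻¹`, and the third point does not move. -/
def strand (l : BraidLetter) (j : Fin 3) (s : ℝ) : ℂ :=
  if j = l.1.castSucc ∨ j = l.1.succ then
    let m : ℂ := (puncture l.1.castSucc + puncture l.1.succ) / 2
    m + (puncture j - m) *
      Complex.exp ((if l.2 then 1 else -1) * (Real.pi * s : ℝ) * Complex.I)
  else puncture j

/-- The closure in `S³` of a (nonempty) braid word of length `N`: its `k`-th letter is performed
while `arg w` runs from `2πk/N` to `2π(k+1)/N`. -/
def closedBraid (w : BraidWord) : Set S3 :=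
  {q | ∃ (k : Fin w.length) (j : Fin 3) (s : ℝ), s ∈ Set.Icc (0 : ℝ) 1 ∧
    q.1 0 = strand (w.get k) j s ∧
    q.1 1 = (Real.sqrt (1 - ‖strand (w.get k) j s‖ ^ 2) : ℂ) *
      Complex.exp ((2 * Real.pi * (((k : ℕ) + s) / w.length) : ℝ) * Complex.I)}

/-- The knot `10₁₂₃`, the Turk's head knot `Th(3,5)`: the closure of `(σ₁ σ₂⁻¹)⁵`. -/
def knot10_123 : Set S3 :=
  closedBraid (List.replicate 5 ([(0, true), (1, false)] : BraidWord)).flatten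

/-! ### Wirtinger generators of a closed braid -/

/-- The closed unit disc with the three points removed. -/
abbrev Page : Type := {z : ℂ // ‖z‖ ≤ 1 ∧ ∀ j : Fin 3, z ≠ puncture j}

/-- The inclusion of the closed disc `arg w = 0` in `S³`. -/
def pageToSphere (z : ℂ) (hz : ‖z‖ ≤ 1) : S3 :=
  ⟨!₂[z, (Real.sqrt (1 - ‖z‖ ^ 2) : ℂ)], by
    have h : 0 ≤ 1 - ‖z‖ ^ 2 := by nlinarith [norm_nonneg z]
    rw [mem_sphere_zero_iff_norm, EuclideanSpace.norm_eq]
    simp [Fin.sum_univ_two, abs_of_nonneg (Real.sqrt_nonneg _), Real.sq_sqrt h]⟩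

theorem strand_norm_lt (l : BraidLetter) (j : Fin 3) (s : ℝ) : ‖strand l j s‖ < 1 := by
  have hp : ∀ x : ℝ, ‖Complex.exp (x * Complex.I)‖ = 1 := Complex.norm_exp_ofReal_mul_I
  obtain ⟨i, ε⟩ := l
  have hexp : ‖Complex.exp ((if ε then 1 else -1) * (Real.pi * s : ℝ) * Complex.I)‖ = 1 := by
    cases ε
    · simpa using hp (-(Real.pi * s))
    · simpa using hp (Real.pi * s)
  by_cases h : j = i.castSucc ∨ j = i.succ
  · simp only [strand, if_pos h]
    refine (norm_add_le _ _).trans_lt ?_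
    rw [norm_mul, hexp]
    fin_cases i <;> fin_cases j <;> first | exact absurd h (by decide) | norm_num [puncture]
  · simp only [strand, if_neg h]
    fin_cases j <;> norm_num [puncture]

theorem strand_zero (l : BraidLetter) (j : Fin 3) : strand l j 0 = puncture j := by
  unfold strand
  split_ifs <;> simp

theorem strand_one (l : BraidLetter) (j : Fin 3) : ∃ k, strand l j 1 = puncture k := by
  obtain ⟨i, ε⟩ := l
  have hexp : Complex.exp ((if ε then 1 else -1) * (Real.pi * 1 : ℝ) * Complex.I) = -1 := by
    cases ε
    · simp [Complex.exp_neg]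
    · simp
  unfold strand
  rw [hexp]
  split_ifs with h
  · rcases h with h | h
    · refine ⟨i.succ, ?_⟩
      simp only [h]
      ring
    · refine ⟨i.castSucc, ?_⟩
      simp only [h]
      ring
  · exact ⟨j, rfl⟩

theorem pageToSphere_notMem (w : BraidWord) (z : Page) :
    pageToSphere z.1 z.2.1 ∈ (closedBraid w)ᶜ := by
  rintro ⟨k, j, s, ⟨hs0, hs1⟩, h0, h1⟩
  have hz : z.1 = strand (w.get k) j s := h0
  have hlt := strand_norm_lt (w.get k) j s
  have hpos : 0 < Real.sqrt (1 - ‖strand (w.get k) j s‖ ^ 2) := by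
    apply Real.sqrt_pos.2
    nlinarith [norm_nonneg (strand (w.get k) j s)]
  have h1' : ((Real.sqrt (1 - ‖z.1‖ ^ 2) : ℝ) : ℂ) = _ := h1
  rw [hz] at h1'
  have hne : ((Real.sqrt (1 - ‖strand (w.get k) j s‖ ^ 2) : ℝ) : ℂ) ≠ 0 := by
    exact_mod_cast hpos.ne'
  have he := (mul_eq_left₀ hne).1 h1'.symm
  obtain ⟨n, hn⟩ := Complex.exp_eq_one_iff.1 he
  have hk : (k : ℕ) + 1 ≤ w.length := k.2
  have hN : (0 : ℝ) < w.length := by exact_mod_cast (by omega : 0 < w.length)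
  have hn' : (2 * Real.pi * (((k : ℕ) + s) / w.length) : ℝ) = n * (2 * Real.pi) := by
    have := congrArg Complex.im hn
    simpa using this
  have hn2 : ((k : ℕ) + s : ℝ) = n * w.length := by
    have hpi := Real.pi_pos
    have : (((k : ℕ) + s) / w.length : ℝ) = n := by
      apply mul_left_cancel₀ (by positivity : (2 * Real.pi) ≠ 0)
      rw [hn']
      ring
    rw [← this]
    field_simp
  have hkr : ((k : ℕ) : ℝ) + 1 ≤ w.length := by exact_mod_cast hk
  have hk0 : (0 : ℝ) ≤ (k : ℕ) := Nat.cast_nonneg _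
  have hend : s = 0 ∨ s = 1 := by
    rcases lt_trichotomy n 0 with h | h | h
    · have : (n : ℝ) ≤ -1 := by exact_mod_cast (by omega : n ≤ -1)
      nlinarith
    · left
      rw [h] at hn2
      simp at hn2
      linarith
    · right
      have : (1 : ℝ) ≤ n := by exact_mod_cast h
      nlinarith
  rcases hend with h | h
  · rw [h, strand_zero] at hz
    exact z.2.2 _ hz
  · obtain ⟨m, hm⟩ := strand_one (w.get k) j
    rw [h, hm] at hz
    exact z.2.2 _ hz

/-- The inclusion of the punctured disc `arg w = 0` in the complement of a closed braid. -/
def pageMap (w : BraidWord) : C(Page, ↥(closedBraid w)ᶜ) where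
  toFun z := ⟨pageToSphere z.1 z.2.1, pageToSphere_notMem w z⟩
  continuous_toFun := by
    refine Continuous.subtype_mk (Continuous.subtype_mk ?_ _) _
    refine (PiLp.continuous_toLp 2 _).comp ?_
    refine continuous_pi fun i => ?_
    fin_cases i
    · exact continuous_subtype_val
    · exact Complex.continuous_ofReal.comp
        (Real.continuous_sqrt.comp (by fun_prop))

/-- The base point `i` on the boundary of the disc. -/
def pageBase : Page := ⟨Complex.I, by simp, by
  intro j h
  have := congrArg Complex.im h
  fin_cases j <;> simp [puncture] at this⟩

/-- The base point `(i, 0)` of the complement of a closed braid. -/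
def axisPoint (w : BraidWord) : ↥(closedBraid w)ᶜ := pageMap w pageBase

/-- The triangular loop in `ℂ` that starts at `i` and goes once clockwise around the `j`-th of the
points `-1/2, 0, 1/2`. -/
def triangle (j : Fin 3) : Path Complex.I Complex.I :=
  (Path.segment Complex.I (puncture j + (1 - Complex.I) / 8)).trans
    ((Path.segment (puncture j + (1 - Complex.I) / 8) (puncture j - (1 + Complex.I) / 8)).trans
      (Path.segment (puncture j - (1 + Complex.I) / 8) Complex.I))

theorem triangle_mem (j : Fin 3) (t : unitInterval) :
    ‖triangle j t‖ ≤ 1 ∧ ∀ k : Fin 3, triangle j t ≠ puncture k := by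
  have hb : ‖puncture j + (1 - Complex.I) / 8‖ ≤ 1 := by
    rw [← sq_le_one_iff₀ (norm_nonneg _), ← Complex.normSq_eq_norm_sq, Complex.normSq_apply]
    fin_cases j <;> norm_num [puncture]
  have hc : ‖puncture j - (1 + Complex.I) / 8‖ ≤ 1 := by
    rw [← sq_le_one_iff₀ (norm_nonneg _), ← Complex.normSq_eq_norm_sq, Complex.normSq_apply]
    fin_cases j <;> norm_num [puncture]
  have hi : ‖Complex.I‖ ≤ 1 := by simp
  have hball : ∀ a b x : ℂ, ‖a‖ ≤ 1 → ‖b‖ ≤ 1 → x ∈ segment ℝ a b → ‖x‖ ≤ 1 := by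
    intro a b x ha hb hx
    have := (convex_closedBall (0 : ℂ) 1).segment_subset
      (mem_closedBall_zero_iff.2 ha) (mem_closedBall_zero_iff.2 hb) hx
    exact mem_closedBall_zero_iff.1 this
  have hmem : triangle j t ∈ Set.range (triangle j) := ⟨t, rfl⟩
  rw [triangle, Path.trans_range, Path.trans_range, Path.range_segment, Path.range_segment,
    Path.range_segment, ← triangle] at hmem
  generalize triangle j t = x at hmem
  rcases hmem with h | h | h
  · refine ⟨hball _ _ _ hi hb h, ?_⟩
    rintro k rfl
    obtain ⟨u, v, hu, hv, huv, h⟩ := h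
    have hre := congrArg Complex.re h
    have him := congrArg Complex.im h
    fin_cases j <;> fin_cases k <;> norm_num [puncture] at hre him <;> linarith
  · refine ⟨hball _ _ _ hb hc h, ?_⟩
    rintro k rfl
    obtain ⟨u, v, hu, hv, huv, h⟩ := h
    have him := congrArg Complex.im h
    fin_cases j <;> fin_cases k <;> norm_num [puncture] at him <;> linarith
  · refine ⟨hball _ _ _ hc hi h, ?_⟩
    rintro k rfl
    obtain ⟨u, v, hu, hv, huv, h⟩ := h
    have hre := congrArg Complex.re h
    have him := congrArg Complex.im h
    fin_cases j <;> fin_cases k <;> norm_num [puncture] at hre him <;> linarith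

/-- The triangular loop in the punctured disc. -/
def pageLoop (j : Fin 3) : Path pageBase pageBase where
  toFun t := ⟨triangle j t, triangle_mem j t⟩
  continuous_toFun := by fun_prop
  source' := Subtype.ext (triangle j).source
  target' := Subtype.ext (triangle j).target

/-- The `j`-th Wirtinger generator on the left end of the braid word `w`, as an element of the
fundamental group of the complement of its closure. -/
def wirtinger (w : BraidWord) (j : Fin 3) : KnotGroup (closedBraid w) (axisPoint w) :=
  FundamentalGroup.fromPath
    (Path.Homotopic.Quotient.mk ((pageLoop j).map (pageMap w).continuous))

end

/-! Everything is reduced to traces. For a triple with common trace x and tr G₁G₂G₃ = z, the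
alternating letters σ₁, σ₂⁻¹ keep x and z and act on the pair traces by a single recursion, eₙ +
eₙ₊₃ + eₙ₊₁eₙ₊₂ = K with K = xz + x². Start with (tr G₁G₂, tr G₂G₃, tr G₁G₃) = (e₂, e₁, e₀). If the
sequence is 5-periodic, the five letters of b lead to (e₁, e₂, e₀), which are the pair traces of
(G₃⁻¹, G₂⁻¹, G₁⁻¹) (`HasTraces.braidB`). Traces determine an irreducible triple up to conjugation
(`exists_conj_of_traces_eq`), so A exists. Since b preserves p = G₁G₂G₃, also p = A p⁻¹ A⁻¹, and tr
p ≠ ±2 forces tr A = 0, hence A² = −I (`sq_eq_neg_one_of_conj_inv`). The operation * is compatible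
with reversing and inverting labels, so bb* conjugates the triple by A², that is, fixes it
(`braidAct_append_star`).

The 5-periodic sequences form a two-parameter family, given by pentagon relations
(`periodic_relations`). The remaining unknown x has to satisfy the Fricke relation between the seven
traces of a triple, here a cubic in x². The implicit function theorem at one explicit solution gives
an analytic family of triples over a product of two discs (`exists_good_family`). By the identity
theorem its characters form an irreducible set, and a chain point, curve, surface bounds the
dimension below by 2 (`two_le_topologicalKrullDim_of_family`).

A triple fixed by a braid must still be turned into a representation of the actual fundamental
group. Only a homomorphism with prescribed values on the Wirtinger loops is needed, so no
presentation of the group is computed. The complement is covered by three charts (above the strands,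
below them, and between the two strands of a crossing), the labels define a locally constant cocycle
on the overlaps, and its monodromy is the homomorphism (`exists_holonomy`,
`exists_hom_of_braidAct_eq`). Applied to the universal triple fixed by bb*, this yields one
homomorphism through which the whole family factors, so the family of representations of the knot
group is analytic as well.

That the closure is a knot follows from an explicit parametrization which runs three times around
the axis (`isKnot_knot10_123`). -/

open scoped ContDiff Topology

noncomputable section

/-! ### Pairs and triples in `SL₂(ℂ)` -/

/-- `tr [a, b] - 2` as a polynomial in the traces of `a`, `b` and `ab`. -/
def kappa (x y z : ℂ) : ℂ := x ^ 2 + y ^ 2 + z ^ 2 - x * y * z - 4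

theorem SL2C.det_eq (a : SL2C) : a 0 0 * a 1 1 - a 0 1 * a 1 0 = 1 := by
  have := a.2
  rwa [Matrix.det_fin_two] at this

/-- A common eigenvector of a and b lies in the kernel of ab − ba. In this form κ ≠ 0 visibly
excludes one. -/
theorem kappa_eq_neg_det (a b : SL2C) :
    kappa (a : Matrix (Fin 2) (Fin 2) ℂ).trace (b : Matrix (Fin 2) (Fin 2) ℂ).trace
      ((a * b : SL2C) : Matrix (Fin 2) (Fin 2) ℂ).trace =
    -((a : Matrix (Fin 2) (Fin 2) ℂ) * b - (b : Matrix (Fin 2) (Fin 2) ℂ) * a).det := by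
  have ha := a.det_eq
  have hb := b.det_eq
  simp only [kappa, Matrix.SpecialLinearGroup.coe_mul, Matrix.det_fin_two, Matrix.trace_fin_two,
    Matrix.mul_apply, Fin.sum_univ_two, Matrix.sub_apply]
  linear_combination -(a 0 0 + a 1 1) ^ 2 * hb - (b 0 0 + b 1 1) ^ 2 * ha +
    4 * ((a 0 0 * a 1 1 - a 0 1 * a 1 0) * hb + ha)

/-- Two elements of `SL₂(ℂ)` with a common eigenvector have `κ = 0`. -/
theorem kappa_eq_zero_of_common_eigenvector (a b : SL2C) {v : Fin 2 → ℂ} (hv : v ≠ 0) {l m : ℂ}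
    (ha : (a : Matrix (Fin 2) (Fin 2) ℂ) *ᵥ v = l • v)
    (hb : (b : Matrix (Fin 2) (Fin 2) ℂ) *ᵥ v = m • v) :
    kappa (a : Matrix (Fin 2) (Fin 2) ℂ).trace (b : Matrix (Fin 2) (Fin 2) ℂ).trace
      ((a * b : SL2C) : Matrix (Fin 2) (Fin 2) ℂ).trace = 0 := by
  rw [kappa_eq_neg_det, neg_eq_zero, ← Matrix.exists_mulVec_eq_zero_iff]
  refine ⟨v, hv, ?_⟩
  rw [Matrix.sub_mulVec, ← Matrix.mulVec_mulVec, ← Matrix.mulVec_mulVec, ha, hb,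
    Matrix.mulVec_smul, Matrix.mulVec_smul, ha, hb, smul_comm, sub_self]

/-- A representation is irreducible if two of its values have `κ ≠ 0`. -/
theorem RepVar.isIrred_of_kappa_ne_zero {Γ : Type} [Group Γ] (ρ : RepVar Γ) (γ δ : Γ)
    (h : kappa (ρ γ : Matrix (Fin 2) (Fin 2) ℂ).trace (ρ δ : Matrix (Fin 2) (Fin 2) ℂ).trace
      ((ρ γ * ρ δ : SL2C) : Matrix (Fin 2) (Fin 2) ℂ).trace ≠ 0) : ρ.IsIrred := by
  intro W hW
  by_contra hcon
  push Not at hcon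
  obtain ⟨v, hvW, hv⟩ := W.ne_bot_iff.1 hcon.1
  -- A nonzero proper invariant subspace of ℂ² is a line, so v is an eigenvector of every value of
  -- ρ.
  have hrank : Module.finrank ℂ W ≤ 1 := by
    have h2 := Submodule.finrank_lt hcon.2
    simp only [Module.finrank_fin_fun] at h2
    omega
  have key : ∀ u ∈ W, ∃ c : ℂ, u = c • v := by
    intro u hu
    have hv' : (⟨v, hvW⟩ : W) ≠ 0 := fun h => hv (congrArg Subtype.val h)
    have h1 : Module.finrank ℂ W = 1 := by
      have : Nontrivial W := ⟨⟨⟨v, hvW⟩, 0, hv'⟩⟩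
      have := Module.finrank_pos (R := ℂ) (M := W)
      omega
    obtain ⟨c, hc⟩ := (finrank_eq_one_iff_of_nonzero' _ hv').1 h1 ⟨u, hu⟩
    exact ⟨c, (congrArg Subtype.val hc).symm⟩
  obtain ⟨l, hl⟩ := key _ (hW γ v hvW)
  obtain ⟨m, hm⟩ := key _ (hW δ v hvW)
  exact h (kappa_eq_zero_of_common_eigenvector _ _ hv hl hm)

/-- Normal form of a triple whose first two members have no common eigenvector. -/
theorem exists_normalForm (a b : SL2C) (c : Matrix (Fin 2) (Fin 2) ℂ)
    (h : kappa (a : Matrix (Fin 2) (Fin 2) ℂ).trace (b : Matrix (Fin 2) (Fin 2) ℂ).trace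
      ((a * b : SL2C) : Matrix (Fin 2) (Fin 2) ℂ).trace ≠ 0) {l : ℂ}
    (hl : l ^ 2 - (a : Matrix (Fin 2) (Fin 2) ℂ).trace * l + 1 = 0) :
    ∃ P N : Matrix (Fin 2) (Fin 2) ℂ, IsUnit P.det ∧
      (a : Matrix (Fin 2) (Fin 2) ℂ) * P =
        P * !![l, ((a * b : SL2C) : Matrix (Fin 2) (Fin 2) ℂ).trace -
          (b : Matrix (Fin 2) (Fin 2) ℂ).trace * l⁻¹; 0, l⁻¹] ∧
      (b : Matrix (Fin 2) (Fin 2) ℂ) * P =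
        P * !![0, -1; 1, (b : Matrix (Fin 2) (Fin 2) ℂ).trace] ∧
      c * P = P * N := by
  have hl0 : l ≠ 0 := by rintro rfl; simp at hl
  have hdet : ((a : Matrix (Fin 2) (Fin 2) ℂ) - l • (1 : Matrix (Fin 2) (Fin 2) ℂ)).det = 0 := by
    have ha := a.det_eq
    simp only [Matrix.trace_fin_two] at hl
    simp only [Matrix.det_fin_two, Matrix.sub_apply, Matrix.smul_apply, Matrix.one_apply,
      Fin.isValue, smul_eq_mul]
    norm_num
    linear_combination ha + hl
  obtain ⟨v, hv, hav⟩ := Matrix.exists_mulVec_eq_zero_iff.2 hdet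
  have hav' : (a : Matrix (Fin 2) (Fin 2) ℂ) *ᵥ v = l • v := by
    rw [Matrix.sub_mulVec, Matrix.smul_mulVec, Matrix.one_mulVec, sub_eq_zero] at hav
    exact hav
  set u := (b : Matrix (Fin 2) (Fin 2) ℂ) *ᵥ v with hu
  -- The basis is v, bv with v an eigenvector of a. Cayley–Hamilton puts b into companion form, and
  -- tr ab then fixes the corner entry of a.
  let P : Matrix (Fin 2) (Fin 2) ℂ := !![v 0, u 0; v 1, u 1]
  have hP : P.det ≠ 0 := by
    intro h0
    rw [Matrix.det_fin_two_of] at h0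
    have : ∃ m : ℂ, u = m • v := by
      by_cases hv0 : v 0 = 0
      · have hv1 : v 1 ≠ 0 := fun h1 => hv (by ext i; fin_cases i <;> assumption)
        refine ⟨u 1 / v 1, ?_⟩
        have : u 0 = 0 := by
          rw [hv0, zero_mul, zero_sub, neg_eq_zero] at h0
          exact (mul_eq_zero.1 h0).resolve_right hv1
        ext i
        fin_cases i
        · simp [hv0, this]
        · simp [hv1]
      · refine ⟨u 0 / v 0, ?_⟩
        ext i
        fin_cases i
        · simp [hv0]
        · simp only [Fin.mk_one, Pi.smul_apply, smul_eq_mul]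
          field_simp
          linear_combination h0
    obtain ⟨m, hm⟩ := this
    exact h (kappa_eq_zero_of_common_eigenvector _ _ hv hav' hm)
  have hPu : IsUnit P.det := isUnit_iff_ne_zero.2 hP
  have e0 : a 0 0 * v 0 + a 0 1 * v 1 = l * v 0 := by
    simpa [Matrix.mulVec, dotProduct, Fin.sum_univ_two] using congrFun hav' 0
  have e1 : a 1 0 * v 0 + a 1 1 * v 1 = l * v 1 := by
    simpa [Matrix.mulVec, dotProduct, Fin.sum_univ_two] using congrFun hav' 1
  have u0 : u 0 = b 0 0 * v 0 + b 0 1 * v 1 := by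
    simp [u]
  have u1 : u 1 = b 1 0 * v 0 + b 1 1 * v 1 := by
    simp [u]
  have ha := a.det_eq
  have hb := b.det_eq
  refine ⟨P, P⁻¹ * c * P, hPu, ?_, ?_, ?_⟩
  · have htr : l⁻¹ = a 0 0 + a 1 1 - l := by
      simp only [Matrix.trace_fin_two] at hl
      field_simp
      linear_combination hl
    rw [htr]
    ext i j
    fin_cases i <;> fin_cases j <;>
      simp [P, Matrix.mul_apply, Fin.sum_univ_two, Matrix.trace_fin_two, u0, u1]
    · linear_combination e0
    · linear_combination b 1 1 * e0 - b 0 1 * e1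
    · linear_combination e1
    · linear_combination b 0 0 * e1 - b 1 0 * e0
  · ext i j
    fin_cases i <;> fin_cases j <;>
      simp [P, Matrix.mul_apply, Fin.sum_univ_two, Matrix.trace_fin_two, u0, u1]
    · linear_combination (-v 0) * hb
    · linear_combination (-v 1) * hb
  · rw [← mul_assoc, ← mul_assoc, Matrix.mul_nonsing_inv _ hPu, one_mul]

/-- A `2 × 2` matrix is determined by its traces against the normal form of an irreducible pair. -/
theorem eq_of_normalForm_traces {l s m : ℂ} (hl0 : l ≠ 0)
    (hk : kappa (l + l⁻¹) m (s + m * l⁻¹) ≠ 0) {N N' : Matrix (Fin 2) (Fin 2) ℂ}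
    (h1 : N.trace = N'.trace) (h2 : (!![l, s; 0, l⁻¹] * N).trace = (!![l, s; 0, l⁻¹] * N').trace)
    (h3 : (!![0, -1; 1, m] * N).trace = (!![0, -1; 1, m] * N').trace)
    (h4 : (!![l, s; 0, l⁻¹] * !![0, -1; 1, m] * N).trace =
      (!![l, s; 0, l⁻¹] * !![0, -1; 1, m] * N').trace) : N = N' := by
  simp only [kappa] at hk
  set k := l⁻¹ with hkdef
  have hlk : l * k = 1 := mul_inv_cancel₀ hl0
  simp [Matrix.trace_fin_two, Matrix.vecMul, dotProduct, Fin.sum_univ_two] at h1 h2 h3 h4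
  -- This is κ after using lk = 1, and up to sign the determinant of the linear system `f2`, `f4`
  -- for two entries of N − N'.
  have hk' : s ^ 2 + (l - k) ^ 2 - s * m * (l - k) ≠ 0 := by
    intro h0
    apply hk
    linear_combination h0 + (4 - m ^ 2) * hlk
  have f2 : (l - k) * (N 0 0 - N' 0 0) + s * (N 1 0 - N' 1 0) = 0 := by
    linear_combination h2 - k * h1
  have f3 : (N 0 1 - N' 0 1) = (N 1 0 - N' 1 0) + m * (N 0 0 - N' 0 0) := by
    linear_combination h3 - m * h1
  have f4 : s * (N 0 0 - N' 0 0) + (-l + s * m + k) * (N 1 0 - N' 1 0) = 0 := by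
    linear_combination h4 - k * m * h1 - k * f3
  have g0 : N 0 0 - N' 0 0 = 0 := by
    refine (mul_eq_zero.1 ?_).resolve_left hk'
    linear_combination s * f4 - (-l + s * m + k) * f2
  have g2 : N 1 0 - N' 1 0 = 0 := by
    refine (mul_eq_zero.1 ?_).resolve_left hk'
    linear_combination s * f2 - (l - k) * f4
  rw [g0, g2, mul_zero, add_zero] at f3
  rw [sub_eq_zero] at g0 g2 f3
  ext i j
  fin_cases i <;> fin_cases j
  · exact g0
  · exact f3
  · exact g2
  · simpa [g0] using h1

theorem trace_eq_of_mul_eq {P M N : Matrix (Fin 2) (Fin 2) ℂ} (hP : IsUnit P.det)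
    (h : M * P = P * N) : M.trace = N.trace := by
  have : M = P * N * P⁻¹ := by rw [← h, Matrix.mul_nonsing_inv_cancel_right _ _ hP]
  rw [this, Matrix.trace_mul_cycle, Matrix.nonsing_inv_mul _ hP, one_mul]

/-- Triples in `SL₂(ℂ)` with the same traces are conjugate, if the first two members generate an
irreducible subgroup. -/
theorem exists_conj_of_traces_eq (g h : Fin 3 → SL2C)
    (hk : kappa (g 0 : Matrix (Fin 2) (Fin 2) ℂ).trace (g 1 : Matrix (Fin 2) (Fin 2) ℂ).trace
      ((g 0 * g 1 : SL2C) : Matrix (Fin 2) (Fin 2) ℂ).trace ≠ 0)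
    (h1 : ∀ i, (g i : Matrix (Fin 2) (Fin 2) ℂ).trace = (h i : Matrix (Fin 2) (Fin 2) ℂ).trace)
    (h01 : ((g 0 * g 1 : SL2C) : Matrix (Fin 2) (Fin 2) ℂ).trace =
      ((h 0 * h 1 : SL2C) : Matrix (Fin 2) (Fin 2) ℂ).trace)
    (h02 : ((g 0 * g 2 : SL2C) : Matrix (Fin 2) (Fin 2) ℂ).trace =
      ((h 0 * h 2 : SL2C) : Matrix (Fin 2) (Fin 2) ℂ).trace)
    (h12 : ((g 1 * g 2 : SL2C) : Matrix (Fin 2) (Fin 2) ℂ).trace =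
      ((h 1 * h 2 : SL2C) : Matrix (Fin 2) (Fin 2) ℂ).trace)
    (h012 : ((g 0 * g 1 * g 2 : SL2C) : Matrix (Fin 2) (Fin 2) ℂ).trace =
      ((h 0 * h 1 * h 2 : SL2C) : Matrix (Fin 2) (Fin 2) ℂ).trace) :
    ∃ A : SL2C, ∀ i, g i = A * h i * A⁻¹ := by
  obtain ⟨l, hl⟩ : ∃ l : ℂ, l ^ 2 - (g 0 : Matrix (Fin 2) (Fin 2) ℂ).trace * l + 1 = 0 := by
    obtain ⟨d, hd⟩ := IsAlgClosed.exists_pow_nat_eq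
      ((g 0 : Matrix (Fin 2) (Fin 2) ℂ).trace ^ 2 - 4) (n := 2) (by norm_num)
    exact ⟨((g 0 : Matrix (Fin 2) (Fin 2) ℂ).trace + d) / 2, by linear_combination hd / 4⟩
  have hl0 : l ≠ 0 := by rintro rfl; simp at hl
  have hll : l + l⁻¹ = (g 0 : Matrix (Fin 2) (Fin 2) ℂ).trace := by
    field_simp
    linear_combination hl
  obtain ⟨P, N, hP, ha, hb, hc⟩ := exists_normalForm (g 0) (g 1) (g 2) hk hl
  obtain ⟨P', N', hP', ha', hb', hc'⟩ := exists_normalForm (h 0) (h 1) (h 2)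
    (by rwa [← h1, ← h1, ← h01]) (l := l) (by rwa [← h1])
  rw [← h01, ← h1 1] at ha'
  rw [← h1 1] at hb'
  set s := ((g 0 * g 1 : SL2C) : Matrix (Fin 2) (Fin 2) ℂ).trace -
          (g 1 : Matrix (Fin 2) (Fin 2) ℂ).trace * l⁻¹ with hs
  set m := (g 1 : Matrix (Fin 2) (Fin 2) ℂ).trace with hm
  have mulEq : ∀ {P M N M' N' : Matrix (Fin 2) (Fin 2) ℂ}, M * P = P * N → M' * P = P * N' →
      M * M' * P = P * (N * N') := by
    intro P M N M' N' h h'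
    rw [mul_assoc, h', ← mul_assoc, h, mul_assoc]
  have hN : N = N' := by
    refine eq_of_normalForm_traces (l := l) (s := s) (m := m) hl0 ?_ ?_ ?_ ?_ ?_
    · rw [hll, hs, sub_add_cancel]
      exact hk
    · rw [← trace_eq_of_mul_eq hP hc, ← trace_eq_of_mul_eq hP' hc', h1]
    · rw [← trace_eq_of_mul_eq hP (mulEq ha hc), ← trace_eq_of_mul_eq hP' (mulEq ha' hc')]
      exact h02
    · rw [← trace_eq_of_mul_eq hP (mulEq hb hc), ← trace_eq_of_mul_eq hP' (mulEq hb' hc')]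
      exact h12
    · rw [← trace_eq_of_mul_eq hP (mulEq (mulEq ha hb) hc),
        ← trace_eq_of_mul_eq hP' (mulEq (mulEq ha' hb') hc')]
      exact h012
  have hM : IsUnit (P * P'⁻¹).det := by
    rw [Matrix.det_mul]
    exact hP.mul ((Matrix.isUnit_nonsing_inv_det_iff).2 hP')
  -- Scaling by this square root moves P P'⁻¹ into SL₂ and leaves the conjugation by it unchanged.
  obtain ⟨e, he⟩ := IsAlgClosed.exists_pow_nat_eq ((P * P'⁻¹).det⁻¹) (n := 2) (by norm_num)
  let A : SL2C := ⟨e • (P * P'⁻¹), by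
    rw [Matrix.det_smul, Fintype.card_fin, he, inv_mul_cancel₀ hM.ne_zero]⟩
  have inter : ∀ {M M' R : Matrix (Fin 2) (Fin 2) ℂ}, M * P = P * R → M' * P' = P' * R →
      M * (e • (P * P'⁻¹)) = e • (P * P'⁻¹) * M' := by
    intro M M' R h h'
    have : M' = P' * R * P'⁻¹ := by rw [← h', Matrix.mul_nonsing_inv_cancel_right _ _ hP']
    rw [this, Matrix.mul_smul, Matrix.smul_mul, ← mul_assoc M, h]
    congr 1
    simp only [mul_assoc]
    rw [Matrix.nonsing_inv_mul_cancel_left _ _ hP']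
  refine ⟨A, fun i => ?_⟩
  rw [eq_mul_inv_iff_mul_eq]
  apply Matrix.SpecialLinearGroup.ext
  intro p q
  refine congrFun (congrFun (?_ : ((g i * A : SL2C) : Matrix (Fin 2) (Fin 2) ℂ) =
    ((A * h i : SL2C) : Matrix (Fin 2) (Fin 2) ℂ)) p) q
  rw [Matrix.SpecialLinearGroup.coe_mul, Matrix.SpecialLinearGroup.coe_mul]
  fin_cases i
  · exact inter ha ha'
  · exact inter hb hb'
  · exact inter hc (hN ▸ hc')

/-- An element of `SL₂(ℂ)` that conjugates some `p` with `tr p ≠ ±2` to its inverse is a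
half turn. -/
theorem sq_eq_neg_one_of_conj_inv (A p : SL2C) (h2 : (p : Matrix (Fin 2) (Fin 2) ℂ).trace ≠ 2)
    (h2' : (p : Matrix (Fin 2) (Fin 2) ℂ).trace ≠ -2) (h : p = A * p⁻¹ * A⁻¹) : A ^ 2 = -1 := by
  have hA := A.det_eq
  have hp := p.det_eq
  rw [eq_mul_inv_iff_mul_eq] at h
  have hm : ((p * A : SL2C) : Matrix (Fin 2) (Fin 2) ℂ) =
    ((A * p⁻¹ : SL2C) : Matrix (Fin 2) (Fin 2) ℂ) := congrArg _ h
  rw [Matrix.SpecialLinearGroup.coe_mul, Matrix.SpecialLinearGroup.coe_mul,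
    Matrix.SpecialLinearGroup.coe_inv, Matrix.adjugate_fin_two] at hm
  have e := fun i j => congrFun (congrFun hm i) j
  have e00 := e 0 0
  have e01 := e 0 1
  have e10 := e 1 0
  have e11 := e 1 1
  simp [Matrix.mul_apply, Fin.sum_univ_two] at e00 e01 e10 e11
  rw [Matrix.trace_fin_two] at h2 h2'
  -- As p⁻¹ = tr p − p, the hypothesis reads pA + Ap = (tr p)A. Its trace, and its trace after
  -- multiplication by p, give (tr p)² tr A = 4 tr A. Cayley–Hamilton for A then yields A² = −I.
  have htr : A 0 0 + A 1 1 = 0 := by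
    have hne : (p 0 0 + p 1 1 - 2) * (p 0 0 + p 1 1 + 2) ≠ 0 :=
      mul_ne_zero (sub_ne_zero.2 h2) (by rwa [Ne, add_eq_zero_iff_eq_neg])
    refine (mul_eq_zero.1 ?_).resolve_left hne
    linear_combination -(p 0 0 + p 1 1) * (e00 + e11) +
      2 * (p 0 0 * e00 + p 0 1 * e10 + p 1 0 * e01 + p 1 1 * e11) + 4 * (A 0 0 + A 1 1) * hp
  apply Matrix.SpecialLinearGroup.ext
  intro i j
  rw [pow_two]
  fin_cases i <;> fin_cases j <;> simp [Matrix.mul_apply, Fin.sum_univ_two]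
  · linear_combination -hA + A 0 0 * htr
  · linear_combination A 0 1 * htr
  · linear_combination A 1 0 * htr
  · linear_combination -hA + A 1 1 * htr

/-! ### The action of braids on triples -/

/-- The triple `(g₃⁻¹, g₂⁻¹, g₁⁻¹)`. -/
def revInv {M : Type} [Group M] (g : Fin 3 → M) : Fin 3 → M := fun i => (g i.rev)⁻¹

theorem letterAct_map {M N : Type} [Group M] [Group N] (f : M →* N) (l : BraidLetter)
    (g : Fin 3 → M) : letterAct l (fun i => f (g i)) = fun i => f (letterAct l g i) := by
  obtain ⟨i, ε⟩ := l
  funext j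
  fin_cases i <;> cases ε <;> fin_cases j <;> simp [letterAct]

/-- This compatibility is what the operation * is made for: the action of `braidStar w` can be read
off from that of w. -/
theorem letterAct_revInv {M : Type} [Group M] (l : BraidLetter) (g : Fin 3 → M) :
    letterAct (Fin.rev l.1, !l.2) (revInv g) = revInv (letterAct l g) := by
  obtain ⟨i, ε⟩ := l
  funext j
  have h0 : Fin.rev (0 : Fin 3) = 2 := rfl
  have h1 : Fin.rev (1 : Fin 3) = 1 := rfl
  have h2 : Fin.rev (2 : Fin 3) = 0 := rfl
  have k0 : Fin.rev (0 : Fin 2) = 1 := rfl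
  have k1 : Fin.rev (1 : Fin 2) = 0 := rfl
  fin_cases i <;> cases ε <;> fin_cases j <;>
    simp [letterAct, revInv, h0, h1, h2, k0, k1, mul_assoc]

/-- Hurwitz moves preserve the total product. It serves twice: as the element that A inverts, and as
the value of the cocycle to the right of all strands. -/
theorem letterAct_prod {M : Type} [Group M] (l : BraidLetter) (g : Fin 3 → M) :
    letterAct l g 0 * letterAct l g 1 * letterAct l g 2 = g 0 * g 1 * g 2 := by
  obtain ⟨i, ε⟩ := l
  fin_cases i <;> cases ε <;> simp [letterAct, mul_assoc]

theorem braidAct_cons {M : Type} [Group M] (l : BraidLetter) (w : BraidWord) (g : Fin 3 → M) :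
    braidAct (l :: w) g = braidAct w (letterAct l g) := rfl

theorem braidAct_append {M : Type} [Group M] (v w : BraidWord) (g : Fin 3 → M) :
    braidAct (v ++ w) g = braidAct w (braidAct v g) := List.foldl_append

theorem braidAct_map {M N : Type} [Group M] [Group N] (f : M →* N) (w : BraidWord)
    (g : Fin 3 → M) : braidAct w (fun i => f (g i)) = fun i => f (braidAct w g i) := by
  induction w generalizing g with
  | nil => rfl
  | cons l w ih => rw [braidAct_cons, braidAct_cons, letterAct_map, ih]

theorem braidAct_star {M : Type} [Group M] (w : BraidWord) (g : Fin 3 → M) :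
    braidAct (braidStar w) (revInv g) = revInv (braidAct w g) := by
  induction w generalizing g with
  | nil => rfl
  | cons l w ih =>
    rw [braidAct_cons, ← ih, ← letterAct_revInv]
    rfl

theorem braidAct_prod {M : Type} [Group M] (w : BraidWord) (g : Fin 3 → M) :
    braidAct w g 0 * braidAct w g 1 * braidAct w g 2 = g 0 * g 1 * g 2 := by
  induction w generalizing g with
  | nil => rfl
  | cons l w ih => rw [braidAct_cons, ih, letterAct_prod]

/-- If `w` takes `g` to a conjugate of `(g₃⁻¹, g₂⁻¹, g₁⁻¹)` by a half turn, then `w w*` fixes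
`g`. -/
theorem braidAct_append_star {w : BraidWord} {g : Fin 3 → SL2C} {A : SL2C}
    (h : ∀ i, braidAct w g i = A * (g i.rev)⁻¹ * A⁻¹) (hA : A ^ 2 = -1) :
    braidAct (w ++ braidStar w) g = g := by
  -- The second half of the braid ends in the double conjugate of g by A, and A² = −I is central.
  have hA' : ∀ x : SL2C, A * (A * x * A⁻¹) * A⁻¹ = x := by
    intro x
    have : A * (A * x * A⁻¹) * A⁻¹ = A ^ 2 * x * (A ^ 2)⁻¹ := by
      simp [pow_two, mul_assoc]
    rw [this, hA]
    simp
  have h1 : braidAct w g = fun i => (MulAut.conj A).toMonoidHom (revInv g i) := funext h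
  rw [braidAct_append]
  conv_lhs => rw [h1]
  rw [braidAct_map, braidAct_star, h1]
  funext i
  simp only [revInv, MulEquiv.coe_toMonoidHom, MulAut.conj_apply, Fin.rev_rev, mul_inv_rev,
    inv_inv]
  simpa [mul_assoc] using hA' (g i)

/-! ### Traces along a braid -/

/-- The trace of an element of `SL₂(ℂ)`. -/
def tr (g : SL2C) : ℂ := (g : Matrix (Fin 2) (Fin 2) ℂ).trace

theorem tr_mul_comm (g h : SL2C) : tr (g * h) = tr (h * g) := by
  simp only [tr, Matrix.SpecialLinearGroup.coe_mul]
  exact Matrix.trace_mul_comm _ _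

theorem tr_inv (g : SL2C) : tr g⁻¹ = tr g := by
  simp only [tr, Matrix.SpecialLinearGroup.coe_inv, Matrix.adjugate_fin_two, Matrix.trace_fin_two]
  simp [add_comm]

/-- Cayley–Hamilton, h⁻¹ = tr h − h. All trace computations along the braid rest on this identity.
-/
theorem tr_mul_inv (g h : SL2C) : tr (g * h⁻¹) = tr g * tr h - tr (g * h) := by
  simp only [tr, Matrix.SpecialLinearGroup.coe_mul, Matrix.SpecialLinearGroup.coe_inv,
    Matrix.adjugate_fin_two, Matrix.trace_fin_two, Matrix.mul_apply, Fin.sum_univ_two]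
  simp
  ring

theorem tr_conj (g h : SL2C) : tr (h * g * h⁻¹) = tr g := by
  rw [tr_mul_comm]
  simp

/-- The members of `g` have trace `x`, and `a`, `b`, `c`, `z` are the traces of `g₁g₂`, `g₂g₃`,
`g₁g₃` and `g₁g₂g₃`. -/
structure HasTraces (g : Fin 3 → SL2C) (x a b c z : ℂ) : Prop where
  single : ∀ i, tr (g i) = x
  h01 : tr (g 0 * g 1) = a
  h12 : tr (g 1 * g 2) = b
  h02 : tr (g 0 * g 2) = c
  h012 : tr (g 0 * g 1 * g 2) = z

/-- Two of the new pair traces are old ones. The third belongs to g₂⁻¹(g₁g₂g₃), and `tr_mul_inv`,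
used repeatedly, expresses it through the given traces. -/
theorem HasTraces.letterAct_zero {g : Fin 3 → SL2C} {x a b c z : ℂ} (h : HasTraces g x a b c z) :
    HasTraces (letterAct (0, true) g) x a (x * z + x ^ 2 - a * b - c) b z where
  single i := by
    fin_cases i
    · exact h.single 1
    · have := tr_conj (g 0) (g 1)⁻¹
      rw [inv_inv] at this
      exact this.trans (h.single 0)
    · exact h.single 2
  h01 := by
    rw [← h.h01]
    simp [letterAct, mul_assoc]
  h12 := by
    have e1 : tr (g 1 * (g 0 * g 1 * g 2)) = a * b - (x ^ 2 - c) := by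
      have e := tr_mul_inv (g 1 * g 0) (g 1 * g 2)
      have e' : tr (g 1 * g 0 * (g 1 * g 2)⁻¹) = tr (g 0 * (g 2)⁻¹) := by
        rw [mul_inv_rev, ← mul_assoc, mul_assoc (g 1), tr_conj]
      rw [e', tr_mul_inv, h.single, h.single, h.h02, tr_mul_comm (g 1) (g 0), h.h01, h.h12] at e
      rw [mul_assoc (g 0), ← mul_assoc (g 1)]
      linear_combination e
    have e2 := tr_mul_inv (g 0 * g 1 * g 2) (g 1)
    rw [tr_mul_comm, h.single, h.h012, tr_mul_comm _ (g 1), e1] at e2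
    have : letterAct (0, true) g 1 * letterAct (0, true) g 2 = (g 1)⁻¹ * (g 0 * g 1 * g 2) := by
      simp [letterAct, mul_assoc]
    rw [this, e2]
    ring
  h02 := h.h12
  h012 := by rw [letterAct_prod, h.h012]

theorem HasTraces.letterAct_one_inv {g : Fin 3 → SL2C} {x a b c z : ℂ}
    (h : HasTraces g x a b c z) :
    HasTraces (letterAct (1, false) g) x (x * z + x ^ 2 - a * b - c) b a z where
  single i := by
    fin_cases i
    · exact h.single 0
    · exact (tr_conj (g 2) (g 1)).trans (h.single 2)
    · exact h.single 1
  h01 := by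
    have e1 : tr (g 0 * g 1 * g 2 * g 1) = a * b - (x ^ 2 - c) := by
      have e := tr_mul_inv (g 0 * g 1) (g 2 * g 1)
      have e' : g 0 * g 1 * (g 2 * g 1)⁻¹ = g 0 * (g 2)⁻¹ := by
        simp [mul_assoc]
      rw [e', tr_mul_inv, h.single, h.single, h.h02, tr_mul_comm (g 2) (g 1), h.h01, h.h12,
        ← mul_assoc] at e
      linear_combination e
    have e2 := tr_mul_inv (g 0 * g 1 * g 2) (g 1)
    rw [h.single, h.h012, e1] at e2
    have : letterAct (1, false) g 0 * letterAct (1, false) g 1 = g 0 * g 1 * g 2 * (g 1)⁻¹ := by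
      simp [letterAct, mul_assoc]
    rw [this, e2]
    ring
  h12 := by
    rw [← h.h12]
    simp [letterAct, mul_assoc]
  h02 := h.h01
  h012 := by rw [letterAct_prod, h.h012]

theorem HasTraces.revInv {g : Fin 3 → SL2C} {x a b c z : ℂ} (h : HasTraces g x a b c z) :
    HasTraces (revInv g) x b a c z where
  single i := (tr_inv _).trans (h.single _)
  h01 := by
    rw [← h.h12, ← tr_inv (g 1 * g 2), mul_inv_rev]
    rfl
  h12 := by
    rw [← h.h01, ← tr_inv (g 0 * g 1), mul_inv_rev]
    rfl
  h02 := by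
    rw [← h.h02, ← tr_inv (g 0 * g 2), mul_inv_rev]
    rfl
  h012 := by
    rw [← h.h012, ← tr_inv (g 0 * g 1 * g 2), mul_inv_rev, mul_inv_rev, ← mul_assoc]
    rfl

/-- The traces at the right end of the braid `b`: they are given by a recursion of order three. -/
theorem HasTraces.braidB {g : Fin 3 → SL2C} {x z e0 e1 e2 e3 e4 : ℂ}
    (h : HasTraces g x e2 e1 e0 z)
    (h0 : e0 + e3 + e1 * e2 = x * z + x ^ 2) (h1 : e1 + e4 + e2 * e3 = x * z + x ^ 2)
    (h2 : e2 + e0 + e3 * e4 = x * z + x ^ 2) (h3 : e3 + e1 + e4 * e0 = x * z + x ^ 2)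
    (h4 : e4 + e2 + e0 * e1 = x * z + x ^ 2) :
    HasTraces (braidAct braidB g) x e1 e2 e0 z := by
  -- Each letter drops the oldest trace and creates the next one: (e₂,e₁,e₀), (e₂,e₃,e₁),
  -- (e₄,e₃,e₂), (e₄,e₀,e₃), (e₁,e₀,e₄), (e₁,e₂,e₀).
  have s1 := h.letterAct_zero
  rw [show x * z + x ^ 2 - e2 * e1 - e0 = e3 by linear_combination -h0] at s1
  have s2 := s1.letterAct_one_inv
  rw [show x * z + x ^ 2 - e2 * e3 - e1 = e4 by linear_combination -h1] at s2
  have s3 := s2.letterAct_zero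
  rw [show x * z + x ^ 2 - e4 * e3 - e2 = e0 by linear_combination -h2] at s3
  have s4 := s3.letterAct_one_inv
  rw [show x * z + x ^ 2 - e4 * e0 - e3 = e1 by linear_combination -h3] at s4
  have s5 := s4.letterAct_zero
  rw [show x * z + x ^ 2 - e1 * e0 - e4 = e2 by linear_combination -h4] at s5
  exact s5

/-! ### The Zariski topology of the character variety -/

section Zariski

variable {Γ : Type} [Group Γ]

/-- The function on the character variety that is given by an invariant regular function. -/
def CharVar.eval (f : invariantRing Γ) : CharVar Γ → ℂ :=
  Quotient.lift (f : RepVar Γ → ℂ) fun _ _ h => h f f.2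

theorem CharVar.eval_mk (f : invariantRing Γ) (ρ : RepVar Γ) :
    CharVar.eval f (CharVar.mk ρ) = (f : RepVar Γ → ℂ) ρ := rfl

theorem CharVar.mk_surjective : Function.Surjective (CharVar.mk : RepVar Γ → CharVar Γ) :=
  Quotient.mk_surjective

theorem CharVar.isOpen_eval_ne_zero (f : invariantRing Γ) : IsOpen {χ | CharVar.eval f χ ≠ 0} := by
  refine TopologicalSpace.isOpen_generateFrom_of_mem ⟨f, f.2, ?_⟩
  ext χ
  obtain ⟨ρ, rfl⟩ := CharVar.mk_surjective χ
  constructor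
  · exact fun h => ⟨ρ, h, rfl⟩
  · rintro ⟨ρ', h, he⟩
    rw [Set.mem_ofPred_eq, ← he]
    exact h

theorem CharVar.isClosed_eval_eq_zero (f : invariantRing Γ) :
    IsClosed {χ | CharVar.eval f χ = 0} :=
  ⟨CharVar.isOpen_eval_ne_zero f⟩

/-- Every open neighbourhood contains a basic one. -/
theorem CharVar.exists_eval_ne_zero {O : Set (CharVar Γ)} (hO : IsOpen O) {χ : CharVar Γ}
    (hχ : χ ∈ O) : ∃ f : invariantRing Γ, CharVar.eval f χ ≠ 0 ∧
      ∀ χ', CharVar.eval f χ' ≠ 0 → χ' ∈ O := by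
  induction hO with
  | basic s hs =>
    obtain ⟨f, hf, rfl⟩ := hs
    refine ⟨⟨f, hf⟩, ?_, fun χ' h => ?_⟩
    · obtain ⟨ρ, h, rfl⟩ := hχ
      exact h
    · obtain ⟨ρ, rfl⟩ := CharVar.mk_surjective χ'
      exact ⟨ρ, h, rfl⟩
  | univ =>
    obtain ⟨ρ, rfl⟩ := CharVar.mk_surjective χ
    exact ⟨1, by rw [CharVar.eval_mk]; exact one_ne_zero, fun _ _ => trivial⟩
  | inter s t _ _ hs ht =>
    obtain ⟨f, hf, hf'⟩ := hs hχ.1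
    obtain ⟨g, hg, hg'⟩ := ht hχ.2
    have hmul : ∀ χ, CharVar.eval (f * g) χ = CharVar.eval f χ * CharVar.eval g χ := by
      intro χ
      obtain ⟨ρ, rfl⟩ := CharVar.mk_surjective χ
      rfl
    refine ⟨f * g, by rw [hmul]; exact mul_ne_zero hf hg, fun χ' h => ?_⟩
    rw [hmul] at h
    exact ⟨hf' _ (left_ne_zero_of_mul h), hg' _ (right_ne_zero_of_mul h)⟩
  | sUnion S _ ih =>
    obtain ⟨s, hs, hχs⟩ := hχ
    obtain ⟨f, hf, hf'⟩ := ih s hs hχs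
    exact ⟨f, hf, fun χ' h => ⟨s, hs, hf' χ' h⟩⟩

/-- The regular function `[ρ] ↦ tr ρ(γ)`. -/
def traceFun (γ : Γ) : invariantRing Γ :=
  ⟨fun ρ => tr (ρ γ), by
    refine ⟨?_, fun g ρ => tr_conj _ _⟩
    have : (fun ρ : RepVar Γ => tr (ρ γ)) =
        (fun ρ : RepVar Γ => (ρ γ : Matrix (Fin 2) (Fin 2) ℂ) 0 0) +
        fun ρ : RepVar Γ => (ρ γ : Matrix (Fin 2) (Fin 2) ℂ) 1 1 := by
      funext ρ
      simp [tr, Matrix.trace_fin_two]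
    rw [this]
    exact add_mem (Algebra.subset_adjoin ⟨γ, 0, 0, rfl⟩) (Algebra.subset_adjoin ⟨γ, 1, 1, rfl⟩)⟩

theorem eval_traceFun (γ : Γ) (ρ : RepVar Γ) :
    CharVar.eval (traceFun γ) (CharVar.mk ρ) = tr (ρ γ) := rfl

end Zariski

/-! ### Analytic families of representations -/

section AnalyticFamily

variable {Γ : Type} [Group Γ] {E : Type} [NormedAddCommGroup E] [NormedSpace ℂ E]

/-- The values at `γ` of a family of representations are analytic functions on `B`. -/
def IsAnalyticAtElement (B : Set E) (ρ : E → RepVar Γ) (γ : Γ) : Prop :=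
  ∀ i j, AnalyticOnNhd ℂ (fun a => (ρ a γ : Matrix (Fin 2) (Fin 2) ℂ) i j) B

theorem isAnalyticAtElement_of_closure {B : Set E} {ρ : E → RepVar Γ} {S : Set Γ}
    (hS : Subgroup.closure S = ⊤) (h : ∀ γ ∈ S, IsAnalyticAtElement B ρ γ) (γ : Γ) :
    IsAnalyticAtElement B ρ γ := by
  have hγ : γ ∈ Subgroup.closure S := hS ▸ Subgroup.mem_top γ
  induction hγ using Subgroup.closure_induction with
  | mem x hx => exact h x hx
  | one =>
    intro i j
    simp only [map_one]
    exact analyticOnNhd_const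
  | mul x y _ _ hx hy =>
    intro i j
    simp only [map_mul, Matrix.SpecialLinearGroup.coe_mul, Matrix.mul_apply, Fin.sum_univ_two]
    exact ((hx i 0).mul (hy 0 j)).add ((hx i 1).mul (hy 1 j))
  | inv x _ hx =>
    intro i j
    simp only [map_inv, Matrix.SpecialLinearGroup.coe_inv, Matrix.adjugate_fin_two]
    fin_cases i <;> fin_cases j
    · exact hx 1 1
    · exact (hx 0 1).neg
    · exact (hx 1 0).neg
    · exact hx 0 0

theorem analyticOnNhd_of_mem_repCoordRing {B : Set E} {ρ : E → RepVar Γ}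
    (h : ∀ γ, IsAnalyticAtElement B ρ γ) {f : RepVar Γ → ℂ} (hf : f ∈ repCoordRing Γ) :
    AnalyticOnNhd ℂ (fun a => f (ρ a)) B := by
  induction hf using Algebra.adjoin_induction with
  | mem f hf =>
    obtain ⟨γ, i, j, rfl⟩ := hf
    exact h γ i j
  | algebraMap c => exact analyticOnNhd_const
  | add f g _ _ hf hg => exact hf.add hg
  | mul f g _ _ hf hg => exact hf.mul hg

/-- The characters of an analytic family over a connected set form an irreducible set. -/
theorem isIrreducible_image_of_analytic {B : Set E} (hBo : IsOpen B) (hB : IsPreconnected B)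
    (hne : B.Nonempty)
    {ρ : E → RepVar Γ} (h : ∀ γ, IsAnalyticAtElement B ρ γ) :
    IsIrreducible ((fun a => CharVar.mk (ρ a)) '' B) := by
  refine ⟨hne.image _, ?_⟩
  rintro u v hu hv ⟨_, ⟨a, ha, rfl⟩, hau⟩ ⟨_, ⟨b, hb, rfl⟩, hbv⟩
  obtain ⟨f, hf, hfu⟩ := CharVar.exists_eval_ne_zero hu hau
  obtain ⟨g, hg, hgv⟩ := CharVar.exists_eval_ne_zero hv hbv
  have hfa := analyticOnNhd_of_mem_repCoordRing h f.2.1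
  have hga := analyticOnNhd_of_mem_repCoordRing h g.2.1
  by_contra hcon
  -- Without a common point, fg vanishes along the family. Near a the factor f has no zero, so g
  -- vanishes there, and by the identity theorem also at b.
  have hz : ∀ c ∈ B, (f : RepVar Γ → ℂ) (ρ c) = 0 ∨ (g : RepVar Γ → ℂ) (ρ c) = 0 := by
    intro c hc
    by_contra! hc'
    exact hcon ⟨_, ⟨c, hc, rfl⟩, hfu _ hc'.1, hgv _ hc'.2⟩
  have hfa' : ∀ᶠ c in nhds a, (f : RepVar Γ → ℂ) (ρ c) ≠ 0 :=
    (hfa a ha).continuousAt.eventually_ne hf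
  refine hg (hga.eqOn_zero_of_preconnected_of_eventuallyEq_zero hB ha ?_ hb)
  filter_upwards [hfa', hBo.mem_nhds ha] with c hc hcB
  exact (hz c hcB).resolve_left hc

end AnalyticFamily

/-! ### Krull dimension -/

theorem IsIrreducible.preimage_val {X : Type*} [TopologicalSpace X] {U S : Set X}
    (h : IsIrreducible S) (hS : S ⊆ U) : IsIrreducible ((↑) ⁻¹' S : Set U) := by
  have := Subtype.irreducibleSpace h
  have h2 : ((↑) ⁻¹' S : Set U) = Set.inclusion hS '' Set.univ := by
    ext x
    constructor
    · exact fun hx => ⟨⟨x, hx⟩, trivial, rfl⟩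
    · rintro ⟨y, -, rfl⟩
      exact y.2
  rw [h2]
  exact (IrreducibleSpace.isIrreducible_univ _).image _ (continuous_inclusion hS).continuousOn

/-- A point, an irreducible set and a larger irreducible set in `U` that are separated by closed
sets show that `U` has dimension at least two. -/
theorem two_le_topologicalKrullDim {X : Type*} [TopologicalSpace X] {U S T C D : Set X} {x : X}
    (hS : IsIrreducible S) (hT : IsIrreducible T) (hxS : x ∈ S) (hST : S ⊆ T) (hTU : T ⊆ U)
    (hC : IsClosed C) (hD : IsClosed D) (hxC : x ∈ C) (hSC : ¬S ⊆ C) (hSD : S ⊆ D)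
    (hTD : ¬T ⊆ D) : 2 ≤ topologicalKrullDim U := by
  have hSU := hST.trans hTU
  have hx : IsIrreducible ({x} : Set X) := isIrreducible_singleton
  have hxU : {x} ⊆ U := Set.singleton_subset_iff.2 (hSU hxS)
  let Z : ∀ A : Set X, IsIrreducible A → A ⊆ U → TopologicalSpace.IrreducibleCloseds U :=
    fun A hA hAU => ⟨closure ((↑) ⁻¹' A), (hA.preimage_val hAU).closure, isClosed_closure⟩
  -- The inclusion stays strict after taking closures in U, because the closed set F contains A but
  -- not B.
  have hlt : ∀ (A B F : Set X) (hA : IsIrreducible A) (hB : IsIrreducible B) (hAU : A ⊆ U)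
      (hBU : B ⊆ U), A ⊆ B → IsClosed F → A ⊆ F → ¬B ⊆ F → Z A hA hAU < Z B hB hBU := by
    intro A B F hA hB hAU hBU hAB hF hAF hBF
    refine lt_of_le_not_ge (closure_mono (Set.preimage_mono hAB)) fun hle => hBF fun b hb => ?_
    have h1 : (⟨b, hBU hb⟩ : U) ∈ closure ((↑) ⁻¹' A : Set U) := hle (subset_closure hb)
    exact closure_minimal (t := ((↑) ⁻¹' F : Set U)) (Set.preimage_mono hAF)
      (hF.preimage continuous_subtype_val) h1
  let p : LTSeries (TopologicalSpace.IrreducibleCloseds U) :=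
    { length := 2
      toFun := ![Z {x} hx hxU, Z S hS hSU, Z T hT hTU]
      step := fun i => by
        fin_cases i
        · exact hlt _ _ C hx hS hxU hSU (Set.singleton_subset_iff.2 hxS) hC
            (Set.singleton_subset_iff.2 hxC) hSC
        · exact hlt _ _ D hS hT hSU hTU hST hD hSD hTD }
  exact Order.LTSeries.length_le_krullDim p

/-! ### A two-dimensional family of triples -/

/-- Implicit functions of one complex unknown. -/
theorem exists_analyticAt_implicit {E : Type*} [NormedAddCommGroup E] [NormedSpace ℂ E]
    [CompleteSpace E] {F : E × ℂ → ℂ} {a : E} {y c : ℂ} (hF : ContDiffAt ℂ ω F (a, y))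
    (h0 : F (a, y) = 0) (hc : c ≠ 0) (hd : HasDerivAt (fun s => F (a, s)) c y) :
    ∃ φ : E → ℂ, AnalyticAt ℂ φ a ∧ φ a = y ∧ ∀ᶠ b in 𝓝 a, F (b, φ b) = 0 := by
  have hω : (ω : WithTop ℕ∞) ≠ 0 := by simp
  have hL : fderiv ℂ F (a, y) ∘L .inr ℂ E ℂ = ContinuousLinearMap.toSpanSingleton ℂ c := by
    have h1 : HasFDerivAt F (fderiv ℂ F (a, y)) (a, y) := (hF.differentiableAt hω).hasFDerivAt
    have h2 : HasFDerivAt (fun s : ℂ => (a, s)) (ContinuousLinearMap.inr ℂ E ℂ) y := by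
      exact hasFDerivAt_prodMk_right a y
    exact (h1.comp y h2).unique hd.hasFDerivAt
  have hinv : (fderiv ℂ F (a, y) ∘L .inr ℂ E ℂ).IsInvertible := by
    rw [hL]
    refine ⟨ContinuousLinearEquiv.unitsEquivAut ℂ (Units.mk0 c hc), ?_⟩
    ext
    simp
  refine ⟨hF.implicitFunction hω hinv, (hF.contDiffAt_implicitFunction hω hinv).analyticAt,
    hF.implicitFunction_apply_self hω hinv, ?_⟩
  simpa [h0] using hF.eventually_apply_implicitFunction hω hinv

/-- The third trace of a `5`-periodic solution of the trace recursion. -/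
def periodicR (p q : ℂ) : ℂ := p * q / ((1 - p) * (1 - q))

/-- The constant of a `5`-periodic solution of the trace recursion. -/
def periodicK (p q : ℂ) : ℂ := 1 + p + periodicR p q * q - p / (1 - q)

/-- With e₀ = p, e₁ = r, e₂ = q, the formulas solve the pentagon relations (1 − eᵢ)(1 − eᵢ₊₁) =
eᵢ₊₃, indices modulo 5. Expanding one of them turns eᵢ₋₁ + eᵢ₊₂ + eᵢeᵢ₊₁ into e₀ + e₁ + e₂ + e₃ + e₄
− 1. This is independent of i and equals K. -/
theorem periodic_relations {p q : ℂ} (hp : 1 - p ≠ 0) (hq : 1 - q ≠ 0) :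
    let r := periodicR p q
    let K := periodicK p q
    let e3 := K - r * q - p
    let e4 := K - p * r - q
    p + e3 + r * q = K ∧ r + e4 + q * e3 = K ∧ q + p + e3 * e4 = K ∧ e3 + r + e4 * p = K ∧
      e4 + q + p * r = K := by
  intro r K e3 e4
  refine ⟨by ring, ?_, ?_, ?_, by ring⟩ <;>
  · simp only [e3, e4, K, r, periodicK, periodicR]
    field_simp
    ring

/-- The equation between the traces of `gᵢ`, `g₁g₂`, `g₂g₃`, `g₁g₃` and `g₁g₂g₃`. -/
def fricke (x a b c z : ℂ) : ℂ :=
  z ^ 2 + 3 * x ^ 2 - 4 + a ^ 2 + b ^ 2 + c ^ 2 + a * b * c - (x * z + x ^ 2) * (a + b + c) +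
    x ^ 3 * z

/-- A discriminant of the pair of the first two matrices of `tripleMat`. -/
def pairDisc (x t : ℂ) : ℂ := x ^ 2 * (t - 1) ^ 2 / t - (t - t⁻¹) ^ 2

/-- The upper left entry of the third matrix. -/
def entryU (x t b c z : ℂ) : ℂ :=
  ((t - t⁻¹) * (z - t * x) - x * (t - 1) * (b - x ^ 2 + c / t)) / pairDisc x t

/-- The lower left entry of the third matrix. -/
def entryM (x t b c z : ℂ) : ℂ :=
  (x * (t - 1) / t * (z - t * x) - (t - t⁻¹) * (b - x ^ 2 + c / t)) / pairDisc x t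

/-- Three matrices with prescribed traces. -/
def tripleMat (x t b c z : ℂ) : Fin 3 → Matrix (Fin 2) (Fin 2) ℂ :=
  ![!![x, -1; 1, 0], !![0, t; -t⁻¹, x],
    !![entryU x t b c z, c - x * entryU x t b c z + entryM x t b c z;
      entryM x t b c z, x - entryU x t b c z]]

/-- Cramer's rule for the two linear conditions tr g₂g₃ = b and tr g₁g₂g₃ = z on the third matrix.
For t ≠ 0 the determinant `pairDisc x t` is −κ(x, x, t + t⁻¹), so it is nonzero exactly when the
first two matrices form an irreducible pair. -/
theorem entry_relations {x t b c z : ℂ} (hD : pairDisc x t ≠ 0) :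
    (t - t⁻¹) * entryM x t b c z - x * (t - 1) / t * entryU x t b c z = b - x ^ 2 + c / t ∧
    x * (t - 1) * entryM x t b c z - (t - t⁻¹) * entryU x t b c z = z - t * x := by
  have h : pairDisc x t = x ^ 2 * (t - 1) ^ 2 / t - (t - t⁻¹) ^ 2 := rfl
  constructor
  · rw [entryM, entryU]
    rw [← mul_div_assoc, ← mul_div_assoc, ← sub_div, div_eq_iff hD, h]
    ring
  · rw [entryM, entryU]
    rw [← mul_div_assoc, ← mul_div_assoc, ← sub_div, div_eq_iff hD, h]
    ring

theorem tripleMat_det {x t b c z : ℂ} (ht : t ≠ 0) (hD : pairDisc x t ≠ 0)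
    (hF : fricke x (t + t⁻¹) b c z = 0) (i : Fin 3) : (tripleMat x t b c z i).det = 1 := by
  fin_cases i
  · simp [tripleMat]
  · simp [tripleMat, ht]
  · simp only [tripleMat, Fin.reduceFinMk, Matrix.cons_val, Matrix.det_fin_two_of]
    obtain ⟨h1, h2⟩ := entry_relations (b := b) (c := c) (z := z) hD
    generalize entryU x t b c z = u at *
    generalize entryM x t b c z = m at *
    have hb : b = (t - t⁻¹) * m - x * (t - 1) / t * u + x ^ 2 - c / t := by
      linear_combination -h1
    have hz : z = x * (t - 1) * m - (t - t⁻¹) * u + t * x := by linear_combination -h2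
    -- After elimination of b and z, the Fricke polynomial is the discriminant times (det − 1) of
    -- the third matrix.
    have key : pairDisc x t * (u * (x - u) - (c - x * u + m) * m - 1) = 0 := by
      rw [← hF, fricke, pairDisc, hb, hz]
      field_simp
      ring
    linear_combination (mul_eq_zero.1 key).resolve_left hD

/-- The matrices `tripleMat` as elements of `SL₂(ℂ)`. -/
def tripleSL (x t b c z : ℂ) (i : Fin 3) : SL2C :=
  -- The default 1 makes the triple a total function of the parameters; good parameters never meet
  -- it.
  if h : (tripleMat x t b c z i).det = 1 then ⟨tripleMat x t b c z i, h⟩ else 1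

theorem coe_tripleSL {x t b c z : ℂ} (ht : t ≠ 0) (hD : pairDisc x t ≠ 0)
    (hF : fricke x (t + t⁻¹) b c z = 0) (i : Fin 3) :
    (tripleSL x t b c z i : Matrix (Fin 2) (Fin 2) ℂ) = tripleMat x t b c z i := by
  have : tripleSL x t b c z i = ⟨tripleMat x t b c z i, tripleMat_det ht hD hF i⟩ := dif_pos _
  rw [this]

theorem hasTraces_tripleSL {x t b c z : ℂ} (ht : t ≠ 0) (hD : pairDisc x t ≠ 0)
    (hF : fricke x (t + t⁻¹) b c z = 0) :
    HasTraces (tripleSL x t b c z) x (t + t⁻¹) b c z := by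
  have hc := coe_tripleSL ht hD hF
  obtain ⟨h1, h2⟩ := entry_relations (b := b) (c := c) (z := z) hD
  constructor
  · intro i
    rw [tr, hc]
    fin_cases i <;> simp [tripleMat, Matrix.trace_fin_two]
  all_goals
    rw [tr]
    simp only [Matrix.SpecialLinearGroup.coe_mul, hc, tripleMat, Matrix.trace_fin_two,
      Matrix.mul_apply, Fin.sum_univ_two]
    generalize entryU x t b c z = u at *
    generalize entryM x t b c z = m at *
    simp
  · ring
  · field_simp at h1 ⊢
    linear_combination h1
  · ring
  · field_simp at h2 ⊢
    linear_combination h2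

/-- The equation for the trace of the generators in terms of the traces of `g₁g₃` and `g₁g₂`. -/
def traceEq (p q x : ℂ) : ℂ :=
  x ^ 6 - (4 + periodicK p q) * x ^ 4 + (4 + 2 * periodicK p q -
    (p ^ 2 + q ^ 2 + periodicR p q ^ 2 + p * q * periodicR p q -
      periodicK p q * (p + q + periodicR p q))) * x ^ 2 - periodicK p q ^ 2

/-- The substitution z = (K − x²)/x, which encodes K = xz + x², turns −x² times the Fricke
polynomial into `traceEq`, a cubic in x². -/
theorem fricke_of_traceEq {p q x : ℂ} (hx : x ≠ 0) (h : traceEq p q x = 0) :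
    fricke x q (periodicR p q) p ((periodicK p q - x ^ 2) / x) = 0 := by
  have h2 : x ^ 2 * fricke x q (periodicR p q) p ((periodicK p q - x ^ 2) / x) = 0 := by
    rw [← neg_eq_zero, ← h, fricke, traceEq]
    field_simp
    ring
  exact (mul_eq_zero.1 h2).resolve_left (pow_ne_zero 2 hx)

/-- The traces of a triple and of its image under `b`, for a solution of `traceEq`. -/
theorem braidB_traces {p t x : ℂ} (ht : t ≠ 0) (hx : x ≠ 0) (hp : 1 - p ≠ 0)
    (hq : 1 - (t + t⁻¹) ≠ 0) (hD : pairDisc x t ≠ 0) (h : traceEq p (t + t⁻¹) x = 0) :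
    let q := t + t⁻¹
    let r := periodicR p q
    let z := (periodicK p q - x ^ 2) / x
    HasTraces (tripleSL x t r p z) x q r p z ∧
      HasTraces (braidAct braidB (tripleSL x t r p z)) x r q p z := by
  intro q r z
  have h1 : HasTraces (tripleSL x t r p z) x q r p z :=
    hasTraces_tripleSL ht hD (fricke_of_traceEq hx h)
  refine ⟨h1, ?_⟩
  have hK : x * z + x ^ 2 = periodicK p q := by
    simp only [z]
    field_simp
    ring
  obtain ⟨k0, k1, k2, k3, k4⟩ := periodic_relations hp hq
  rw [← hK] at k0 k1 k2 k3 k4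
  exact h1.braidB k0 k1 k2 k3 k4

/-- The conditions on the parameters under which `tripleSL` gives a triple in the family. -/
structure IsGoodParameter (p t x : ℂ) : Prop where
  t_ne : t ≠ 0
  x_ne : x ≠ 0
  p_ne : 1 - p ≠ 0
  q_ne : 1 - (t + t⁻¹) ≠ 0
  disc_ne : pairDisc x t ≠ 0
  kappa_ne : kappa x x (periodicR p (t + t⁻¹)) ≠ 0
  z_ne : (periodicK p (t + t⁻¹) - x ^ 2) / x ≠ 2
  z_ne' : (periodicK p (t + t⁻¹) - x ^ 2) / x ≠ -2
  eq : traceEq p (t + t⁻¹) x = 0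

/-- The base point is p = 0, t = i. There q = r = 0 and K = 1, and `traceEq` reduces to X³ − 5X² +
6X − 1 = 0 for X = x². This has a root with nonvanishing derivative in x, so x continues
analytically; the remaining conditions are open and are checked at the base point. -/
theorem exists_good_family : ∃ (φ : ℂ × ℂ → ℂ) (ε : ℝ), 0 < ε ∧
    AnalyticOnNhd ℂ φ (Metric.ball 0 ε ×ˢ Metric.ball Complex.I ε) ∧
    ∀ a ∈ (Metric.ball 0 ε ×ˢ Metric.ball Complex.I ε : Set (ℂ × ℂ)),
      IsGoodParameter a.1 a.2 (φ a) := by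
  obtain ⟨X, hX⟩ : ∃ X : ℂ, X ^ 3 - 5 * X ^ 2 + 6 * X - 1 = 0 := by
    obtain ⟨X, hX⟩ := IsAlgClosed.exists_root
      (Polynomial.X ^ 3 - 5 * Polynomial.X ^ 2 + 6 * Polynomial.X - 1 : Polynomial ℂ) (by
        have : (Polynomial.X ^ 3 - 5 * Polynomial.X ^ 2 + 6 * Polynomial.X - 1 :
            Polynomial ℂ).degree = 3 := by compute_degree!
        rw [this]
        norm_num)
    exact ⟨X, by simpa [Polynomial.IsRoot] using hX⟩
  obtain ⟨y, rfl⟩ := IsAlgClosed.exists_pow_nat_eq X (n := 2) (by norm_num)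
  have hII : Complex.I + Complex.I⁻¹ = 0 := by simp
  have hy0 : y ≠ 0 := by rintro rfl; norm_num at hX
  have hR : periodicR 0 0 = 0 := by simp [periodicR]
  have hK : periodicK 0 0 = 1 := by simp [periodicK, hR]
  let F : (ℂ × ℂ) × ℂ → ℂ := fun u => traceEq u.1.1 (u.1.2 + u.1.2⁻¹) u.2
  have hF : ContDiffAt ℂ ω F ((0, Complex.I), y) := by
    simp only [F, traceEq, periodicK, periodicR]
    fun_prop (disch := simp)
  have hF0 : F ((0, Complex.I), y) = 0 := by
    simp only [F, hII, traceEq, hR, hK]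
    linear_combination hX
  have hd : HasDerivAt (fun s => F ((0, Complex.I), s)) (6 * y ^ 5 - 20 * y ^ 3 + 12 * y) y := by
    have : (fun s => F ((0, Complex.I), s)) = fun s => s ^ 6 - 5 * s ^ 4 + 6 * s ^ 2 - 1 := by
      funext s
      simp only [F, hII, traceEq, hR, hK]
      ring
    rw [this]
    convert! ((((hasDerivAt_pow 6 y).sub ((hasDerivAt_pow 4 y).const_mul 5)).add
      ((hasDerivAt_pow 2 y).const_mul 6)).sub_const 1) using 1
    norm_num
    ring
  have hc : 6 * y ^ 5 - 20 * y ^ 3 + 12 * y ≠ 0 := by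
    intro h
    have h' : 3 * (y ^ 2) ^ 2 - 10 * y ^ 2 + 6 = 0 := by
      refine (mul_eq_zero.1 (?_ : y * _ = 0)).resolve_left hy0
      linear_combination h / 2
    -- One Euclidean division of the cubic in X = y² by its derivative leaves a linear remainder,
    -- whose root does not satisfy `h'`.
    have hX' : y ^ 2 = 3 / 2 := by
      linear_combination (-9 / 14 : ℂ) * (hX - (y ^ 2 / 3 - 5 / 9) * h')
    rw [hX'] at h'
    norm_num at h'
  obtain ⟨φ, hφ, hφy, hφF⟩ := exists_analyticAt_implicit hF hF0 hc hd
  have hgood : ∀ᶠ a in 𝓝 ((0 : ℂ), Complex.I), 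
      AnalyticAt ℂ φ a ∧ IsGoodParameter a.1 a.2 (φ a) := by
    have hφc := hφ.continuousAt
    have hy2 : y ^ 2 ≠ 2 := by
      intro h
      rw [h] at hX
      norm_num at hX
    have open_cond : ∀ {f : (ℂ × ℂ) × ℂ → ℂ} (e : ℂ), ContinuousAt f ((0, Complex.I), y) →
        f ((0, Complex.I), y) ≠ e → ∀ᶠ a in 𝓝 ((0 : ℂ), Complex.I), f (a, φ a) ≠ e := by
      intro f e hf hne
      have hpair : ContinuousAt (fun a => (a, φ a)) ((0 : ℂ), Complex.I) :=
        continuousAt_id.prodMk hφc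
      have hf' : ContinuousAt (fun a => f (a, φ a)) ((0 : ℂ), Complex.I) :=
        ContinuousAt.comp (g := f) (by rw [hφy]; exact hf) hpair
      exact hf'.eventually_ne (by simpa only [hφy] using hne)
    have c1 := open_cond (f := fun u => u.1.2) (0) (by fun_prop) (by simp)
    have c2 := open_cond (f := fun u => u.2) (0) (by fun_prop) hy0
    have c3 := open_cond (f := fun u => 1 - u.1.1) (0) (by fun_prop) (by simp)
    have c4 := open_cond (f := fun u => 1 - (u.1.2 + u.1.2⁻¹)) (0)
      (by fun_prop (disch := simp)) (by simp)
    have c5 := open_cond (f := fun u => pairDisc u.2 u.1.2) (0)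
      (by simp only [pairDisc]; fun_prop (disch := simp)) (by
        intro h
        have h1 : pairDisc y Complex.I = -2 * y ^ 2 + 4 := by
          rw [pairDisc, Complex.inv_I, Complex.div_I]
          linear_combination (2 * y ^ 2 - 4 - y ^ 2 * Complex.I) * Complex.I_sq
        refine hy2 ?_
        linear_combination (h1 - h) / 2)
    have c6 := open_cond (f := fun u => kappa u.2 u.2 (periodicR u.1.1 (u.1.2 + u.1.2⁻¹))) (0)
      (by simp only [kappa, periodicR]; fun_prop (disch := simp)) (by
        intro h
        simp only [hII, hR, kappa] at h
        refine hy2 ?_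
        linear_combination h / 2)
    have hz : ∀ e : ℂ, e ^ 2 = 4 → (1 - y ^ 2) / y ≠ e := by
      intro e he h
      rw [div_eq_iff hy0] at h
      have h2 : (1 - y ^ 2) ^ 2 = 4 * y ^ 2 := by
        rw [h, mul_pow, he]
      -- Again a Euclidean division: modulo (1 − X)² = 4X the cubic becomes 11X − 2.
      have h3 : y ^ 2 = 2 / 11 := by
        linear_combination (1 / 11 : ℂ) * (hX - (y ^ 2 + 1) * h2)
      rw [h3] at h2
      norm_num at h2
    have c7 := open_cond (f := fun u => (periodicK u.1.1 (u.1.2 + u.1.2⁻¹) - u.2 ^ 2) / u.2) (2)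
      (by
        simp only [periodicK, periodicR]
        fun_prop (disch := simp)) (by
        simp only [hII, hK]
        exact hz 2 (by norm_num))
    have c8 := open_cond (f := fun u => (periodicK u.1.1 (u.1.2 + u.1.2⁻¹) - u.2 ^ 2) / u.2) (-2)
      (by
        simp only [periodicK, periodicR]
        fun_prop (disch := simp)) (by
        simp only [hII, hK]
        exact hz (-2) (by norm_num))
    filter_upwards [hφ.eventually_analyticAt, hφF, c1, c2, c3, c4, c5, c6, c7, c8]
      with a a0 aF a1 a2 a3 a4 a5 a6 a7 a8
    exact ⟨a0, a1, a2, a3, a4, a5, a6, a7, a8, aF⟩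
  obtain ⟨ε, hε, h⟩ := Metric.eventually_nhds_iff_ball.1 hgood
  refine ⟨φ, ε, hε, ?_, ?_⟩
  · intro a ha
    exact (h a (by rwa [← ball_prod_same])).1
  · intro a ha
    exact (h a (by rwa [← ball_prod_same])).2

/-! ### The locally closed set of twisted triples -/

/-- The trace conditions for `b` to take `g` to a conjugate of `(g₃⁻¹, g₂⁻¹, g₁⁻¹)` by a half
turn. -/
structure IsTwisted (g : Fin 3 → SL2C) : Prop where
  single : ∀ i j, tr (g i) = tr (g j)
  single_braidB : ∀ i, tr (braidAct braidB g i) = tr (revInv g i)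
  pair_braidB : ∀ i j, i < j →
    tr (braidAct braidB g i * braidAct braidB g j) = tr (revInv g i * revInv g j)
  kappa_ne : kappa (tr (braidAct braidB g 0)) (tr (braidAct braidB g 1))
    (tr (braidAct braidB g 0 * braidAct braidB g 1)) ≠ 0
  prod_ne : tr (g 0 * g 1 * g 2) ≠ 2
  prod_ne' : tr (g 0 * g 1 * g 2) ≠ -2

/-- The condition κ ≠ 0 is imposed on H₁, H₂, the pair to which the normal form is applied. These
are words in the Gᵢ, so it also gives irreducibility of the triple itself. -/
theorem IsTwisted.isIrred {g : Fin 3 → SL2C} (h : IsTwisted g) :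
    RepVar.IsIrred (FreeGroup.lift g) := by
  refine RepVar.isIrred_of_kappa_ne_zero _ (braidAct braidB FreeGroup.of 0)
    (braidAct braidB FreeGroup.of 1) ?_
  have hb := braidAct_map (FreeGroup.lift g) braidB FreeGroup.of
  simp only [FreeGroup.lift_apply_of] at hb
  have h2 := h.kappa_ne
  rw [show braidAct braidB g = braidAct braidB fun i => g i from rfl, hb] at h2
  exact h2

theorem revInv_prod {M : Type} [Group M] (g : Fin 3 → M) :
    revInv g 0 * revInv g 1 * revInv g 2 = (g 0 * g 1 * g 2)⁻¹ := by
  have h0 : Fin.rev (0 : Fin 3) = 2 := rfl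
  have h1 : Fin.rev (1 : Fin 3) = 1 := rfl
  have h2 : Fin.rev (2 : Fin 3) = 0 := rfl
  simp [revInv, h0, h1, h2, mul_assoc]

theorem IsTwisted.exists_conj {g : Fin 3 → SL2C} (h : IsTwisted g) :
    ∃ A : SL2C, ∀ i, braidAct braidB g i = A * (g i.rev)⁻¹ * A⁻¹ := by
  refine exists_conj_of_traces_eq _ (revInv g) h.kappa_ne h.single_braidB
    (h.pair_braidB 0 1 (by decide)) (h.pair_braidB 0 2 (by decide)) (h.pair_braidB 1 2 (by decide))
    ?_
  rw [braidAct_prod, revInv_prod]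
  exact (tr_inv _).symm

/-- Multiplying the three conjugation identities and using the invariance of p = G₁G₂G₃ under b
gives p = A p⁻¹ A⁻¹. -/
theorem IsTwisted.sq_eq {g : Fin 3 → SL2C} (h : IsTwisted g) {A : SL2C}
    (hA : ∀ i, braidAct braidB g i = A * (g i.rev)⁻¹ * A⁻¹) : A ^ 2 = -1 := by
  refine sq_eq_neg_one_of_conj_inv A (g 0 * g 1 * g 2) h.prod_ne h.prod_ne' ?_
  conv_lhs => rw [← braidAct_prod braidB g, hA 0, hA 1, hA 2]
  rw [← revInv_prod]
  simp [revInv, mul_assoc]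

theorem IsTwisted.braidAct_eq {g : Fin 3 → SL2C} (h : IsTwisted g) :
    braidAct (braidB ++ braidStar braidB) g = g := by
  obtain ⟨A, hA⟩ := h.exists_conj
  exact braidAct_append_star hA (h.sq_eq hA)

/-- The set of characters of twisted triples. -/
def twistedLocus : Set (CharVar (FreeGroup (Fin 3))) :=
  {χ | (∀ i j, CharVar.eval (traceFun (FreeGroup.of i) - traceFun (FreeGroup.of j)) χ = 0) ∧
    (∀ i, CharVar.eval (traceFun (braidAct braidB FreeGroup.of i) -
      traceFun (revInv FreeGroup.of i)) χ = 0) ∧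
    ∀ i j, i < j → CharVar.eval
      (traceFun (braidAct braidB FreeGroup.of i * braidAct braidB FreeGroup.of j) -
        traceFun (revInv FreeGroup.of i * revInv FreeGroup.of j)) χ = 0} ∩
  ({χ | CharVar.eval (traceFun (braidAct braidB FreeGroup.of 0) ^ 2 +
      traceFun (braidAct braidB FreeGroup.of 1) ^ 2 +
      traceFun (braidAct braidB FreeGroup.of 0 * braidAct braidB FreeGroup.of 1) ^ 2 -
      traceFun (braidAct braidB FreeGroup.of 0) * traceFun (braidAct braidB FreeGroup.of 1) *
      traceFun (braidAct braidB FreeGroup.of 0 * braidAct braidB FreeGroup.of 1) -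
      algebraMap ℂ _ 4) χ ≠ 0} ∩
  ({χ | CharVar.eval (traceFun (FreeGroup.of 0 * FreeGroup.of 1 * FreeGroup.of 2) -
      algebraMap ℂ _ 2) χ ≠ 0} ∩
  {χ | CharVar.eval (traceFun (FreeGroup.of 0 * FreeGroup.of 1 * FreeGroup.of 2) -
      algebraMap ℂ _ (-2)) χ ≠ 0}))

theorem isLocallyClosed_twistedLocus : IsLocallyClosed twistedLocus := by
  refine IsLocallyClosed.inter (IsClosed.isLocallyClosed ?_) (IsOpen.isLocallyClosed ?_)
  · simp only [Set.ofPred_and, Set.ofPred_forall]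
    refine IsClosed.inter ?_ (IsClosed.inter ?_ ?_)
    · exact isClosed_iInter fun i => isClosed_iInter fun j => CharVar.isClosed_eval_eq_zero _
    · exact isClosed_iInter fun i => CharVar.isClosed_eval_eq_zero _
    · exact isClosed_iInter fun i => isClosed_iInter fun j => isClosed_iInter fun _ =>
        CharVar.isClosed_eval_eq_zero _
  · exact (CharVar.isOpen_eval_ne_zero _).inter
      ((CharVar.isOpen_eval_ne_zero _).inter (CharVar.isOpen_eval_ne_zero _))

theorem mk_lift_mem_twistedLocus (g : Fin 3 → SL2C) :
    CharVar.mk (FreeGroup.lift g) ∈ twistedLocus ↔ IsTwisted g := by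
  have hb := braidAct_map (FreeGroup.lift g) braidB FreeGroup.of
  simp only [FreeGroup.lift_apply_of] at hb
  have hbi : ∀ i, FreeGroup.lift g (braidAct braidB FreeGroup.of i) = braidAct braidB g i :=
    fun i => (congrFun hb i).symm
  have hri : ∀ i, FreeGroup.lift g (revInv FreeGroup.of i) = revInv g i := by
    intro i
    simp [revInv]
  have hsub : ∀ (u v : invariantRing (FreeGroup (Fin 3))),
      CharVar.eval (u - v) (CharVar.mk (FreeGroup.lift g)) =
        CharVar.eval u (CharVar.mk (FreeGroup.lift g)) -
          CharVar.eval v (CharVar.mk (FreeGroup.lift g)) := fun _ _ => rfl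
  have hadd : ∀ (u v : invariantRing (FreeGroup (Fin 3))),
      CharVar.eval (u + v) (CharVar.mk (FreeGroup.lift g)) =
        CharVar.eval u (CharVar.mk (FreeGroup.lift g)) +
          CharVar.eval v (CharVar.mk (FreeGroup.lift g)) := fun _ _ => rfl
  have hmul : ∀ (u v : invariantRing (FreeGroup (Fin 3))),
      CharVar.eval (u * v) (CharVar.mk (FreeGroup.lift g)) =
        CharVar.eval u (CharVar.mk (FreeGroup.lift g)) *
          CharVar.eval v (CharVar.mk (FreeGroup.lift g)) := fun _ _ => rfl
  have halg : ∀ (c : ℂ), CharVar.eval (algebraMap ℂ (invariantRing (FreeGroup (Fin 3))) c)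
      (CharVar.mk (FreeGroup.lift g)) = c := fun _ => rfl
  simp only [twistedLocus, Set.mem_inter_iff, Set.mem_ofPred_eq, hsub, hadd, hmul, halg, pow_two,
    eval_traceFun, map_mul, hbi, hri, FreeGroup.lift_apply_of, sub_eq_zero, Ne]
  constructor
  · rintro ⟨⟨h1, h2, h3⟩, h4, h5, h6⟩
    refine ⟨h1, h2, h3, ?_, h5, h6⟩
    intro h
    exact h4 (by rw [kappa] at h; linear_combination h)
  · rintro ⟨h1, h2, h3, h4, h5, h6⟩
    refine ⟨⟨h1, h2, h3⟩, fun h => h4 ?_, h5, h6⟩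
    rw [kappa]
    linear_combination h

/-! ### The family of twisted triples and its dimension -/

/-- The triple of a parameter in the family. -/
def familyTriple (φ : ℂ × ℂ → ℂ) (a : ℂ × ℂ) : Fin 3 → SL2C :=
  tripleSL (φ a) a.2 (periodicR a.1 (a.2 + a.2⁻¹)) a.1
    ((periodicK a.1 (a.2 + a.2⁻¹) - φ a ^ 2) / φ a)

theorem familyTriple_traces {φ : ℂ × ℂ → ℂ} {a : ℂ × ℂ} (h : IsGoodParameter a.1 a.2 (φ a)) :
    tr (familyTriple φ a 0 * familyTriple φ a 2) = a.1 ∧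
      tr (familyTriple φ a 0 * familyTriple φ a 1) = a.2 + a.2⁻¹ := by
  obtain ⟨h1, -⟩ := braidB_traces h.t_ne h.x_ne h.p_ne h.q_ne h.disc_ne h.eq
  exact ⟨h1.h02, h1.h01⟩

theorem isTwisted_familyTriple {φ : ℂ × ℂ → ℂ} {a : ℂ × ℂ} (h : IsGoodParameter a.1 a.2 (φ a)) :
    IsTwisted (familyTriple φ a) := by
  obtain ⟨h1, h2⟩ := braidB_traces h.t_ne h.x_ne h.p_ne h.q_ne h.disc_ne h.eq
  have h3 := h1.revInv
  constructor
  · intro i j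
    rw [familyTriple, h1.single, h1.single]
  · intro i
    rw [familyTriple, h2.single, h3.single]
  · intro i j hij
    fin_cases i <;> fin_cases j <;> first | exact absurd hij (by decide) | skip
    · exact h2.h01.trans h3.h01.symm
    · exact h2.h02.trans h3.h02.symm
    · exact h2.h12.trans h3.h12.symm
  · rw [familyTriple, h2.single, h2.single, h2.h01]
    exact h.kappa_ne
  · rw [familyTriple, h1.h012]
    exact h.z_ne
  · rw [familyTriple, h1.h012]
    exact h.z_ne'

theorem analyticAt_tripleMat {E : Type*} [NormedAddCommGroup E] [NormedSpace ℂ E]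
    {X T P : E → ℂ} {e : E} (hX : AnalyticAt ℂ X e) (hT : AnalyticAt ℂ T e)
    (hP : AnalyticAt ℂ P e) (h : IsGoodParameter (P e) (T e) (X e)) (i : Fin 3) (j k : Fin 2) :
    AnalyticAt ℂ (fun a => tripleMat (X a) (T a) (periodicR (P a) (T a + (T a)⁻¹)) (P a)
      ((periodicK (P a) (T a + (T a)⁻¹) - X a ^ 2) / X a) i j k) e := by
  obtain ⟨t_ne, x_ne, p_ne, q_ne, disc_ne, -, -, -, -⟩ := h
  have hI : AnalyticAt ℂ (fun a => (T a)⁻¹) e := hT.inv t_ne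
  have hR : AnalyticAt ℂ (fun a => periodicR (P a) (T a + (T a)⁻¹)) e := by
    simp only [periodicR]
    exact (hP.mul (hT.add hI)).div (by fun_prop) (mul_ne_zero p_ne q_ne)
  have hK : AnalyticAt ℂ (fun a => periodicK (P a) (T a + (T a)⁻¹)) e := by
    have : AnalyticAt ℂ (fun a => P a / (1 - (T a + (T a)⁻¹))) e :=
      hP.div (by fun_prop) q_ne
    simp only [periodicK]
    fun_prop
  have hZ : AnalyticAt ℂ (fun a => (periodicK (P a) (T a + (T a)⁻¹) - X a ^ 2) / X a) e :=
    AnalyticAt.div (by fun_prop) hX x_ne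
  have hPT : AnalyticAt ℂ (fun a => P a / T a) e := hP.div hT t_ne
  have hXT : AnalyticAt ℂ (fun a => X a * (T a - 1) / T a) e :=
    AnalyticAt.div (by fun_prop) hT t_ne
  have hD : AnalyticAt ℂ (fun a => pairDisc (X a) (T a)) e := by
    have : AnalyticAt ℂ (fun a => X a ^ 2 * (T a - 1) ^ 2 / T a) e :=
      AnalyticAt.div (by fun_prop) hT t_ne
    simp only [pairDisc]
    fun_prop
  generalize hr : (fun a => periodicR (P a) (T a + (T a)⁻¹)) = R at *
  generalize hz : (fun a => (periodicK (P a) (T a + (T a)⁻¹) - X a ^ 2) / X a) = Z at *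
  have hr' := congrFun hr
  have hz' := congrFun hz
  simp only [hr', hz']
  have hU : AnalyticAt ℂ (fun a => entryU (X a) (T a) (R a) (P a) (Z a)) e := by
    simp only [entryU]
    exact AnalyticAt.div (by fun_prop) hD disc_ne
  have hM : AnalyticAt ℂ (fun a => entryM (X a) (T a) (R a) (P a) (Z a)) e := by
    simp only [entryM]
    exact AnalyticAt.div (by fun_prop) hD disc_ne
  fin_cases i <;> fin_cases j <;> fin_cases k <;> simp [tripleMat] <;> fun_prop

/-- A subset of a character variety that contains the characters of an analytic family in which
three elements are mapped to the triples of the family has dimension at least two. -/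
theorem two_le_topologicalKrullDim_of_family {Γ : Type} [Group Γ] {φ : ℂ × ℂ → ℂ} {ε : ℝ}
    (hε : 0 < ε)
    (hgood : ∀ a ∈ (Metric.ball 0 ε ×ˢ Metric.ball Complex.I ε : Set (ℂ × ℂ)),
      IsGoodParameter a.1 a.2 (φ a))
    (y : Fin 3 → Γ) (ρ : ℂ × ℂ → RepVar Γ) (U : Set (CharVar Γ))
    (hρ : ∀ a ∈ (Metric.ball 0 ε ×ˢ Metric.ball Complex.I ε : Set (ℂ × ℂ)),
      ∀ i, ρ a (y i) = familyTriple φ a i)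
    (han : ∀ γ, IsAnalyticAtElement (Metric.ball 0 ε ×ˢ Metric.ball Complex.I ε) ρ γ)
    (hU : ∀ a ∈ (Metric.ball 0 ε ×ˢ Metric.ball Complex.I ε : Set (ℂ × ℂ)),
      CharVar.mk (ρ a) ∈ U) : 2 ≤ topologicalKrullDim U := by
  have h0 : (0 : ℂ) ∈ Metric.ball (0 : ℂ) ε := Metric.mem_ball_self hε
  have hI : Complex.I ∈ Metric.ball Complex.I ε := Metric.mem_ball_self hε
  have han' : ∀ γ, IsAnalyticAtElement (Metric.ball Complex.I ε) (fun t : ℂ => ρ (0, t)) γ := by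
    intro γ i j t ht
    exact AnalyticAt.comp (f := fun t : ℂ => ((0 : ℂ), t)) (han γ i j (0, t) ⟨h0, ht⟩)
      (analyticAt_const.prod analyticAt_id)
  have hS := isIrreducible_image_of_analytic Metric.isOpen_ball
    (convex_ball Complex.I ε).isPreconnected ⟨_, hI⟩ han'
  have hT := isIrreducible_image_of_analytic (Metric.isOpen_ball.prod Metric.isOpen_ball)
    ((convex_ball (0 : ℂ) ε).prod (convex_ball Complex.I ε)).isPreconnected ⟨(0, Complex.I), h0, hI⟩
    han
  have htr1 : ∀ a ∈ (Metric.ball 0 ε ×ˢ Metric.ball Complex.I ε : Set (ℂ × ℂ)),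
      CharVar.eval (traceFun (y 0 * y 2)) (CharVar.mk (ρ a)) = a.1 := by
    intro a ha
    rw [eval_traceFun, map_mul, hρ a ha, hρ a ha]
    exact (familyTriple_traces (hgood a ha)).1
  have htr2 : ∀ a ∈ (Metric.ball 0 ε ×ˢ Metric.ball Complex.I ε : Set (ℂ × ℂ)),
      CharVar.eval (traceFun (y 0 * y 1)) (CharVar.mk (ρ a)) = a.2 + a.2⁻¹ := by
    intro a ha
    rw [eval_traceFun, map_mul, hρ a ha, hρ a ha]
    exact (familyTriple_traces (hgood a ha)).2
  -- The chain is the base point, the curve p = 0 and the full family. The trace of y₁y₂ vanishes at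
  -- the point but not on the curve, that of y₁y₃ on the curve but not on the family.
  refine two_le_topologicalKrullDim (x := CharVar.mk (ρ (0, Complex.I))) hS hT
    ⟨Complex.I, hI, rfl⟩ ?_ ?_ (CharVar.isClosed_eval_eq_zero (traceFun (y 0 * y 1)))
    (CharVar.isClosed_eval_eq_zero (traceFun (y 0 * y 2))) ?_ ?_ ?_ ?_
  · rintro _ ⟨t, ht, rfl⟩
    exact ⟨(0, t), ⟨h0, ht⟩, rfl⟩
  · rintro _ ⟨a, ha, rfl⟩
    exact hU a ha
  · rw [Set.mem_ofPred_eq, htr2 _ ⟨h0, hI⟩]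
    simp
  · intro hsub
    have hδ : ((1 + ε / 2 : ℝ) : ℂ) ≠ 0 := by
      exact_mod_cast (by positivity : (1 + ε / 2 : ℝ) ≠ 0)
    -- For t = iδ with δ > 1 one has t + t⁻¹ = i(δ − δ⁻¹) ≠ 0.
    have ht : Complex.I * (1 + ε / 2 : ℝ) ∈ Metric.ball Complex.I ε := by
      rw [Metric.mem_ball, dist_eq_norm]
      have : Complex.I * ((1 + ε / 2 : ℝ) : ℂ) - Complex.I = Complex.I * ((ε / 2 : ℝ) : ℂ) := by
        push_cast
        ring
      rw [this, norm_mul, Complex.norm_I, one_mul, Complex.norm_real, Real.norm_eq_abs,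
        abs_of_pos (by positivity)]
      linarith
    have h := hsub ⟨_, ht, rfl⟩
    rw [Set.mem_ofPred_eq, htr2 _ ⟨h0, ht⟩, mul_inv, Complex.inv_I] at h
    have h2 : (((1 + ε / 2) - (1 + ε / 2)⁻¹ : ℝ) : ℂ) = 0 := by
      refine (mul_eq_zero.1 (?_ : Complex.I * _ = 0)).resolve_left Complex.I_ne_zero
      rw [← h]
      push_cast
      ring
    have h3 : (1 + ε / 2) - (1 + ε / 2)⁻¹ = 0 := by exact_mod_cast h2
    have h4 : (1 + ε / 2)⁻¹ < 1 := inv_lt_one_of_one_lt₀ (by linarith)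
    linarith
  · rintro _ ⟨t, ht, rfl⟩
    exact htr1 (0, t) ⟨h0, ht⟩
  · intro hsub
    have hp : ((ε / 2 : ℝ) : ℂ) ∈ Metric.ball (0 : ℂ) ε := by
      rw [mem_ball_zero_iff, Complex.norm_real, Real.norm_eq_abs, abs_of_pos (by positivity)]
      linarith
    have h := hsub ⟨(((ε / 2 : ℝ) : ℂ), Complex.I), ⟨hp, hI⟩, rfl⟩
    rw [Set.mem_ofPred_eq, htr1 _ ⟨hp, hI⟩] at h
    have h' : ((ε / 2 : ℝ) : ℂ) = 0 := h
    have : ε / 2 = 0 := by exact_mod_cast h'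
    linarith

/-- The entries of the triples of the family are analytic. -/
theorem analyticOnNhd_familyTriple {φ : ℂ × ℂ → ℂ} {B : Set (ℂ × ℂ)} (hB : IsOpen B)
    (hφ : AnalyticOnNhd ℂ φ B) (hgood : ∀ a ∈ B, IsGoodParameter a.1 a.2 (φ a)) (i : Fin 3)
    (j k : Fin 2) :
    AnalyticOnNhd ℂ (fun a => (familyTriple φ a i : Matrix (Fin 2) (Fin 2) ℂ) j k) B := by
  intro a ha
  refine (analyticAt_tripleMat (hφ a ha) analyticAt_snd analyticAt_fst (hgood a ha) i j k).congr ?_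
  filter_upwards [hB.mem_nhds ha] with c hc
  have h := hgood c hc
  rw [familyTriple, coe_tripleSL h.t_ne h.disc_ne (fricke_of_traceEq h.x_ne h.eq)]

/-- The representations that are determined by the family, for a group generated by three elements
with relations that are satisfied by the triples. -/
theorem isAnalyticAtElement_family {Γ : Type} [Group Γ] {φ : ℂ × ℂ → ℂ} {B : Set (ℂ × ℂ)}
    (hB : IsOpen B) (hφ : AnalyticOnNhd ℂ φ B) (hgood : ∀ a ∈ B, IsGoodParameter a.1 a.2 (φ a))
    {y : Fin 3 → Γ} (hy : Subgroup.closure (Set.range y) = ⊤) {ρ : ℂ × ℂ → RepVar Γ}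
    (hρ : ∀ a ∈ B, ∀ i, ρ a (y i) = familyTriple φ a i) (γ : Γ) :
    IsAnalyticAtElement B ρ γ := by
  refine isAnalyticAtElement_of_closure hy ?_ γ
  rintro _ ⟨i, rfl⟩ j k a ha
  refine (analyticOnNhd_familyTriple hB hφ hgood i j k a ha).congr ?_
  filter_upwards [hB.mem_nhds ha] with c hc
  rw [hρ c hc]

theorem two_le_topologicalKrullDim_twistedLocus : 2 ≤ topologicalKrullDim twistedLocus := by
  obtain ⟨φ, ε, hε, hφ, hgood⟩ := exists_good_family
  have hρ : ∀ a ∈ (Metric.ball 0 ε ×ˢ Metric.ball Complex.I ε : Set (ℂ × ℂ)), ∀ i,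
      FreeGroup.lift (familyTriple φ a) (FreeGroup.of i) = familyTriple φ a i :=
    fun a _ i => FreeGroup.lift_apply_of
  exact two_le_topologicalKrullDim_of_family hε hgood FreeGroup.of
    (fun a => FreeGroup.lift (familyTriple φ a)) _ hρ
    (isAnalyticAtElement_family (Metric.isOpen_ball.prod Metric.isOpen_ball) hφ hgood
      (FreeGroup.closure_range_of _) hρ)
    fun a ha => (mk_lift_mem_twistedLocus _).2 (isTwisted_familyTriple (hgood a ha))

/-! ### Holonomy of a locally constant cocycle -/

section Holonomy

open unitInterval

variable {X G ι : Type} [TopologicalSpace X] [Group G] {U : ι → Set X} {a : ι → X → G}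

/-- The covering space of the cocycle `aⱼ aᵢ⁻¹`. -/
def cocycleCore [TopologicalSpace G] [DiscreteTopology G] (hU : ∀ i, IsOpen (U i)) (idx : X → ι)
    (hidx : ∀ x, x ∈ U (idx x))
    (hloc : ∀ i j, ∀ x ∈ U i ∩ U j, ∀ᶠ y in 𝓝 x, a i y * (a j y)⁻¹ = a i x * (a j x)⁻¹) :
    FiberBundleCore ι X G where
  baseSet := U
  isOpen_baseSet := hU
  indexAt := idx
  mem_baseSet_at := hidx
  coordChange i j x v := a j x * (a i x)⁻¹ * v
  coordChange_self i x _ v := by simp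
  continuousOn_coordChange i j := by
    rintro ⟨x, v⟩ ⟨⟨hi, hj⟩, -⟩
    apply ContinuousAt.continuousWithinAt
    have h1 : ∀ᶠ p in 𝓝 (x, v), a j p.1 * (a i p.1)⁻¹ * v = a j x * (a i x)⁻¹ * v := by
      filter_upwards [continuousAt_fst.eventually (hloc j i x ⟨hj, hi⟩)] with p hp
      rw [hp]
    have h2 : ∀ᶠ p : X × G in 𝓝 (x, v), p.2 = v :=
      (continuousAt_snd (p := (x, v))).eventually (p := fun u => u = v) (by simp [nhds_discrete])
    refine (continuousAt_const (y := a j x * (a i x)⁻¹ * v)).congr ?_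
    filter_upwards [h1, h2] with p hp hp2
    rw [hp2, hp]
  coordChange_comp i j k x _ v := by simp [mul_assoc]

/-- Right translation on the covering space. -/
def cocycleTranslate [TopologicalSpace G] (Z : FiberBundleCore ι X G) (g : G) (e : Z.TotalSpace) :
    Z.TotalSpace := ⟨e.1, (show G from e.2) * g⟩

variable [TopologicalSpace G] [DiscreteTopology G] (hU : ∀ i, IsOpen (U i)) (idx : X → ι)
    (hidx : ∀ x, x ∈ U (idx x))
    (hloc : ∀ i j, ∀ x ∈ U i ∩ U j, ∀ᶠ y in 𝓝 x, a i y * (a j y)⁻¹ = a i x * (a j x)⁻¹)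

/-- Coordinate changes are left multiplications and so commute with right translation. Lifts are
therefore carried to lifts, which makes monodromy left multiplication by one element of G. -/
theorem continuous_cocycleTranslate (g : G) :
    Continuous (cocycleTranslate (cocycleCore hU idx hidx hloc) g) := by
  set Z := cocycleCore hU idx hidx hloc with hZ
  rw [continuous_iff_continuousAt]
  intro e
  rw [FiberBundle.continuousAt_totalSpace]
  refine ⟨(FiberBundle.continuous_proj G Z.Fiber).continuousAt, ?_⟩
  have h1 : ContinuousAt (fun e' : Z.TotalSpace =>
      ((trivializationAt G Z.Fiber e.proj) e').2) e :=
    ((FiberBundle.continuousAt_totalSpace G (fun e' : Z.TotalSpace => e')).1 continuousAt_id).2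
  have h2 : ∀ e' : Z.TotalSpace, ((trivializationAt G Z.Fiber e.proj)
      (cocycleTranslate Z g e')).2 = ((trivializationAt G Z.Fiber e.proj) e').2 * g := by
    intro e'
    exact (mul_assoc (a (idx e.proj) e'.1 * (a (idx e'.1) e'.1)⁻¹) (show G from e'.2) g).symm
  have h3 : ContinuousAt (fun e' : Z.TotalSpace =>
      ((trivializationAt G Z.Fiber e.proj) e').2 * g) e :=
    (continuous_of_discreteTopology (f := fun v : G => v * g)).continuousAt.comp h1
  exact h3.congr (Filter.Eventually.of_forall fun e' => (h2 e').symm)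

theorem isCoveringMap_cocycleCore :
    IsCoveringMap (Bundle.TotalSpace.proj : (cocycleCore hU idx hidx hloc).TotalSpace → X) :=
  FiberBundle.isCoveringMap (F := G) (E := (cocycleCore hU idx hidx hloc).Fiber)

theorem monodromy_mk_eq {E : Type} [TopologicalSpace E] {p : E → X} (cov : IsCoveringMap p)
    {x y : X} (γ : Path x y) (e : p ⁻¹' {x}) (γ' : C(I, E)) (h : ∀ t, p (γ' t) = γ t)
    (h0 : γ' 0 = e) : (cov.monodromy (Path.Homotopic.Quotient.mk γ) e).1 = γ' 1 := by
  have := (cov.eq_liftPath_iff' (γ := (γ : C(I, X))) (e := e.1)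
    (γ_0 := γ.source.trans e.2.symm) (Γ := γ')).2 ⟨funext h, h0⟩
  rw [this]
  rfl

/-- The point over `x` with the coordinate `v` with respect to the discontinuous trivialization
`a`. -/
def cocyclePoint (x : X) (v : G) : (Bundle.TotalSpace.proj :
    (cocycleCore hU idx hidx hloc).TotalSpace → X) ⁻¹' {x} :=
  ⟨⟨x, (a (idx x) x * v : G)⟩, rfl⟩

theorem exists_eq_cocyclePoint {x : X} (e : (Bundle.TotalSpace.proj :
    (cocycleCore hU idx hidx hloc).TotalSpace → X) ⁻¹' {x}) :
    ∃ v, e = cocyclePoint hU idx hidx hloc x v := by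
  obtain ⟨⟨x', w⟩, rfl⟩ := e
  refine ⟨(a (idx x') x')⁻¹ * (show G from w), ?_⟩
  refine Subtype.ext (congrArg (Bundle.TotalSpace.mk x') ?_)
  exact (mul_inv_cancel_left (a (idx x') x') (show G from w)).symm

theorem cocyclePoint_injective {x : X} {v w : G}
    (h : cocyclePoint hU idx hidx hloc x v = cocyclePoint hU idx hidx hloc x w) : v = w := by
  have h1 := congrArg Subtype.val h
  simp only [cocyclePoint] at h1
  have h2 := eq_of_heq (Bundle.TotalSpace.mk.inj h1).2
  exact mul_left_cancel h2

end Holonomy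

/-- The holonomy of a locally constant cocycle `aᵢ aⱼ⁻¹` on the homotopy classes of paths. -/
theorem exists_holonomy {X G ι : Type} [TopologicalSpace X] [Group G] {U : ι → Set X}
    {a : ι → X → G} (hU : ∀ i, IsOpen (U i)) (hcov : ∀ x, ∃ i, x ∈ U i)
    (hloc : ∀ i j, ∀ x ∈ U i ∩ U j, ∀ᶠ y in 𝓝 x, a i y * (a j y)⁻¹ = a i x * (a j x)⁻¹) :
    ∃ Ψ : ∀ x y : X, Path.Homotopic.Quotient x y → G,
      (∀ (x y z : X) (p : Path.Homotopic.Quotient x y) (q : Path.Homotopic.Quotient y z),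
        Ψ x z (p.trans q) = Ψ y z q * Ψ x y p) ∧
      ∀ (i : ι) (x y : X) (γ : Path x y), (∀ t, γ t ∈ U i) →
        Ψ x y (Path.Homotopic.Quotient.mk γ) = (a i y)⁻¹ * a i x := by
  -- A bundle with discrete fibre is a covering, so path lifting and homotopy invariance are
  -- available.
  let _ : TopologicalSpace G := ⊥
  have : DiscreteTopology G := ⟨rfl⟩
  choose idx hidx using hcov
  set Z := cocycleCore hU idx hidx hloc with hZ
  have cov := isCoveringMap_cocycleCore hU idx hidx hloc
  let pt := cocyclePoint hU idx hidx hloc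
  have hpt : ∀ {x : X} e, ∃ v, e = pt x v := exists_eq_cocyclePoint hU idx hidx hloc
  have hinj : ∀ {x : X} {v w : G}, pt x v = pt x w → v = w :=
    cocyclePoint_injective hU idx hidx hloc
  have hM : ∀ (x y : X) (p : Path.Homotopic.Quotient x y), ∃ g : G,
      ∀ v, cov.monodromy p (pt x v) = pt y (g * v) := by
    intro x y p
    obtain ⟨g, hg⟩ := hpt (cov.monodromy p (pt x 1))
    refine ⟨g, fun v => ?_⟩
    obtain ⟨γ, rfl⟩ := Path.Homotopic.Quotient.mk_surjective p
    let L := cov.liftPath γ (pt x 1) (γ.source.trans (pt x 1).2.symm)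
    have hL1 : L 1 = (pt y g).1 := congrArg Subtype.val hg
    have hL0 : L 0 = (pt x 1).1 := cov.liftPath_zero _ _ _
    have hLp : ∀ t, (L t).proj = γ t := fun t => congrFun (cov.liftPath_lifts _ _ _) t
    refine Subtype.ext ?_
    rw [monodromy_mk_eq cov γ (pt x v)
      ⟨fun t => cocycleTranslate Z v (L t),
        (continuous_cocycleTranslate hU idx hidx hloc v).comp L.continuous⟩ hLp]
    · change cocycleTranslate Z v (L 1) = _
      rw [hL1]
      exact congrArg (Bundle.TotalSpace.mk y) (mul_assoc (a (idx y) y) g v)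
    · change cocycleTranslate Z v (L 0) = _
      rw [hL0]
      exact congrArg (Bundle.TotalSpace.mk x)
        (congrArg (fun u : G => u * v) (mul_one (a (idx x) x)))
  choose Ψ hΨ using hM
  refine ⟨Ψ, ?_, ?_⟩
  · intro x y z p q
    apply mul_right_cancel (b := (1 : G))
    apply hinj
    rw [← hΨ, cov.monodromy_trans_apply, hΨ, hΨ, mul_assoc]
  · intro i x y γ hγ
    apply mul_right_cancel (b := (1 : G))
    apply hinj
    rw [← hΨ]
    refine Subtype.ext ?_
    -- Inside one chart the lift has constant coordinate; translated to the discontinuous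
    -- trivialization a, this is the stated value.
    have hs : ∀ z, (Z.localTriv i).toOpenPartialHomeomorph.symm (z, a i x) =
        (pt z ((a i z)⁻¹ * a i x)).1 := fun z =>
      congrArg (Bundle.TotalSpace.mk z) (mul_assoc (a (idx z) z) (a i z)⁻¹ (a i x))
    have hcont : Continuous fun t : unitInterval => (pt (γ t) ((a i (γ t))⁻¹ * a i x)).1 := by
      simp only [← hs]
      have h1 := (Z.localTriv i).toOpenPartialHomeomorph.continuousOn_symm
      refine h1.comp_continuous (by fun_prop) fun t => ?_
      exact (Z.mem_localTriv_target i _).2 (hγ t)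
    rw [monodromy_mk_eq cov γ (pt x 1) ⟨_, hcont⟩ (fun t => rfl)]
    · change (pt (γ 1) ((a i (γ 1))⁻¹ * a i x)).1 = _
      rw [γ.target, mul_one]
    · change (pt (γ 0) ((a i (γ 0))⁻¹ * a i x)).1 = _
      rw [γ.source, inv_mul_cancel]

/-! ### The strands of a letter -/

/-- The midpoint of the two points that are exchanged by a letter. -/
def midPoint (l : BraidLetter) : ℝ := if l.1 = 0 then -1 / 4 else 1 / 4

/-- The sign of the imaginary part of a strand that is above (`true`) or below (`false`). -/
def sgn (b : Bool) : ℝ := if b then 1 else -1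

/-- The strand that passes above (`true`) or below (`false`) the midpoint. -/
def outer (l : BraidLetter) (b : Bool) : Fin 3 := if l.2 = b then l.1.succ else l.1.castSucc

/-- The strand that does not move. -/
def restStrand (l : BraidLetter) : Fin 3 := if l.1 = 0 then 2 else 0

theorem strand_castSucc (l : BraidLetter) (s : ℝ) : strand l l.1.castSucc s =
    ⟨midPoint l - Real.cos (Real.pi * s) / 4, -(sgn l.2 * Real.sin (Real.pi * s)) / 4⟩ := by
  have h : ((if l.2 then (1 : ℂ) else -1) * (Real.pi * s : ℝ) * Complex.I) =
      ((sgn l.2 * (Real.pi * s) : ℝ) : ℂ) * Complex.I := by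
    cases l.2 <;> simp [sgn]
  have hc : Real.cos (sgn l.2 * (Real.pi * s)) = Real.cos (Real.pi * s) := by
    cases l.2 <;> simp [sgn]
  have hs : Real.sin (sgn l.2 * (Real.pi * s)) = sgn l.2 * Real.sin (Real.pi * s) := by
    cases l.2 <;> simp [sgn]
  have he : Complex.exp ((if l.2 then (1 : ℂ) else -1) * (Real.pi * s : ℝ) * Complex.I) =
      ⟨Real.cos (Real.pi * s), sgn l.2 * Real.sin (Real.pi * s)⟩ := by
    rw [h, ← hc, ← hs]
    exact Complex.ext (Complex.exp_ofReal_mul_I_re _) (Complex.exp_ofReal_mul_I_im _)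
  rw [strand, if_pos (Or.inl rfl), he]
  obtain ⟨i, ε⟩ := l
  apply Complex.ext <;> fin_cases i <;> norm_num [puncture, midPoint] <;> ring

theorem strand_succ (l : BraidLetter) (s : ℝ) : strand l l.1.succ s =
    ⟨midPoint l + Real.cos (Real.pi * s) / 4, sgn l.2 * Real.sin (Real.pi * s) / 4⟩ := by
  have h1 := strand_castSucc l s
  have h2 : strand l l.1.succ s = 2 * midPoint l - strand l l.1.castSucc s := by
    rw [strand, strand, if_pos (Or.inr rfl), if_pos (Or.inl rfl)]
    obtain ⟨i, ε⟩ := l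
    fin_cases i <;> norm_num [puncture, midPoint] <;> ring
  rw [h2, h1]
  apply Complex.ext
  · simp
    ring
  · simp
    ring

theorem strand_rest (l : BraidLetter) (s : ℝ) :
    strand l (restStrand l) s = ⟨-2 * midPoint l, 0⟩ := by
  have h : ¬(restStrand l = l.1.castSucc ∨ restStrand l = l.1.succ) := by
    obtain ⟨i, ε⟩ := l
    revert i ε
    decide
  rw [strand, if_neg h]
  obtain ⟨i, ε⟩ := l
  apply Complex.ext <;> fin_cases i <;> norm_num [restStrand, puncture, midPoint]

theorem strand_outer (l : BraidLetter) (b : Bool) (s : ℝ) : strand l (outer l b) s =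
    ⟨midPoint l + sgn b * sgn l.2 * Real.cos (Real.pi * s) / 4,
      sgn b * Real.sin (Real.pi * s) / 4⟩ := by
  rw [outer]
  split_ifs with h
  · rw [strand_succ, ← h]
    cases l.2 <;> simp [sgn]
  · rw [strand_castSucc]
    have : b = !l.2 := by cases b <;> cases hl : l.2 <;> simp_all
    rw [this]
    cases l.2 <;> simp [sgn] <;> ring

theorem eq_outer_or_rest (l : BraidLetter) (j : Fin 3) :
    (∃ b, j = outer l b) ∨ j = restStrand l := by
  obtain ⟨i, ε⟩ := l
  revert i ε j
  decide

theorem abs_midPoint (l : BraidLetter) : |midPoint l| = 1 / 4 := by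
  rw [midPoint]
  split_ifs <;> norm_num [abs_of_pos]

theorem sgn_mul_self (b : Bool) : sgn b * sgn b = 1 := by
  cases b <;> simp [sgn]

theorem abs_sgn (b : Bool) : |sgn b| = 1 := by
  cases b <;> simp [sgn]

/-- The moving strands stay within 1/4 of their midpoint, and the resting strand is at distance 3/4
from it. -/
theorem re_strand_outer_ne (l : BraidLetter) (b : Bool) (s : ℝ) :
    (strand l (outer l b) s).re ≠ (strand l (restStrand l) s).re := by
  intro h
  rw [strand_outer, strand_rest] at h
  have h1 : |3 * midPoint l| ≤ 1 / 4 := by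
    have : 3 * midPoint l = -(sgn b * sgn l.2 * Real.cos (Real.pi * s) / 4) := by
      simp only at h
      linarith
    rw [this, abs_neg, abs_div, abs_mul, abs_mul, abs_sgn, abs_sgn,
      abs_of_pos (by norm_num : (0 : ℝ) < 4)]
    linarith [Real.abs_cos_le_one (Real.pi * s)]
  rw [abs_mul, abs_midPoint] at h1
  norm_num at h1

theorem abs_re_strand_le (l : BraidLetter) (j : Fin 3) (s : ℝ) : |(strand l j s).re| ≤ 1 / 2 := by
  have hm := abs_midPoint l
  obtain ⟨b, rfl⟩ | rfl := eq_outer_or_rest l j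
  · rw [strand_outer]
    refine (abs_add_le _ _).trans ?_
    rw [abs_div, abs_mul, abs_mul, abs_sgn, abs_sgn, hm]
    have := Real.abs_cos_le_one (Real.pi * s)
    rw [abs_of_pos (by norm_num : (0 : ℝ) < 4)]
    linarith
  · rw [strand_rest]
    simp only [abs_mul, hm]
    norm_num

theorem abs_im_strand_le (l : BraidLetter) (j : Fin 3) (s : ℝ) : |(strand l j s).im| ≤ 1 / 4 := by
  obtain ⟨b, rfl⟩ | rfl := eq_outer_or_rest l j
  · rw [strand_outer]
    simp only [abs_div, abs_mul, abs_sgn]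
    have := Real.abs_sin_le_one (Real.pi * s)
    rw [abs_of_pos (by norm_num : (0 : ℝ) < 4)]
    linarith
  · rw [strand_rest]
    norm_num

theorem continuous_strand (l : BraidLetter) (j : Fin 3) : Continuous (strand l j) := by
  unfold strand
  split_ifs <;> fun_prop

theorem strand_one_eq (l : BraidLetter) (j : Fin 3) :
    strand l j 1 = puncture (Equiv.swap l.1.castSucc l.1.succ j) := by
  have hj : j = l.1.castSucc ∨ j = l.1.succ ∨
      j = restStrand l ∧ j ≠ l.1.castSucc ∧ j ≠ l.1.succ := by
    obtain ⟨i, ε⟩ := l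
    revert i ε j
    decide
  rcases hj with rfl | rfl | ⟨h, h1, h2⟩
  · rw [Equiv.swap_apply_left, ← strand_zero l, strand_castSucc, strand_succ]
    simp
    ring
  · rw [Equiv.swap_apply_right, ← strand_zero l, strand_castSucc, strand_succ]
    simp
    ring
  · rw [Equiv.swap_apply_of_ne_of_ne h1 h2, ← strand_zero l, h, strand_rest, strand_rest]

/-! ### Angular time -/

/-- The argument of the second coordinate is `2πτ/N`. -/
def AtTime (N : ℕ) (x : S3) (τ : ℝ) : Prop :=
  x.1 1 = (Real.sqrt (1 - ‖x.1 0‖ ^ 2) : ℂ) *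
    Complex.exp ((2 * Real.pi * (τ / N) : ℝ) * Complex.I)

theorem mem_closedBraid_iff (w : BraidWord) (x : S3) : x ∈ closedBraid w ↔
    ∃ (k : Fin w.length) (j : Fin 3) (s : ℝ), s ∈ Set.Icc (0 : ℝ) 1 ∧
      x.1 0 = strand (w.get k) j s ∧ AtTime w.length x ((k : ℕ) + s) := by
  constructor
  · rintro ⟨k, j, s, hs, h0, h1⟩
    exact ⟨k, j, s, hs, h0, by rw [AtTime, h0, h1]⟩
  · rintro ⟨k, j, s, hs, h0, h1⟩
    exact ⟨k, j, s, hs, h0, by rw [AtTime, h0] at h1; exact h1⟩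

theorem S3.norm_sq_add (x : S3) : ‖x.1 0‖ ^ 2 + ‖x.1 1‖ ^ 2 = 1 := by
  have h := x.2
  rw [mem_sphere_zero_iff_norm, EuclideanSpace.norm_eq, Fin.sum_univ_two,
    Real.sqrt_eq_one] at h
  exact h

theorem exists_atTime {N : ℕ} (hN : 0 < N) (x : S3) : ∃ (k : Fin N) (s : ℝ),
    s ∈ Set.Icc (0 : ℝ) 1 ∧ AtTime N x ((k : ℕ) + s) := by
  have hN' : (0 : ℝ) < N := by exact_mod_cast hN
  have hsq : Real.sqrt (1 - ‖x.1 0‖ ^ 2) = ‖x.1 1‖ := by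
    have h : 1 - ‖x.1 0‖ ^ 2 = ‖x.1 1‖ ^ 2 := by linarith [S3.norm_sq_add x]
    rw [h, Real.sqrt_sq (norm_nonneg _)]
  obtain ⟨θ, hθ0, hθ1, hθ⟩ : ∃ θ : ℝ, 0 ≤ θ ∧ θ < 1 ∧
      x.1 1 = ‖x.1 1‖ * Complex.exp ((2 * Real.pi * θ : ℝ) * Complex.I) := by
    refine ⟨Int.fract (Complex.arg (x.1 1) / (2 * Real.pi)), Int.fract_nonneg _,
      Int.fract_lt_one _, ?_⟩
    conv_lhs => rw [← Complex.norm_mul_exp_arg_mul_I (x.1 1)]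
    congr 1
    refine Complex.exp_eq_exp_iff_exists_int.2
      ⟨⌊Complex.arg (x.1 1) / (2 * Real.pi)⌋, ?_⟩
    have : Complex.arg (x.1 1) = 2 * Real.pi * Int.fract (Complex.arg (x.1 1) / (2 * Real.pi)) +
        ⌊Complex.arg (x.1 1) / (2 * Real.pi)⌋ * (2 * Real.pi) := by
      rw [Int.fract]
      field_simp
      ring
    conv_lhs => rw [this]
    push_cast
    ring
  have h0 : 0 ≤ θ * N := by positivity
  have h1 : θ * N < N := by nlinarith
  refine ⟨⟨⌊θ * N⌋₊, (Nat.floor_lt h0).2 h1⟩, θ * N - ⌊θ * N⌋₊, ⟨?_, ?_⟩, ?_⟩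
  · exact sub_nonneg.2 (Nat.floor_le h0)
  · have := Nat.lt_floor_add_one (θ * N)
    linarith
  · rw [AtTime, hsq]
    conv_lhs => rw [hθ]
    simp only [add_sub_cancel, mul_div_cancel_right₀ θ hN'.ne']

/-- On the axis |z| = 1 every time is admissible, hence the strict bound. Off the axis the angle
determines the time modulo N, and only the two ends 0 and N coincide. -/
theorem AtTime.unique {N : ℕ} (hN : 0 < N) {x : S3} (hx : ‖x.1 0‖ < 1) {σ τ : ℝ}
    (hσ : AtTime N x σ) (hτ : AtTime N x τ) (hσ0 : σ ∈ Set.Icc (0 : ℝ) N)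
    (hτ0 : τ ∈ Set.Icc (0 : ℝ) N) : σ = τ ∨ (σ = 0 ∧ τ = N) ∨ (σ = N ∧ τ = 0) := by
  have hN' : (0 : ℝ) < N := by exact_mod_cast hN
  have hne : ((Real.sqrt (1 - ‖x.1 0‖ ^ 2) : ℝ) : ℂ) ≠ 0 := by
    have : 0 < Real.sqrt (1 - ‖x.1 0‖ ^ 2) := by
      apply Real.sqrt_pos.2
      nlinarith [norm_nonneg (x.1 0)]
    exact_mod_cast this.ne'
  rw [AtTime] at hσ hτ
  have h := mul_left_cancel₀ hne (hσ.symm.trans hτ)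
  obtain ⟨n, hn⟩ := Complex.exp_eq_exp_iff_exists_int.1 h
  have h2 := congrArg Complex.im hn
  simp at h2
  have h3 : σ = τ + n * N := by
    have hpi := Real.pi_pos
    field_simp at h2
    linarith
  have hn1 : n ≤ 1 := by
    by_contra! hc
    have : (2 : ℝ) ≤ n := by exact_mod_cast hc
    nlinarith [hσ0.2, hτ0.1]
  have hn2 : -1 ≤ n := by
    by_contra! hc
    have : (n : ℝ) ≤ -2 := by exact_mod_cast (by omega : n ≤ -2)
    nlinarith [hσ0.1, hτ0.2]
  obtain ⟨hσ1, hσ2⟩ := hσ0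
  obtain ⟨hτ1, hτ2⟩ := hτ0
  have : n = -1 ∨ n = 0 ∨ n = 1 := by omega
  rcases this with rfl | rfl | rfl
  · right; left
    push_cast at h3
    constructor <;> linarith
  · left
    simpa using h3
  · right; right
    push_cast at h3
    constructor <;> linarith

/-- Two representations `k + s` of the angular time of a point. -/
theorem AtTime.unique' {N : ℕ} {x : S3} (hx : ‖x.1 0‖ < 1) {k k' : Fin N} {s s' : ℝ}
    (hs : s ∈ Set.Icc (0 : ℝ) 1) (hs' : s' ∈ Set.Icc (0 : ℝ) 1)
    (h : AtTime N x ((k : ℕ) + s)) (h' : AtTime N x ((k' : ℕ) + s')) :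
    (k = k' ∧ s = s') ∨ (s = 1 ∧ s' = 0 ∧ ((k' : ℕ) = k + 1 ∨ (k : ℕ) + 1 = N ∧ (k' : ℕ) = 0)) ∨
      (s = 0 ∧ s' = 1 ∧ ((k : ℕ) = k' + 1 ∨ (k' : ℕ) + 1 = N ∧ (k : ℕ) = 0)) := by
  have hN : 0 < N := k.pos
  have hk : ((k : ℕ) : ℝ) + 1 ≤ N := by exact_mod_cast k.2
  have hk' : ((k' : ℕ) : ℝ) + 1 ≤ N := by exact_mod_cast k'.2
  have hk0 : (0 : ℝ) ≤ (k : ℕ) := Nat.cast_nonneg _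
  have hk0' : (0 : ℝ) ≤ (k' : ℕ) := Nat.cast_nonneg _
  obtain ⟨hs0, hs1⟩ := hs
  obtain ⟨hs0', hs1'⟩ := hs'
  rcases AtTime.unique hN hx h h' ⟨by linarith, by linarith⟩ ⟨by linarith, by linarith⟩ with
    e | ⟨e1, e2⟩ | ⟨e1, e2⟩
  · rcases lt_trichotomy (k : ℕ) k' with hlt | heq | hlt
    · have hlt' : ((k : ℕ) : ℝ) + 1 ≤ (k' : ℕ) := by exact_mod_cast hlt
      have a1 : s = 1 := by linarith
      have a2 : s' = 0 := by linarith
      refine Or.inr (Or.inl ⟨a1, a2, Or.inl ?_⟩)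
      rw [a1, a2, add_zero] at e
      exact_mod_cast e.symm
    · have : k = k' := Fin.ext heq
      subst this
      exact Or.inl ⟨rfl, by linarith⟩
    · have hlt' : ((k' : ℕ) : ℝ) + 1 ≤ (k : ℕ) := by exact_mod_cast hlt
      have a1 : s' = 1 := by linarith
      have a2 : s = 0 := by linarith
      refine Or.inr (Or.inr ⟨a2, a1, Or.inl ?_⟩)
      rw [a1, a2, add_zero] at e
      exact_mod_cast e
  · have a1 : s = 0 := by linarith
    have a2 : s' = 1 := by linarith
    refine Or.inr (Or.inr ⟨a1, a2, Or.inr ⟨?_, ?_⟩⟩)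
    · rw [a2] at e2
      exact_mod_cast e2
    · rw [a1, add_zero] at e1
      exact_mod_cast e1
  · have a1 : s = 1 := by linarith
    have a2 : s' = 0 := by linarith
    refine Or.inr (Or.inl ⟨a1, a2, Or.inr ⟨?_, ?_⟩⟩)
    · rw [a1] at e1
      exact_mod_cast e1
    · rw [a2, add_zero] at e2
      exact_mod_cast e2

/-- Projection along a compact interval is a closed map. All openness statements for the charts come
from this. -/
theorem isClosed_exists_mem_Icc {X : Type*} [TopologicalSpace X] {a b : ℝ} {R : X → ℝ → Prop}
    (hR : IsClosed {p : X × ℝ | R p.1 p.2}) : IsClosed {x | ∃ s ∈ Set.Icc a b, R x s} := by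
  have h1 : IsClosed {p : X × Set.Icc a b | R p.1 p.2} :=
    hR.preimage (f := fun p : X × Set.Icc a b => (p.1, (p.2 : ℝ))) (by fun_prop)
  have h2 := isClosedMap_fst_of_compactSpace _ h1
  convert h2 using 1
  ext x
  constructor
  · rintro ⟨s, hs, h⟩
    exact ⟨(x, ⟨s, hs⟩), h, rfl⟩
  · rintro ⟨⟨y, s⟩, h, rfl⟩
    exact ⟨s, s.2, h⟩

theorem S3.continuous_coord (i : Fin 2) : Continuous fun x : S3 => x.1 i := by
  exact (EuclideanSpace.proj i).continuous.comp continuous_subtype_val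

theorem isClosed_atTime (N : ℕ) {f : ℝ → ℝ} (hf : Continuous f) :
    IsClosed {p : S3 × ℝ | AtTime N p.1 (f p.2)} := by
  have h0 := (S3.continuous_coord 0).comp (continuous_fst (X := S3) (Y := ℝ))
  have h1 := (S3.continuous_coord 1).comp (continuous_fst (X := S3) (Y := ℝ))
  simp only [Function.comp_def] at h0 h1
  exact isClosed_eq h1 (by fun_prop)

/-! ### The three charts of the complement of a closed braid -/

/-- The points with `Im z > -1/2` that are not on or below a strand with the same real part
(`b = true`), or the points with `Im z < 1/2` that are not on or above such a strand
(`b = false`). -/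
def sideChart (w : BraidWord) (b : Bool) : Set S3 :=
  {x | -1 / 2 < sgn b * (x.1 0).im ∧ ∀ (k : Fin w.length) (j : Fin 3) (s : ℝ),
    s ∈ Set.Icc (0 : ℝ) 1 → AtTime w.length x ((k : ℕ) + s) →
    (x.1 0).re = (strand (w.get k) j s).re →
    ¬ sgn b * (x.1 0).im ≤ sgn b * (strand (w.get k) j s).im}

/-- The points between the two moving strands of the `k`-th letter. -/
def betweenAt (w : BraidWord) (x : S3) (k : Fin w.length) (s : ℝ) : Prop :=
  s ∈ Set.Ioo (0 : ℝ) 1 ∧ AtTime w.length x ((k : ℕ) + s) ∧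
    ‖x.1 0 - midPoint (w.get k)‖ < 1 / 4

/-- The points between the two moving strands of some letter. -/
def betweenChart (w : BraidWord) : Set S3 := {x | ∃ k s, betweenAt w x k s}

theorem S3.continuous_re : Continuous fun x : S3 => (x.1 0).re :=
  Complex.continuous_re.comp (S3.continuous_coord 0)

theorem S3.continuous_im : Continuous fun x : S3 => (x.1 0).im :=
  Complex.continuous_im.comp (S3.continuous_coord 0)

theorem isOpen_sideChart (w : BraidWord) (b : Bool) : IsOpen (sideChart w b) := by
  have h : sideChart w b = {x | -1 / 2 < sgn b * (x.1 0).im} ∩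
      ⋂ (k : Fin w.length), ⋂ (j : Fin 3), {x | ∃ s ∈ Set.Icc (0 : ℝ) 1,
        AtTime w.length x ((k : ℕ) + s) ∧ (x.1 0).re = (strand (w.get k) j s).re ∧
        sgn b * (x.1 0).im ≤ sgn b * (strand (w.get k) j s).im}ᶜ := by
    ext x
    simp only [sideChart, Set.mem_ofPred_eq, Set.mem_inter_iff, Set.mem_iInter, Set.mem_compl_iff]
    constructor
    · rintro ⟨h1, h2⟩
      refine ⟨h1, ?_⟩
      rintro k j ⟨s, hs, ht, hre, him⟩
      exact h2 k j s hs ht hre him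
    · rintro ⟨h1, h2⟩
      exact ⟨h1, fun k j s hs ht hre him => h2 k j ⟨s, hs, ht, hre, him⟩⟩
  rw [h]
  refine (isOpen_lt continuous_const (continuous_const.mul S3.continuous_im)).inter ?_
  refine isOpen_iInter_of_finite fun k => isOpen_iInter_of_finite fun j => ?_
  rw [isOpen_compl_iff]
  apply isClosed_exists_mem_Icc
  have hs := (continuous_strand (w.get k) j).comp (continuous_snd (X := S3) (Y := ℝ))
  have hre := S3.continuous_re.comp (continuous_fst (X := S3) (Y := ℝ))
  have him := S3.continuous_im.comp (continuous_fst (X := S3) (Y := ℝ))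
  refine (isClosed_atTime w.length (by fun_prop)).inter (IsClosed.inter ?_ ?_)
  · exact isClosed_eq hre (Complex.continuous_re.comp hs)
  · exact isClosed_le (continuous_const.mul him)
      (continuous_const.mul (Complex.continuous_im.comp hs))

theorem norm_lt_one_of_near {l : BraidLetter} {z : ℂ} (h : ‖z - midPoint l‖ < 1 / 4) :
    ‖z‖ < 1 := by
  have h1 : ‖z‖ ≤ ‖z - midPoint l‖ + ‖(midPoint l : ℂ)‖ := by
    simpa using norm_add_le (z - midPoint l) (midPoint l : ℂ)
  rw [Complex.norm_real, Real.norm_eq_abs, abs_midPoint] at h1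
  linarith

/-- The letter and the time of a point between two strands are determined by the point. -/
theorem betweenAt.unique {w : BraidWord} {x : S3} {k k' : Fin w.length} {s s' : ℝ}
    (h : betweenAt w x k s) (hs' : s' ∈ Set.Icc (0 : ℝ) 1)
    (h' : AtTime w.length x ((k' : ℕ) + s')) : k' = k ∧ s' = s := by
  rcases AtTime.unique' (norm_lt_one_of_near h.2.2) (Set.Ioo_subset_Icc_self h.1) hs' h.2.1 h' with
    ⟨h1, h2⟩ | ⟨h1, -⟩ | ⟨h1, -⟩
  · exact ⟨h1.symm, h2.symm⟩
  · exact absurd h1 h.1.2.ne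
  · exact absurd h1 h.1.1.ne'

theorem isOpen_betweenChart {w : BraidWord} (hw : 0 < w.length) : IsOpen (betweenChart w) := by
  -- The time lies in the interior of the k-th interval exactly when it is neither end of that
  -- interval nor in any other one. The degenerate intervals [0,0] and [1,1] let the same projection
  -- argument treat the ends.
  have h : betweenChart w = ⋃ k : Fin w.length, {x : S3 | ‖x.1 0 - midPoint (w.get k)‖ < 1 / 4} ∩
      ({x | ∃ s ∈ Set.Icc (0 : ℝ) 0, AtTime w.length x ((k : ℕ) + s)}ᶜ ∩
      ({x | ∃ s ∈ Set.Icc (1 : ℝ) 1, AtTime w.length x ((k : ℕ) + s)}ᶜ ∩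
      ⋂ k' : Fin w.length, {x | k' ≠ k ∧ ∃ s ∈ Set.Icc (0 : ℝ) 1,
        AtTime w.length x ((k' : ℕ) + s)}ᶜ)) := by
    ext x
    simp only [betweenChart, Set.mem_ofPred_eq, Set.mem_iUnion, Set.mem_inter_iff,
      Set.mem_compl_iff, Set.mem_iInter]
    refine exists_congr fun k => ?_
    constructor
    · rintro ⟨s, h⟩
      refine ⟨h.2.2, ?_, ?_, ?_⟩
      · rintro ⟨s', hs', h'⟩
        have := (h.unique ⟨hs'.1, hs'.2.trans zero_le_one⟩ h').2
        exact h.1.1.not_ge (this ▸ hs'.2)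
      · rintro ⟨s', hs', h'⟩
        have := (h.unique ⟨zero_le_one.trans hs'.1, hs'.2⟩ h').2
        exact h.1.2.not_ge (this ▸ hs'.1)
      · rintro k' ⟨hk', s', hs', h'⟩
        exact hk' (h.unique hs' h').1
    · rintro ⟨h1, h2, h3, h4⟩
      obtain ⟨k', s, hs, h⟩ := exists_atTime hw x
      have hk : k' = k := by
        by_contra hne
        exact h4 k' ⟨hne, s, hs, h⟩
      subst hk
      refine ⟨s, ⟨?_, ?_⟩, h, h1⟩
      · refine lt_of_le_of_ne hs.1 fun h0 => h2 ⟨s, ?_, h⟩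
        rw [h0]
        simp
      · refine lt_of_le_of_ne hs.2 fun h0 => h3 ⟨s, ?_, h⟩
        rw [h0]
        simp
  rw [h]
  have hc : ∀ (k : Fin w.length) (a b : ℝ),
      IsClosed {x | ∃ s ∈ Set.Icc a b, AtTime w.length x ((k : ℕ) + s)} := fun k a b =>
    isClosed_exists_mem_Icc (isClosed_atTime w.length (by fun_prop))
  refine isOpen_iUnion fun k => IsOpen.inter ?_ ((hc k 0 0).isOpen_compl.inter
    ((hc k 1 1).isOpen_compl.inter (isOpen_iInter_of_finite fun k' => ?_)))
  · have := S3.continuous_coord 0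
    exact isOpen_lt (by fun_prop) continuous_const
  · rw [isOpen_compl_iff]
    by_cases hk : k' = k
    · simp [hk]
    · simpa [hk] using hc k' 0 1

/-- Every point outside a closed braid is in one of the three charts. -/
theorem mem_charts {w : BraidWord} {x : S3} (hx : x ∉ closedBraid w) :
    (∃ b, x ∈ sideChart w b) ∨ x ∈ betweenChart w := by
  by_contra! hcon
  obtain ⟨hs, hB⟩ := hcon
  have hside : ∀ b, sgn b * (x.1 0).im ≤ -1 / 2 ∨ ∃ (k : Fin w.length) (j : Fin 3) (s : ℝ),
      s ∈ Set.Icc (0 : ℝ) 1 ∧ AtTime w.length x ((k : ℕ) + s) ∧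
      (x.1 0).re = (strand (w.get k) j s).re ∧
      sgn b * (x.1 0).im ≤ sgn b * (strand (w.get k) j s).im := by
    intro b
    have := hs b
    simp only [sideChart, Set.mem_ofPred_eq, not_and_or, not_lt] at this
    refine this.imp id fun h => ?_
    push Not at h
    exact h
  have ht := hside true
  have hb := hside false
  simp only [sgn, if_true, Bool.false_eq_true, if_false, one_mul, neg_mul, neg_le_neg_iff] at ht hb
  rcases ht with ht | ⟨k, j, s, hs, hst, hre, him⟩
  · rcases hb with hb | ⟨k, j, s, hs, hst, hre, him⟩
    · linarith
    · have := abs_le.1 (abs_im_strand_le (w.get k) j s)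
      linarith
  rcases hb with hb | ⟨k', j', s', hs', hst', hre', him'⟩
  · have := abs_le.1 (abs_im_strand_le (w.get k) j s)
    linarith
  have hr := abs_le.1 (abs_re_strand_le (w.get k) j s)
  have hi := abs_le.1 (abs_im_strand_le (w.get k) j s)
  have hi' := abs_le.1 (abs_im_strand_le (w.get k') j' s')
  have hnorm : ‖x.1 0‖ < 1 := by
    rw [← sq_lt_one_iff₀ (norm_nonneg _), ← Complex.normSq_eq_norm_sq, Complex.normSq_apply]
    rw [hre]
    nlinarith
  have hlt : (x.1 0).im < (strand (w.get k) j s).im := by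
    refine lt_of_le_of_ne him fun h => hx ?_
    exact (mem_closedBraid_iff w x).2 ⟨k, j, s, hs, Complex.ext hre h, hst⟩
  have hlt' : (strand (w.get k') j' s').im < (x.1 0).im := by
    refine lt_of_le_of_ne him' fun h => hx ?_
    exact (mem_closedBraid_iff w x).2 ⟨k', j', s', hs', Complex.ext hre' h.symm, hst'⟩
  have im0 : ∀ (l : BraidLetter) (j : Fin 3) (s : ℝ), s = 0 ∨ s = 1 → (strand l j s).im = 0 := by
    rintro l j s (rfl | rfl)
    · rw [strand_zero]
      simp [puncture]
    · rw [strand_one_eq]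
      simp [puncture]
  -- A point outside all charts is strictly below one strand and strictly above another. At the ends
  -- of a letter all strands are on the real axis, so this happens inside a letter; there two
  -- strands share a real part only at s = 1/2, and the point lies between them.
  have hends : ¬((s = 0 ∨ s = 1) ∧ (s' = 0 ∨ s' = 1)) := by
    rintro ⟨h, h'⟩
    rw [im0 _ _ _ h] at hlt
    rw [im0 _ _ _ h'] at hlt'
    linarith
  rcases AtTime.unique' hnorm hs hs' hst hst' with ⟨rfl, rfl⟩ | ⟨h1, h2, -⟩ | ⟨h1, h2, -⟩
  · have hsIoo : s ∈ Set.Ioo (0 : ℝ) 1 :=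
      ⟨lt_of_le_of_ne hs.1 fun h => hends ⟨Or.inl h.symm, Or.inl h.symm⟩,
        lt_of_le_of_ne hs.2 fun h => hends ⟨Or.inr h, Or.inr h⟩⟩
    refine hB ⟨k, s, hsIoo, hst, ?_⟩
    have hpair : ∀ b b' : Bool, b ≠ b' →
        (strand (w.get k) (outer (w.get k) b) s).re = (strand (w.get k) (outer (w.get k) b') s).re →
        Real.cos (Real.pi * s) = 0 := by
      intro b b' hbb h
      rw [strand_outer, strand_outer] at h
      simp only at h
      generalize (w.get k).2 = e at h
      cases b <;> cases b' <;> cases e <;> simp [sgn] at h hbb <;> linarith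
    rw [hre] at hre'
    obtain ⟨b, rfl⟩ | rfl := eq_outer_or_rest (w.get k) j
    · obtain ⟨b', rfl⟩ | rfl := eq_outer_or_rest (w.get k) j'
      · have hbb : b ≠ b' := by
          rintro rfl
          linarith
        have hc := hpair b b' hbb hre'
        rw [strand_outer] at hre hlt
        rw [strand_outer] at hlt'
        rw [hc] at hre
        simp only [mul_zero, zero_div, add_zero] at hre hlt hlt'
        have hsin := Real.abs_sin_le_one (Real.pi * s)
        have e1 : x.1 0 - midPoint (w.get k) = ⟨0, (x.1 0).im⟩ := by
          apply Complex.ext <;> simp [hre]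
        rw [e1, ← sq_lt_sq₀ (norm_nonneg _) (by norm_num), ← Complex.normSq_eq_norm_sq,
          Complex.normSq_apply]
        have hsin' := abs_le.1 hsin
        have hb1 : (x.1 0).im < 1 / 4 := by
          cases b <;> simp [sgn] at hlt <;> linarith
        have hb2 : -1 / 4 < (x.1 0).im := by
          cases b' <;> simp [sgn] at hlt' <;> linarith
        simp only [mul_zero, zero_add]
        nlinarith
      · exact absurd hre' (re_strand_outer_ne _ b s)
    · obtain ⟨b', rfl⟩ | rfl := eq_outer_or_rest (w.get k) j'
      · exact absurd hre'.symm (re_strand_outer_ne _ b' s)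
      · linarith
  · exact hends ⟨Or.inr h1, Or.inl h2⟩
  · exact hends ⟨Or.inl h1, Or.inr h2⟩

/-! ### The cocycle of a labelling that is fixed by a braid -/

/-- A function with constant values on the pieces of a finite closed cover is locally constant. -/
theorem eventually_eq_of_closed_cover {X G ι : Type*} [TopologicalSpace X] [Finite ι] {O : Set X}
    (hO : IsOpen O) {f : X → G} {P : ι → Set X} {v : ι → G} (hP : ∀ c, IsClosed (P c))
    (hcov : ∀ x ∈ O, ∃ c, x ∈ P c) (hv : ∀ c, ∀ x ∈ O, x ∈ P c → f x = v c) {x : X} (hx : x ∈ O) :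
    ∀ᶠ y in 𝓝 x, f y = f x := by
  have h1 : ∀ᶠ y in 𝓝 x, ∀ c, y ∈ P c → x ∈ P c := by
    rw [Filter.eventually_all]
    intro c
    by_cases h : x ∈ P c
    · exact Filter.Eventually.of_forall fun _ _ => h
    · filter_upwards [(hP c).isOpen_compl.mem_nhds h] with y hy hy'
      exact absurd hy' hy
  filter_upwards [h1, hO.mem_nhds hx] with y hy hyO
  obtain ⟨c, hc⟩ := hcov y hyO
  rw [hv c y hyO hc, hv c x hx (hy c hc)]

section Labels

variable {G : Type} [Group G]

/-- The product of the first `n` labels. -/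
def prefixProd (h : Fin 3 → G) (n : ℕ) : G := ((List.ofFn h).take n).prod

theorem prefixProd_zero (h : Fin 3 → G) : prefixProd h 0 = 1 := by simp [prefixProd]
theorem prefixProd_one (h : Fin 3 → G) : prefixProd h 1 = h 0 := by simp [prefixProd]
theorem prefixProd_two (h : Fin 3 → G) : prefixProd h 2 = h 0 * h 1 := by simp [prefixProd]
theorem prefixProd_three (h : Fin 3 → G) : prefixProd h 3 = h 0 * h 1 * h 2 := by
  simp [prefixProd, mul_assoc]

theorem prefixProd_letterAct {l : BraidLetter} (h : Fin 3 → G) {n : ℕ} (hn : n ≤ 3)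
    (hl : n ≠ (l.1 : ℕ) + 1) : prefixProd (letterAct l h) n = prefixProd h n := by
  obtain ⟨i, ε⟩ := l
  interval_cases n
  · simp only [prefixProd_zero]
  · fin_cases i
    · simp at hl
    · cases ε <;> simp only [prefixProd_one] <;> rfl
  · fin_cases i
    · cases ε <;> simp [prefixProd_two, letterAct, mul_assoc]
    · simp at hl
  · simp only [prefixProd_three, letterAct_prod]

/-- The number of strands to the left of a point. -/
def leftCount (l : BraidLetter) (s : ℝ) (z : ℂ) : ℕ :=
  (Finset.univ.filter fun j => (strand l j s).re < z.re).card

theorem leftCount_le (l : BraidLetter) (s : ℝ) (z : ℂ) : leftCount l s z ≤ 3 :=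
  (Finset.card_le_univ _).trans_eq (Fintype.card_fin 3)

theorem leftCount_eq (l : BraidLetter) (s : ℝ) (z : ℂ) : leftCount l s z =
    (if (strand l (outer l true) s).re < z.re then 1 else 0) +
    (if (strand l (outer l false) s).re < z.re then 1 else 0) +
    (if (strand l (restStrand l) s).re < z.re then 1 else 0) := by
  rw [leftCount, Finset.card_filter, Fin.sum_univ_three]
  obtain ⟨i, ε⟩ := l
  fin_cases i <;> cases ε <;> simp [outer, restStrand] <;> ring

theorem leftCount_one (l : BraidLetter) (z : ℂ) :
    leftCount l 1 z = (Finset.univ.filter fun j => (puncture j).re < z.re).card := by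
  rw [leftCount, Finset.card_filter, Finset.card_filter,
    ← Equiv.sum_comp (Equiv.swap l.1.castSucc l.1.succ)]
  simp only [strand_one_eq, Equiv.swap_apply_self]

theorem leftCount_zero (l : BraidLetter) (z : ℂ) :
    leftCount l 0 z = (Finset.univ.filter fun j => (puncture j).re < z.re).card := by
  simp only [leftCount, strand_zero]

/-- The labels of the strands before the `k`-th letter. -/
def labels (w : BraidWord) (g : Fin 3 → G) (k : ℕ) : Fin 3 → G := braidAct (w.take k) g

theorem labels_succ (w : BraidWord) (g : Fin 3 → G) (k : Fin w.length) :
    labels w g (k + 1) = letterAct (w.get k) (labels w g k) := by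
  rw [labels, List.take_succ_eq_append_getElem k.2, braidAct_append]
  rfl

theorem labels_length (w : BraidWord) (g : Fin 3 → G) : labels w g w.length = braidAct w g := by
  rw [labels, List.take_length]

/-- The labels of the strands in the first (`false`) or second (`true`) half of a letter. -/
def halfLabels (w : BraidWord) (g : Fin 3 → G) (k : ℕ) (e : Bool) : Fin 3 → G :=
  if e then labels w g (k + 1) else labels w g k

/-- The first or second half of the time of a letter. -/
def halfTime (e : Bool) : Set ℝ := if e then Set.Icc (1 / 2) 1 else Set.Icc 0 (1 / 2)

theorem halfTime_subset (e : Bool) : halfTime e ⊆ Set.Icc 0 1 := by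
  cases e <;> simp only [halfTime] <;> intro s hs <;>
    exact ⟨by norm_num at hs; linarith [hs.1], by norm_num at hs; linarith [hs.2]⟩

theorem exists_mem_halfTime {s : ℝ} (hs : s ∈ Set.Icc (0 : ℝ) 1) : ∃ e, s ∈ halfTime e := by
  rcases le_total s (1 / 2) with h | h
  · exact ⟨false, by simpa [halfTime] using ⟨hs.1, by simpa using h⟩⟩
  · exact ⟨true, by simpa [halfTime] using ⟨by simpa using h, hs.2⟩⟩

/-- The product of the labels of the strands to the left of a point. -/
def leftProd (w : BraidWord) (g : Fin 3 → G) (k : Fin w.length) (e : Bool) (s : ℝ) (z : ℂ) : G :=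
  prefixProd (halfLabels w g k e) (leftCount (w.get k) s z)

/-- At half time the two moving strands have the same real part, so both or neither are counted, and
the other prefix products do not see the change of labels. -/
theorem leftProd_half (w : BraidWord) (g : Fin 3 → G) (k : Fin w.length) (e e' : Bool) (z : ℂ) :
    leftProd w g k e (1 / 2) z = leftProd w g k e' (1 / 2) z := by
  have key : leftProd w g k true (1 / 2) z = leftProd w g k false (1 / 2) z := by
    simp only [leftProd, halfLabels, if_true, Bool.false_eq_true, if_false, labels_succ]
    refine prefixProd_letterAct _ (leftCount_le _ _ _) ?_
    rw [leftCount_eq, strand_outer, strand_outer, strand_rest]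
    have hc : Real.cos (Real.pi * (1 / 2)) = 0 := by
      rw [mul_one_div, Real.cos_pi_div_two]
    simp only [hc, mul_zero, zero_div, add_zero]
    generalize w.get k = l
    obtain ⟨i, ε⟩ := l
    fin_cases i <;> simp only [midPoint] <;> norm_num <;> split_ifs <;> first | omega | linarith
  cases e <;> cases e' <;> simp only [key]

theorem leftProd_eq_of_half {w : BraidWord} (g : Fin 3 → G) (k : Fin w.length) {e e' : Bool}
    {s : ℝ} (hs : s ∈ halfTime e) (hs' : s ∈ halfTime e') (z : ℂ) :
    leftProd w g k e s z = leftProd w g k e' s z := by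
  by_cases h : e = e'
  · rw [h]
  · have : s = 1 / 2 := by
      cases e <;> cases e' <;> simp [halfTime] at h hs hs' <;> linarith
    rw [this]
    exact leftProd_half w g k e e' z

/-- The hypothesis that w fixes g is used here to glue the last letter to the first. -/
theorem leftProd_one_eq_zero {w : BraidWord} {g : Fin 3 → G} (hg : braidAct w g = g)
    {k k' : Fin w.length} (hk : (k' : ℕ) = k + 1 ∨ (k : ℕ) + 1 = w.length ∧ (k' : ℕ) = 0) (z : ℂ) :
    leftProd w g k true 1 z = leftProd w g k' false 0 z := by
  simp only [leftProd, leftCount_one, leftCount_zero, halfLabels, if_true, Bool.false_eq_true,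
    if_false]
  rcases hk with hk | ⟨hk, hk'⟩
  · rw [hk]
  · rw [hk, hk', labels_length, hg]
    rfl

theorem leftProd_of_re_lt (w : BraidWord) (g : Fin 3 → G) (k : Fin w.length) (e : Bool) (s : ℝ)
    {z : ℂ} (hz : z.re < -1 / 2) : leftProd w g k e s z = 1 := by
  have : leftCount (w.get k) s z = 0 := by
    rw [leftCount, Finset.card_eq_zero, Finset.filter_eq_empty_iff]
    intro j _
    have := abs_le.1 (abs_re_strand_le (w.get k) j s)
    linarith
  rw [leftProd, this, prefixProd_zero]

theorem leftProd_of_lt_re (w : BraidWord) (g : Fin 3 → G) (k : Fin w.length) (e : Bool) (s : ℝ)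
    {z : ℂ} (hz : 1 / 2 < z.re) : leftProd w g k e s z = g 0 * g 1 * g 2 := by
  have : leftCount (w.get k) s z = 3 := by
    rw [leftCount, Finset.filter_true_of_mem]
    · simp
    intro j _
    have := abs_le.1 (abs_re_strand_le (w.get k) j s)
    linarith
  rw [leftProd, this, prefixProd_three]
  cases e <;> simp [halfLabels, labels, braidAct_prod]

/-! ### The part of the cocycle near a crossing -/

/-- The value at a point between the strands of a letter, on one of the two sides of the strand
above (`b = true`) or below (`b = false`). -/
def sideLabel (l : BraidLetter) (h : Fin 3 → G) (b left : Bool) : G :=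
  if b then (if left then 1 else (h (outer l true))⁻¹)
  else (if left then prefixProd h l.1 else prefixProd h (l.1 + 2) * (h (outer l true))⁻¹)

theorem sideLabel_mul_inv (l : BraidLetter) (h : Fin 3 → G) {s : ℝ} {e : Bool}
    (hs : s ∈ halfTime e) {z : ℂ} (hz : ‖z - midPoint l‖ < 1 / 4)
    (hfree : ∀ j, z.re ≠ (strand l j s).re) :
    sideLabel l h false (decide (z.re < (strand l (outer l false) s).re)) *
      (sideLabel l h true (decide (z.re < (strand l (outer l true) s).re)))⁻¹ =
    prefixProd (if e then letterAct l h else h) (leftCount l s z) := by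
  have hre : |z.re - midPoint l| < 1 / 4 := by
    refine lt_of_le_of_lt ?_ hz
    simpa using Complex.abs_re_le_norm (z - midPoint l)
  have ht := hfree (outer l true)
  have hf := hfree (outer l false)
  have hcos : 0 ≤ (if e then -Real.cos (Real.pi * s) else Real.cos (Real.pi * s)) := by
    have hpi := Real.pi_pos
    cases e
    · simp only [halfTime, Bool.false_eq_true, if_false] at hs ⊢
      exact Real.cos_nonneg_of_neg_pi_div_two_le_of_le (by nlinarith [hs.1]) (by nlinarith [hs.2])
    · simp only [halfTime, if_true] at hs ⊢
      have := Real.cos_nonpos_of_pi_div_two_le_of_le (x := Real.pi * s) (by nlinarith [hs.1])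
        (by nlinarith [hs.2])
      linarith
  rw [leftCount_eq]
  have hrest : (strand l (restStrand l) s).re < z.re ↔ l.1 = 1 := by
    rw [strand_rest]
    rw [abs_lt] at hre
    obtain ⟨i, ε⟩ := l
    fin_cases i <;> simp [midPoint] at hre ⊢ <;> linarith
  -- The sign of the letter and the half of its time decide which moving strand is on the left; this
  -- removes the impossible positions from the case check below.
  have hpos : (z.re < (strand l (outer l true) s).re ∧ (strand l (outer l false) s).re < z.re →
      l.2 ≠ e) ∧ (z.re < (strand l (outer l false) s).re ∧ (strand l (outer l true) s).re < z.re →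
      l.2 = e) := by
    rw [strand_outer, strand_outer]
    simp only
    generalize l.2 = ε
    constructor <;> rintro ⟨h1, h2⟩ <;> cases ε <;> cases e <;> simp [sgn] at * <;> linarith
  simp only [hrest]
  obtain ⟨i, ε⟩ := l
  generalize (strand (i, ε) (outer (i, ε) true) s).re = u at *
  generalize (strand (i, ε) (outer (i, ε) false) s).re = v at *
  rcases lt_or_gt_of_ne ht with ht | ht <;> rcases lt_or_gt_of_ne hf with hf | hf <;>
    simp only [ht, hf, ht.not_gt, hf.not_gt, true_and, and_true, and_false,
      false_imp_iff, true_imp_iff, decide_true, decide_false, if_true, if_false] at hpos ⊢ <;>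
    fin_cases i <;> cases ε <;> cases e <;>
    simp [sideLabel, prefixProd_zero, prefixProd_one, prefixProd_two, prefixProd_three, letterAct,
      outer, mul_assoc] at hpos ⊢

end Labels

section Cocycle

variable {G : Type} [Group G]

/-- The product of the labels of the strands to the left of a point of the sphere. -/
def sphereProd (w : BraidWord) (hw : 0 < w.length) (g : Fin 3 → G) (x : S3) : G :=
  leftProd w g (exists_atTime hw x).choose
    (exists_mem_halfTime (exists_atTime hw x).choose_spec.choose_spec.1).choose
    (exists_atTime hw x).choose_spec.choose (x.1 0)

theorem re_ne_of_mem_sideChart {w : BraidWord} {x : S3} (ht : x ∈ sideChart w true)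
    (hf : x ∈ sideChart w false) {k : Fin w.length} {s : ℝ} (hs : s ∈ Set.Icc (0 : ℝ) 1)
    (h : AtTime w.length x ((k : ℕ) + s)) (j : Fin 3) :
    (x.1 0).re ≠ (strand (w.get k) j s).re := by
  intro he
  have h1 := ht.2 k j s hs h he
  have h2 := hf.2 k j s hs h he
  simp [sgn] at h1 h2
  linarith

theorem leftProd_eq_of_norm_lt {w : BraidWord} {g : Fin 3 → G} (hg : braidAct w g = g) {x : S3}
    (hx : ‖x.1 0‖ < 1) {k k' : Fin w.length} {e e' : Bool} {s s' : ℝ}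
    (hs : s ∈ halfTime e) (hs' : s' ∈ halfTime e') (h : AtTime w.length x ((k : ℕ) + s))
    (h' : AtTime w.length x ((k' : ℕ) + s')) :
    leftProd w g k e s (x.1 0) = leftProd w g k' e' s' (x.1 0) := by
  have h1 : (1 : ℝ) ∈ halfTime true := by norm_num [halfTime]
  have h0 : (0 : ℝ) ∈ halfTime false := by norm_num [halfTime]
  rcases AtTime.unique' hx (halfTime_subset e hs) (halfTime_subset e' hs') h h' with
    ⟨rfl, rfl⟩ | ⟨rfl, rfl, hk⟩ | ⟨rfl, rfl, hk⟩
  · exact leftProd_eq_of_half g k hs hs' _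
  · rw [leftProd_eq_of_half g k hs h1, leftProd_eq_of_half g k' hs' h0,
      leftProd_one_eq_zero hg hk]
  · rw [leftProd_eq_of_half g k hs h0, leftProd_eq_of_half g k' hs' h1,
      leftProd_one_eq_zero hg hk]

/-- The chosen time does not matter: off the axis two choices differ only at ends of letters or at
half time, and for |Re z| > 1/2 the product is 1 or g₁g₂g₃ at all times. -/
theorem sphereProd_eq {w : BraidWord} (hw : 0 < w.length) {g : Fin 3 → G} (hg : braidAct w g = g)
    {x : S3} (hx : ‖x.1 0‖ < 1 ∨ 1 / 2 < |(x.1 0).re|) {k : Fin w.length} {e : Bool} {s : ℝ}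
    (hs : s ∈ halfTime e) (h : AtTime w.length x ((k : ℕ) + s)) :
    sphereProd w hw g x = leftProd w g k e s (x.1 0) := by
  have hE := (exists_atTime hw x).choose_spec.choose_spec
  rcases hx with hx | hx
  · exact leftProd_eq_of_norm_lt hg hx (exists_mem_halfTime hE.1).choose_spec hs hE.2 h
  · rcases lt_abs.1 hx with h1 | h1
    · rw [sphereProd, leftProd_of_lt_re _ _ _ _ _ h1, leftProd_of_lt_re _ _ _ _ _ h1]
    · have h2 : (x.1 0).re < -1 / 2 := by linarith
      rw [sphereProd, leftProd_of_re_lt _ _ _ _ _ h2, leftProd_of_re_lt _ _ _ _ _ h2]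

theorem norm_lt_one_or_of_abs_im_lt {z : ℂ} (h : |z.im| < 1 / 2) : ‖z‖ < 1 ∨ 1 / 2 < |z.re| := by
  by_contra! hc
  obtain ⟨h1, h2⟩ := hc
  have h3 : (1 : ℝ) ≤ ‖z‖ ^ 2 := by nlinarith
  rw [← Complex.normSq_eq_norm_sq, Complex.normSq_apply] at h3
  have h4 := abs_le.1 h2
  have h5 := abs_lt.1 h
  nlinarith

/-- The bounds on Im z in `sideChart` exist for this: near the axis, where the time degenerates, the
overlap of the side charts meets only the region in which the product is independent of time. -/
theorem norm_lt_one_or_of_mem_sideChart {w : BraidWord} {x : S3} (ht : x ∈ sideChart w true)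
    (hf : x ∈ sideChart w false) : ‖x.1 0‖ < 1 ∨ 1 / 2 < |(x.1 0).re| := by
  apply norm_lt_one_or_of_abs_im_lt
  have h1 := ht.1
  have h2 := hf.1
  simp only [sgn, if_true, Bool.false_eq_true, if_false] at h1 h2
  exact abs_lt.2 ⟨by linarith, by linarith⟩

/-- The pieces record the letter, its half and the set of strands to the left. Weak inequalities
make them closed; on the overlap no strand has the real part of the point, so they are strict and
the product is constant. -/
theorem eventually_sphereProd_eq {w : BraidWord} (hw : 0 < w.length) {g : Fin 3 → G}
    (hg : braidAct w g = g) {x : S3} (hx : x ∈ sideChart w true ∩ sideChart w false) :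
    ∀ᶠ y in 𝓝 x, sphereProd w hw g y = sphereProd w hw g x := by
  refine eventually_eq_of_closed_cover
    (O := sideChart w true ∩ sideChart w false)
    (P := fun c : Fin w.length × Bool × Finset (Fin 3) => {x | ∃ s ∈ halfTime c.2.1,
      AtTime w.length x ((c.1 : ℕ) + s) ∧
      ∀ j, if j ∈ c.2.2 then (strand (w.get c.1) j s).re ≤ (x.1 0).re
        else (x.1 0).re ≤ (strand (w.get c.1) j s).re})
    (v := fun c => prefixProd (halfLabels w g c.1 c.2.1) c.2.2.card)
    ((isOpen_sideChart w true).inter (isOpen_sideChart w false)) ?_ ?_ ?_ hx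
  · rintro ⟨k, e, A⟩
    have hcl : IsClosed {p : S3 × ℝ | AtTime w.length p.1 ((k : ℕ) + p.2) ∧
        ∀ j, if j ∈ A then (strand (w.get k) j p.2).re ≤ (p.1.1 0).re
          else (p.1.1 0).re ≤ (strand (w.get k) j p.2).re} := by
      rw [Set.ofPred_and, Set.ofPred_forall]
      refine (isClosed_atTime w.length (by fun_prop)).inter ?_
      refine isClosed_iInter fun j => ?_
      have hs := Complex.continuous_re.comp
        ((continuous_strand (w.get k) j).comp (continuous_snd (X := S3) (Y := ℝ)))
      have hre := S3.continuous_re.comp (continuous_fst (X := S3) (Y := ℝ))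
      split_ifs
      · exact isClosed_le hs hre
      · exact isClosed_le hre hs
    cases e
    · exact isClosed_exists_mem_Icc hcl
    · exact isClosed_exists_mem_Icc hcl
  · intro y hy
    obtain ⟨k, s, hs, h⟩ := exists_atTime hw y
    obtain ⟨e, he⟩ := exists_mem_halfTime hs
    refine ⟨(k, e, Finset.univ.filter fun j => (strand (w.get k) j s).re < (y.1 0).re), s, he, h,
      fun j => ?_⟩
    simp only [Finset.mem_filter, Finset.mem_univ, true_and]
    split_ifs with hlt
    · exact hlt.le
    · exact not_lt.1 hlt
  · rintro ⟨k, e, A⟩ y hy ⟨s, hs, h, hA⟩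
    rw [sphereProd_eq hw hg (norm_lt_one_or_of_mem_sideChart hy.1 hy.2) hs h, leftProd, leftCount]
    congr 2
    ext j
    have hne := re_ne_of_mem_sideChart hy.1 hy.2 (halfTime_subset e hs) h j
    have hj := hA j
    simp only [Finset.mem_filter, Finset.mem_univ, true_and]
    by_cases hjA : j ∈ A
    · rw [if_pos hjA] at hj
      exact iff_of_true (lt_of_le_of_ne hj hne.symm) hjA
    · rw [if_neg hjA] at hj
      exact iff_of_false (not_lt.2 hj) hjA

open Classical in
/-- The discontinuous trivialization of the covering over the three charts. -/
def chartLabel (w : BraidWord) (hw : 0 < w.length) (g : Fin 3 → G) : Option Bool → S3 → G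
  | none, _ => 1
  | some b, x =>
    if h : x ∈ betweenChart w then
      sideLabel (w.get h.choose) (labels w g h.choose) b
        (decide ((x.1 0).re < (strand (w.get h.choose) (outer (w.get h.choose) b)
          h.choose_spec.choose).re))
    else if b then 1 else sphereProd w hw g x

theorem chartLabel_of_betweenAt {w : BraidWord} (hw : 0 < w.length) (g : Fin 3 → G) {x : S3}
    {k : Fin w.length} {s : ℝ} (h : betweenAt w x k s) (b : Bool) :
    chartLabel w hw g (some b) x = sideLabel (w.get k) (labels w g k) b
      (decide ((x.1 0).re < (strand (w.get k) (outer (w.get k) b) s).re)) := by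
  have hB : x ∈ betweenChart w := ⟨k, s, h⟩
  rw [chartLabel, dif_pos hB]
  have h2 := hB.choose_spec.choose_spec
  obtain ⟨hk, hs⟩ := h2.unique (Set.Ioo_subset_Icc_self h.1) h.2.1
  rw [← hs]
  congr! <;> exact hk.symm

theorem chartLabel_of_notMem {w : BraidWord} (hw : 0 < w.length) (g : Fin 3 → G) {x : S3}
    (h : x ∉ betweenChart w) (b : Bool) :
    chartLabel w hw g (some b) x = if b then 1 else sphereProd w hw g x := by
  rw [chartLabel, dif_neg h]

theorem chartLabel_mul_inv {w : BraidWord} (hw : 0 < w.length) {g : Fin 3 → G}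
    (hg : braidAct w g = g) {x : S3} (hx : x ∈ sideChart w true ∩ sideChart w false) :
    chartLabel w hw g (some false) x * (chartLabel w hw g (some true) x)⁻¹ =
      sphereProd w hw g x := by
  by_cases h : x ∈ betweenChart w
  · obtain ⟨k, s, h⟩ := h
    obtain ⟨e, he⟩ := exists_mem_halfTime (Set.Ioo_subset_Icc_self h.1)
    rw [chartLabel_of_betweenAt hw g h, chartLabel_of_betweenAt hw g h,
      sphereProd_eq hw hg (Or.inl (norm_lt_one_of_near h.2.2)) he h.2.1,
      sideLabel_mul_inv _ _ he h.2.2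
        (re_ne_of_mem_sideChart hx.1 hx.2 (Set.Ioo_subset_Icc_self h.1) h.2.1), ← labels_succ]
    rfl
  · rw [chartLabel_of_notMem hw g h, chartLabel_of_notMem hw g h]
    simp

theorem eventually_chartLabel_eq {w : BraidWord} (hw : 0 < w.length) (g : Fin 3 → G) {x : S3}
    {b : Bool} (hx : x ∈ betweenChart w ∩ sideChart w b) :
    ∀ᶠ y in 𝓝 x, chartLabel w hw g (some b) y = chartLabel w hw g (some b) x := by
  refine eventually_eq_of_closed_cover
    (O := betweenChart w ∩ sideChart w b)
    (P := fun c : Fin w.length × Bool => {x | ∃ s ∈ Set.Icc (0 : ℝ) 1,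
      AtTime w.length x ((c.1 : ℕ) + s) ∧
      if c.2 then (x.1 0).re ≤ (strand (w.get c.1) (outer (w.get c.1) b) s).re
        else (strand (w.get c.1) (outer (w.get c.1) b) s).re ≤ (x.1 0).re})
    (v := fun c => sideLabel (w.get c.1) (labels w g c.1) b c.2)
    ((isOpen_betweenChart hw).inter (isOpen_sideChart w b)) ?_ ?_ ?_ hx
  · rintro ⟨k, e⟩
    apply isClosed_exists_mem_Icc
    refine (isClosed_atTime w.length (by fun_prop)).inter ?_
    have hs := Complex.continuous_re.comp ((continuous_strand (w.get k)
      (outer (w.get k) b)).comp (continuous_snd (X := S3) (Y := ℝ)))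
    have hre := S3.continuous_re.comp (continuous_fst (X := S3) (Y := ℝ))
    cases e
    · exact isClosed_le hs hre
    · exact isClosed_le hre hs
  · intro y hy
    obtain ⟨k, s, hs, h⟩ := exists_atTime hw y
    rcases le_total (y.1 0).re (strand (w.get k) (outer (w.get k) b) s).re with hle | hle
    · exact ⟨(k, true), s, hs, h, by simpa using hle⟩
    · exact ⟨(k, false), s, hs, h, by simpa using hle⟩
  · rintro ⟨k, e⟩ y ⟨⟨k', s', hB⟩, hy⟩ ⟨s, hs, h, he⟩
    obtain ⟨rfl, rfl⟩ := hB.unique hs h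
    rw [chartLabel_of_betweenAt hw g hB]
    congr 1
    -- The strand moves on the circle of radius 1/4 about the midpoint. A point beyond it with the
    -- same real part would be outside the open disc, so the overlap splits into a left and a right
    -- part.
    have hne : (y.1 0).re ≠ (strand (w.get k) (outer (w.get k) b) s).re := by
      intro heq
      have h1 := hy.2 k _ s hs h heq
      have hB3 := hB.2.2
      rw [← sq_lt_sq₀ (norm_nonneg _) (by norm_num), ← Complex.normSq_eq_norm_sq,
        Complex.normSq_apply] at hB3
      rw [strand_outer] at heq h1
      simp only [Complex.sub_re, Complex.ofReal_re, Complex.sub_im, Complex.ofReal_im, sub_zero,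
        heq, add_sub_cancel_left] at hB3
      have hsin : 0 ≤ Real.sin (Real.pi * s) :=
        Real.sin_nonneg_of_nonneg_of_le_pi (by nlinarith [Real.pi_pos, hs.1])
          (by nlinarith [Real.pi_pos, hs.2])
      have h2 := Real.sin_sq_add_cos_sq (Real.pi * s)
      have hb := sgn_mul_self b
      have hl := sgn_mul_self (w.get k).2
      have h3 : sgn b * (sgn b * Real.sin (Real.pi * s) / 4) = Real.sin (Real.pi * s) / 4 := by
        linear_combination (Real.sin (Real.pi * s) / 4) * hb
      have h4 : (sgn b * (y.1 0).im) ^ 2 = (y.1 0).im * (y.1 0).im := by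
        linear_combination ((y.1 0).im * (y.1 0).im) * hb
      have h5 : sgn b * sgn (w.get k).2 * Real.cos (Real.pi * s) / 4 *
          (sgn b * sgn (w.get k).2 * Real.cos (Real.pi * s) / 4) =
          Real.cos (Real.pi * s) ^ 2 / 16 := by
        linear_combination (Real.cos (Real.pi * s) ^ 2 / 16) *
          ((sgn (w.get k).2 * sgn (w.get k).2) * hb + hl)
      rw [h5, ← h4] at hB3
      rw [h3, not_le] at h1
      nlinarith
    cases e
    · simp only [Bool.false_eq_true, if_false] at he
      exact decide_eq_false (not_lt.2 he)
    · simp only [if_true] at he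
      exact decide_eq_true (lt_of_le_of_ne he hne)

/-- The three charts. -/
def chart (w : BraidWord) : Option Bool → Set S3
  | none => betweenChart w
  | some b => sideChart w b

theorem eventually_chartLabel_mul_inv {w : BraidWord} (hw : 0 < w.length) {g : Fin 3 → G}
    (hg : braidAct w g = g) (i j : Option Bool) {x : S3} (hx : x ∈ chart w i ∩ chart w j) :
    ∀ᶠ y in 𝓝 x, chartLabel w hw g i y * (chartLabel w hw g j y)⁻¹ =
      chartLabel w hw g i x * (chartLabel w hw g j x)⁻¹ := by
  have key : ∀ {y}, y ∈ sideChart w true ∩ sideChart w false → ∀ᶠ z in 𝓝 y,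
      chartLabel w hw g (some false) z * (chartLabel w hw g (some true) z)⁻¹ =
      chartLabel w hw g (some false) y * (chartLabel w hw g (some true) y)⁻¹ := by
    intro y hy
    filter_upwards [eventually_sphereProd_eq hw hg hy,
      ((isOpen_sideChart w true).inter (isOpen_sideChart w false)).mem_nhds hy] with z hz hz2
    rw [chartLabel_mul_inv hw hg hy, chartLabel_mul_inv hw hg hz2, hz]
  match i, j, hx with
  | none, none, _ => exact Filter.Eventually.of_forall fun _ => rfl
  | some b, none, hx =>
    filter_upwards [eventually_chartLabel_eq hw g hx.symm] with y hy
    rw [hy]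
    rfl
  | none, some b, hx =>
    filter_upwards [eventually_chartLabel_eq hw g hx] with y hy
    rw [hy]
    rfl
  | some true, some true, _ => simp
  | some false, some false, _ => simp
  | some false, some true, hx => exact key hx.symm
  | some true, some false, hx =>
    filter_upwards [key hx] with y hy
    simpa using congrArg (·⁻¹) hy

theorem isOpen_chart {w : BraidWord} (hw : 0 < w.length) (i : Option Bool) :
    IsOpen (chart w i) := by
  cases i
  · exact isOpen_betweenChart hw
  · exact isOpen_sideChart w _

end Cocycle

/-! ### Representations of the group of a closed braid -/

theorem atTime_pageToSphere (N : ℕ) (z : ℂ) (hz : ‖z‖ ≤ 1) : AtTime N (pageToSphere z hz) 0 := by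
  simp [AtTime, pageToSphere]

theorem pageToSphere_mem_sideChart {w : BraidWord} {b : Bool} {z : ℂ} (hz : ‖z‖ ≤ 1)
    (h1 : -1 / 2 < sgn b * z.im) (h2 : ∀ c, z.re = (puncture c).re → 0 < sgn b * z.im) :
    pageToSphere z hz ∈ sideChart w b := by
  refine ⟨h1, fun k j s hs ht hre him => ?_⟩
  change z.re = _ at hre
  change sgn b * z.im ≤ _ at him
  have hr := abs_le.1 (abs_re_strand_le (w.get k) j s)
  have hi : sgn b * (strand (w.get k) j s).im ≤ 1 / 4 := by
    refine (le_abs_self _).trans ?_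
    rw [abs_mul, abs_sgn, one_mul]
    exact abs_im_strand_le _ _ _
  have hnorm : ‖z‖ < 1 := by
    rw [← sq_lt_one_iff₀ (norm_nonneg _), ← Complex.normSq_eq_norm_sq, Complex.normSq_apply]
    have h3 : z.im * z.im = (sgn b * z.im) * (sgn b * z.im) := by
      linear_combination (-z.im * z.im) * sgn_mul_self b
    rw [h3]
    nlinarith
  have hk : ((k : ℕ) : ℝ) + 1 ≤ w.length := by exact_mod_cast k.2
  have hk0 : (0 : ℝ) ≤ (k : ℕ) := Nat.cast_nonneg _
  have hs01 : s = 0 ∨ s = 1 := by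
    rcases AtTime.unique k.pos (x := pageToSphere z hz) hnorm ht (atTime_pageToSphere _ z hz)
      ⟨by linarith [hs.1], by linarith [hs.2]⟩ ⟨le_rfl, by linarith⟩ with h | ⟨h, -⟩ | ⟨h, -⟩
    · exact Or.inl (by linarith [hs.1])
    · exact Or.inl (by linarith [hs.1])
    · exact Or.inr (by linarith [hs.2])
  have him0 : ∀ c, (puncture c).im = 0 := fun c => by simp [puncture]
  rcases hs01 with rfl | rfl
  · rw [strand_zero] at hre him
    have := h2 _ hre
    rw [him0] at him
    linarith
  · rw [strand_one_eq] at hre him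
    have := h2 _ hre
    rw [him0] at him
    linarith

theorem pageToSphere_notMem_betweenChart {w : BraidWord} (hw : 0 < w.length) {z : ℂ}
    (hz : ‖z‖ ≤ 1) : pageToSphere z hz ∉ betweenChart w := by
  rintro ⟨k, s, h⟩
  have h0 := (h.unique (k' := ⟨0, hw⟩) (s' := 0) ⟨le_rfl, zero_le_one⟩
    (by simpa using atTime_pageToSphere w.length z hz)).2
  exact h.1.1.ne h0

section

variable {G : Type} [Group G] {w : BraidWord} {g : Fin 3 → G}

theorem chartLabel_true_pageToSphere (hw : 0 < w.length) {z : ℂ} (hz : ‖z‖ ≤ 1) :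
    chartLabel w hw g (some true) (pageToSphere z hz) = 1 := by
  rw [chartLabel_of_notMem hw g (pageToSphere_notMem_betweenChart hw hz)]
  rfl

theorem chartLabel_false_pageToSphere (hw : 0 < w.length) (hg : braidAct w g = g) {z : ℂ} (hz : ‖z‖ < 1) :
    chartLabel w hw g (some false) (pageToSphere z hz.le) =
      prefixProd g (Finset.univ.filter fun j => (puncture j).re < z.re).card := by
  rw [chartLabel_of_notMem hw g (pageToSphere_notMem_betweenChart hw hz.le),
    sphereProd_eq hw hg (Or.inl hz) (k := ⟨0, hw⟩) (e := false) (s := 0) (by norm_num [halfTime])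
      (by simpa using atTime_pageToSphere w.length z hz.le), leftProd, leftCount_zero]
  rfl

/-- A segment in the punctured disc. -/
def pageSegment (a b : Page)
    (h : ∀ t, ‖Path.segment a.1 b.1 t‖ ≤ 1 ∧ ∀ j, Path.segment a.1 b.1 t ≠ puncture j) :
    Path a b where
  toFun t := ⟨Path.segment a.1 b.1 t, h t⟩
  continuous_toFun := by fun_prop
  source' := Subtype.ext (Path.segment a.1 b.1).source
  target' := Subtype.ext (Path.segment a.1 b.1).target

theorem exists_pageLoop_eq (j : Fin 3) : ∃ (a b : Page)
    (h1 : ∀ t, ‖Path.segment pageBase.1 a.1 t‖ ≤ 1 ∧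
      ∀ j, Path.segment pageBase.1 a.1 t ≠ puncture j)
    (h2 : ∀ t, ‖Path.segment a.1 b.1 t‖ ≤ 1 ∧ ∀ j, Path.segment a.1 b.1 t ≠ puncture j)
    (h3 : ∀ t, ‖Path.segment b.1 pageBase.1 t‖ ≤ 1 ∧
      ∀ j, Path.segment b.1 pageBase.1 t ≠ puncture j),
    a.1 = puncture j + (1 - Complex.I) / 8 ∧ b.1 = puncture j - (1 + Complex.I) / 8 ∧
    pageLoop j = (pageSegment pageBase a h1).trans
      ((pageSegment a b h2).trans (pageSegment b pageBase h3)) := by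
  have hr : ∀ z ∈ Set.range (triangle j), ‖z‖ ≤ 1 ∧ ∀ k : Fin 3, z ≠ puncture k := by
    rintro _ ⟨t, rfl⟩
    exact triangle_mem j t
  have h1 : ∀ t, Path.segment Complex.I (puncture j + (1 - Complex.I) / 8) t ∈
      Set.range (triangle j) := fun t => by
    rw [triangle, Path.trans_range]
    exact Or.inl ⟨t, rfl⟩
  have h2 : ∀ t, Path.segment (puncture j + (1 - Complex.I) / 8)
      (puncture j - (1 + Complex.I) / 8) t ∈ Set.range (triangle j) := fun t => by
    rw [triangle, Path.trans_range, Path.trans_range]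
    exact Or.inr (Or.inl ⟨t, rfl⟩)
  have h3 : ∀ t, Path.segment (puncture j - (1 + Complex.I) / 8) Complex.I t ∈
      Set.range (triangle j) := fun t => by
    rw [triangle, Path.trans_range, Path.trans_range]
    exact Or.inr (Or.inr ⟨t, rfl⟩)
  have ha := hr _ (h1 1)
  have hb := hr _ (h2 1)
  rw [Path.target] at ha hb
  refine ⟨⟨_, ha⟩, ⟨_, hb⟩, fun t => hr _ (h1 t), fun t => hr _ (h2 t), fun t => hr _ (h3 t),
    rfl, rfl, ?_⟩
  ext t
  change triangle j t = _
  rw [triangle, Path.trans_apply, Path.trans_apply]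
  split_ifs with h
  · rfl
  · rw [Path.trans_apply, Path.trans_apply]
    split_ifs <;> rfl

theorem segment_apply_re_im (a b : ℂ) (t : unitInterval) :
    (Path.segment a b t).re = a.re + t * (b.re - a.re) ∧
      (Path.segment a b t).im = a.im + t * (b.im - a.im) := by
  simp only [Path.segment_apply, AffineMap.lineMap_apply_module']
  constructor <;> simp <;> ring

theorem card_puncture_lt_succ (j : Fin 3) {z : ℂ} (hz : z.re = (puncture j).re + 1 / 8) :
    (Finset.univ.filter fun j => (puncture j).re < z.re).card = (j : ℕ) + 1 := by
  rw [Finset.card_filter, Fin.sum_univ_three, hz]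
  fin_cases j <;> norm_num [puncture]

theorem card_puncture_lt (j : Fin 3) {z : ℂ} (hz : z.re = (puncture j).re - 1 / 8) :
    (Finset.univ.filter fun j => (puncture j).re < z.re).card = j := by
  rw [Finset.card_filter, Fin.sum_univ_three, hz]
  fin_cases j <;> norm_num [puncture]

theorem prefixProd_succ (h : Fin 3 → G) (j : Fin 3) :
    prefixProd h ((j : ℕ) + 1) = prefixProd h j * h j := by
  fin_cases j <;>
    simp [prefixProd_zero, prefixProd_one, prefixProd_two, prefixProd_three]

/-- A triple that is fixed by a braid is the image of the Wirtinger generators of the closed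
braid. -/
theorem exists_hom_of_braidAct_eq (hw : 0 < w.length) (hg : braidAct w g = g) :
    ∃ Φ : KnotGroup (closedBraid w) (axisPoint w) →* G, ∀ j, Φ (wirtinger w j) = g j := by
  obtain ⟨Ψ, htrans, hpath⟩ := exists_holonomy
    (X := ↥(closedBraid w)ᶜ) (U := fun i => Subtype.val ⁻¹' chart w i)
    (a := fun i x => chartLabel w hw g i x.1)
    (fun i => (isOpen_chart hw i).preimage continuous_subtype_val)
    (fun x => by
      rcases mem_charts x.2 with ⟨b, hb⟩ | hb
      · exact ⟨some b, hb⟩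
      · exact ⟨none, hb⟩)
    (fun i j x hx => continuous_subtype_val.continuousAt.eventually
      (eventually_chartLabel_mul_inv hw hg i j hx))
  -- The reversed order in the holonomy of a concatenation matches the product in
  -- `FundamentalGroup`, so this is a homomorphism and not an antihomomorphism.
  refine ⟨MonoidHom.mk' (fun p => Ψ _ _ (FundamentalGroup.toPath p)) fun p q => htrans _ _ _ _ _,
    fun j => ?_⟩
  obtain ⟨a, b, h1, h2, h3, ha, hb, hloop⟩ := exists_pageLoop_eq j
  change Ψ _ _ (Path.Homotopic.Quotient.mk ((pageLoop j).map (pageMap w).continuous)) = g j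
  have hare : a.1.re = (puncture j).re + 1 / 8 := by rw [ha]; simp
  have haim : a.1.im = -1 / 8 := by rw [ha]; norm_num [puncture]
  have hbre : b.1.re = (puncture j).re - 1 / 8 := by rw [hb]; simp
  have hbim : b.1.im = -1 / 8 := by rw [hb]; norm_num [puncture]
  have hpj : -1 / 2 ≤ (puncture j).re ∧ (puncture j).re ≤ 1 / 2 := by
    fin_cases j <;> norm_num [puncture]
  have hlt : ∀ z : ℂ, z.im = -1 / 8 → -5 / 8 ≤ z.re → z.re ≤ 5 / 8 → ‖z‖ < 1 := by
    intro z h1 h2 h3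
    rw [← sq_lt_one_iff₀ (norm_nonneg _), ← Complex.normSq_eq_norm_sq, Complex.normSq_apply, h1]
    nlinarith
  rw [hloop, Path.map_trans, Path.map_trans, Path.Homotopic.Quotient.mk_trans,
    Path.Homotopic.Quotient.mk_trans, htrans, htrans]
  have e1 := hpath (some true) _ _ ((pageSegment pageBase a h1).map (pageMap w).continuous)
    (fun t => by
      obtain ⟨hre, him⟩ := segment_apply_re_im pageBase.1 a.1 t
      obtain ⟨t0, t1⟩ := t.2
      change _ = Complex.I.re + _ * (_ - Complex.I.re) at hre
      change _ = Complex.I.im + _ * (_ - Complex.I.im) at him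
      rw [Complex.I_re, hare] at hre
      rw [Complex.I_im, haim] at him
      refine pageToSphere_mem_sideChart (h1 t).1 ?_ ?_
      · simp only [sgn, if_true, him]
        linarith
      · intro c hc
        change (Path.segment pageBase.1 a.1 t).re = _ at hc
        simp only [sgn, if_true, one_mul]
        by_contra! hle
        change (Path.segment pageBase.1 a.1 t).im ≤ 0 at hle
        rw [him] at hle
        rw [hre] at hc
        generalize (t : ℝ) = t at *
        fin_cases j <;> fin_cases c <;> norm_num [puncture] at hc <;> linarith)
  have e2 := hpath (some false) _ _ ((pageSegment a b h2).map (pageMap w).continuous)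
    (fun t => by
      obtain ⟨hre, him⟩ := segment_apply_re_im a.1 b.1 t
      rw [haim, hbim] at him
      have h0 : 0 < sgn false * (Path.segment a.1 b.1 t).im := by
        rw [him]
        norm_num [sgn]
      exact pageToSphere_mem_sideChart (h2 t).1 (lt_trans (by norm_num) h0) fun _ _ => h0)
  have e3 := hpath (some true) _ _ ((pageSegment b pageBase h3).map (pageMap w).continuous)
    (fun t => by
      obtain ⟨hre, him⟩ := segment_apply_re_im b.1 pageBase.1 t
      obtain ⟨t0, t1⟩ := t.2
      change _ = _ + _ * (Complex.I.re - _) at hre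
      change _ = _ + _ * (Complex.I.im - _) at him
      rw [Complex.I_re, hbre] at hre
      rw [Complex.I_im, hbim] at him
      refine pageToSphere_mem_sideChart (h3 t).1 ?_ ?_
      · simp only [sgn, if_true, him]
        linarith
      · intro c hc
        change (Path.segment b.1 pageBase.1 t).re = _ at hc
        simp only [sgn, if_true, one_mul]
        by_contra! hle
        change (Path.segment b.1 pageBase.1 t).im ≤ 0 at hle
        rw [him] at hle
        rw [hre] at hc
        generalize (t : ℝ) = t at *
        fin_cases j <;> fin_cases c <;> norm_num [puncture] at hc <;> linarith)
  -- The two long sides of the triangle lie in the upper chart, whose label on the page is 1. The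
  -- short side passes below the j-th point and contributes the quotient of two consecutive prefix
  -- products, which is g j.
  rw [e1, e2, e3]
  have ea : chartLabel w hw g (some false) (pageMap w a).1 = prefixProd g ((j : ℕ) + 1) := by
    rw [← card_puncture_lt_succ j hare]
    exact chartLabel_false_pageToSphere hw hg
      (hlt a.1 haim (by linarith [hpj.1]) (by linarith [hpj.2]))
  have eb : chartLabel w hw g (some false) (pageMap w b).1 = prefixProd g j := by
    rw [← card_puncture_lt j hbre]
    exact chartLabel_false_pageToSphere hw hg
      (hlt b.1 hbim (by linarith [hpj.1]) (by linarith [hpj.2]))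
  have et : ∀ z : Page, chartLabel w hw g (some true) (pageMap w z).1 = 1 := fun z =>
    chartLabel_true_pageToSphere hw z.2.1
  rw [ea, eb, et, et, et, prefixProd_succ]
  simp

end

/-! ### The closure of `(σ₁ σ₂⁻¹)⁵` is a knot -/

theorem strand_injective (l : BraidLetter) (s : ℝ) : Function.Injective fun j => strand l j s := by
  have houter : strand l (outer l true) s ≠ strand l (outer l false) s := by
    intro h
    rw [strand_outer, strand_outer] at h
    have h1 := congrArg Complex.re h
    have h2 := congrArg Complex.im h
    have h3 := Real.sin_sq_add_cos_sq (Real.pi * s)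
    simp only at h1 h2
    generalize l.2 = ε at h1
    cases ε <;> simp [sgn] at h1 h2 <;> nlinarith
  intro j j' h
  simp only at h
  obtain ⟨b, rfl⟩ | rfl := eq_outer_or_rest l j <;>
    obtain ⟨b', rfl⟩ | rfl := eq_outer_or_rest l j'
  · cases b <;> cases b' <;> first | rfl | exact absurd h houter | exact absurd h.symm houter
  · exact absurd (congrArg Complex.re h) (re_strand_outer_ne l b s)
  · exact absurd (congrArg Complex.re h).symm (re_strand_outer_ne l b' s)
  · rfl

/-- The letters of `(σ₁ σ₂⁻¹)ⁿ`. -/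
def turksHeadLetter (m : ℕ) : BraidLetter := if m % 2 = 0 then (0, true) else (1, false)

/-- The positions at integral times of the strand of `(σ₁ σ₂⁻¹)ⁿ` that starts on the left. -/
def turksHeadPosition (m : ℕ) : Fin 3 := ![0, 1, 2, 2, 1, 0] (Fin.ofNat 6 m)

theorem turksHeadPosition_succ : ∀ m < 30, turksHeadPosition (m + 1) =
    Equiv.swap (turksHeadLetter m).1.castSucc (turksHeadLetter m).1.succ
      (turksHeadPosition m) := by
  decide

/-- The first coordinate of a parametrization of the knot `10₁₂₃`. -/
def turksHeadCoord (t : ℝ) : ℂ := puncture 0 + ∑ m ∈ Finset.range 30,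
  (strand (turksHeadLetter m) (turksHeadPosition m) (max 0 (min 1 (t - m))) -
    puncture (turksHeadPosition m))

/-- The clamped times make the sum telescope: finished letters contribute their total displacement,
future ones nothing. Continuity of the parametrization is then immediate. -/
theorem turksHeadCoord_add {k : ℕ} (hk : k < 30) {s : ℝ} (hs : s ∈ Set.Icc (0 : ℝ) 1) :
    turksHeadCoord (k + s) = strand (turksHeadLetter k) (turksHeadPosition k) s := by
  have hsub : Finset.range (k + 1) ⊆ Finset.range 30 := Finset.range_subset_range.2 hk
  rw [turksHeadCoord, ← Finset.sum_subset hsub, Finset.sum_range_succ]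
  · have h1 : ∀ m ∈ Finset.range k, strand (turksHeadLetter m) (turksHeadPosition m)
        (max 0 (min 1 (k + s - m))) - puncture (turksHeadPosition m) =
        puncture (turksHeadPosition (m + 1)) - puncture (turksHeadPosition m) := by
      intro m hm
      have hm' := Finset.mem_range.1 hm
      have : (m : ℝ) + 1 ≤ k := by exact_mod_cast hm'
      rw [min_eq_left (by linarith [hs.1]), max_eq_right zero_le_one, strand_one_eq,
        turksHeadPosition_succ m (hm'.trans hk)]
    rw [Finset.sum_congr rfl h1, Finset.sum_range_sub fun m => puncture (turksHeadPosition m)]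
    rw [add_sub_cancel_left, min_eq_right hs.2, max_eq_right hs.1]
    have : turksHeadPosition 0 = 0 := rfl
    rw [this]
    ring
  · intro m _ hm
    have hm' : (k : ℝ) + 1 ≤ m := by
      rw [Finset.mem_range, not_lt] at hm
      exact_mod_cast hm
    have h0 : (k : ℝ) + s - m ≤ 0 := by linarith [hs.2]
    rw [max_eq_left ((min_le_right _ _).trans h0), strand_zero, sub_self]

theorem continuous_turksHeadCoord : Continuous turksHeadCoord := by
  unfold turksHeadCoord
  refine continuous_const.add (continuous_finsetSum _ fun m _ => Continuous.sub ?_ continuous_const)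
  exact (continuous_strand _ _).comp (by fun_prop)

/-- The point with the angle `2πt/10` of a parametrization of the knot `10₁₂₃`. -/
def turksHeadPoint (t : ℝ) : EuclideanSpace ℂ (Fin 2) :=
  !₂[turksHeadCoord t, (Real.sqrt (1 - ‖turksHeadCoord t‖ ^ 2) : ℂ) *
    Complex.exp ((2 * Real.pi * (t / 10) : ℝ) * Complex.I)]

theorem continuous_turksHeadPoint : Continuous turksHeadPoint := by
  have := continuous_turksHeadCoord
  refine (PiLp.continuous_toLp 2 _).comp (continuous_pi fun i => ?_)
  fin_cases i
  · exact this
  · simp only [Fin.mk_one, Matrix.cons_val_one, Matrix.cons_val_fin_one]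
    fun_prop

theorem knot10_123_get : ∀ k : Fin (List.replicate 5
    ([(0, true), (1, false)] : BraidWord)).flatten.length,
    (List.replicate 5 ([(0, true), (1, false)] : BraidWord)).flatten.get k =
      turksHeadLetter k := by
  decide

/-- The permutation of (σ₁σ₂⁻¹)⁵ is a 3-cycle, so a single strand followed through 3 · 10 letters
occupies every position at every letter. -/
theorem exists_turksHeadPosition : ∀ k < 10, ∀ j, ∃ m < 30, m % 10 = k ∧
    turksHeadLetter m = turksHeadLetter k ∧ turksHeadPosition m = j := by
  decide

theorem turksHeadPosition_injective : ∀ m < 30, ∀ m' < 30, m % 10 = m' % 10 →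
    turksHeadPosition m = turksHeadPosition m' → m = m' := by
  decide

theorem turksHeadLetter_mod : ∀ m < 30, turksHeadLetter (m % 10) = turksHeadLetter m := by
  decide

theorem exp_angle_mod (m : ℕ) (s : ℝ) :
    Complex.exp ((2 * Real.pi * ((m + s) / 10) : ℝ) * Complex.I) =
      Complex.exp ((2 * Real.pi * (((m % 10 : ℕ) + s) / 10) : ℝ) * Complex.I) := by
  refine Complex.exp_eq_exp_iff_exists_int.2 ⟨(m / 10 : ℕ), ?_⟩
  have h : (m : ℂ) = (m % 10 : ℕ) + 10 * (m / 10 : ℕ) := by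
    exact_mod_cast (Nat.mod_add_div m 10).symm
  rw [Int.cast_natCast]
  push_cast
  rw [h]
  ring

theorem exists_eq_add_of_mem_Ico {t : ℝ} (ht : t ∈ Set.Ico (0 : ℝ) 30) :
    ∃ m : ℕ, m < 30 ∧ ∃ s ∈ Set.Ico (0 : ℝ) 1, t = m + s := by
  refine ⟨⌊t⌋₊, (Nat.floor_lt ht.1).2 (by simpa using ht.2), t - ⌊t⌋₊, ⟨?_, ?_⟩, by ring⟩
  · exact sub_nonneg.2 (Nat.floor_le ht.1)
  · linarith [Nat.lt_floor_add_one t]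

theorem turksHeadPoint_mem_sphere {t : ℝ} (ht : t ∈ Set.Ico (0 : ℝ) 30) :
    turksHeadPoint t ∈ Metric.sphere (0 : EuclideanSpace ℂ (Fin 2)) 1 := by
  have hlt : ‖turksHeadCoord t‖ < 1 := by
    obtain ⟨m, hm, s, hs, rfl⟩ := exists_eq_add_of_mem_Ico ht
    rw [turksHeadCoord_add hm (Set.Ico_subset_Icc_self hs)]
    exact strand_norm_lt _ _ _
  have h : 0 ≤ 1 - ‖turksHeadCoord t‖ ^ 2 := by nlinarith [norm_nonneg (turksHeadCoord t)]
  rw [mem_sphere_zero_iff_norm, EuclideanSpace.norm_eq, turksHeadPoint, Fin.sum_univ_two]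
  simp only [Matrix.cons_val_zero, Matrix.cons_val_one, Matrix.cons_val_fin_one, norm_mul,
    Complex.norm_exp_ofReal_mul_I, Complex.norm_real, mul_one, Real.norm_eq_abs, sq_abs,
    Real.sq_sqrt h, add_sub_cancel, Real.sqrt_one]

theorem turksHeadPoint_zero : turksHeadPoint 30 = turksHeadPoint 0 := by
  have h1 := turksHeadCoord_add (k := 0) (s := 0) (by norm_num) ⟨le_rfl, zero_le_one⟩
  have h2 := turksHeadCoord_add (k := 29) (s := 1) (by norm_num) ⟨zero_le_one, le_rfl⟩
  have h3 := exp_angle_mod 30 0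
  rw [strand_zero] at h1
  rw [strand_one_eq] at h2
  norm_num at h1 h2 h3
  have h4 : turksHeadCoord 30 = turksHeadCoord 0 := by
    rw [h1, h2]
    rfl
  rw [turksHeadPoint, turksHeadPoint, h4]
  norm_num
  rw [h3, mul_one]

theorem mem_knot10_123_iff (x : S3) :
    x ∈ knot10_123 ↔ ∃ t ∈ Set.Ico (0 : ℝ) 30, x.1 = turksHeadPoint t := by
  have hpt : ∀ m : ℕ, m < 30 → ∀ s ∈ Set.Icc (0 : ℝ) 1, turksHeadPoint (m + s) =
      !₂[strand (turksHeadLetter m) (turksHeadPosition m) s,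
        (Real.sqrt (1 - ‖strand (turksHeadLetter m) (turksHeadPosition m) s‖ ^ 2) : ℂ) *
        Complex.exp ((2 * Real.pi * (((m % 10 : ℕ) + s) / 10) : ℝ) * Complex.I)] := by
    intro m hm s hs
    rw [turksHeadPoint, turksHeadCoord_add hm hs, exp_angle_mod]
  have hlen : (List.replicate 5 ([(0, true), (1, false)] : BraidWord)).flatten.length = 10 := rfl
  have hlen' : ((List.replicate 5 ([(0, true), (1, false)] : BraidWord)).flatten.length : ℝ) =
      10 := by
    rw [hlen]
    norm_num
  constructor
  · rintro ⟨k, j, s, hs, h0, h1⟩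
    rw [knot10_123_get] at h0 h1
    obtain ⟨m, hm, hmk, hl, rfl⟩ := exists_turksHeadPosition k k.2 j
    rw [hlen'] at h1
    rw [← hl] at h0 h1
    have hx : x.1 = turksHeadPoint (m + s) := by
      rw [hpt m hm s hs, hmk]
      ext i
      fin_cases i
      · exact h0
      · exact h1
    have hm' : (m : ℝ) + 1 ≤ 30 := by exact_mod_cast hm
    rcases lt_or_ge ((m : ℝ) + s) 30 with hlt | hge
    · exact ⟨m + s, ⟨add_nonneg (Nat.cast_nonneg _) hs.1, hlt⟩, hx⟩
    · refine ⟨0, ⟨le_rfl, by norm_num⟩, ?_⟩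
      rw [hx, show (m : ℝ) + s = 30 by linarith [hs.2], turksHeadPoint_zero]
  · rintro ⟨t, ht, hx⟩
    obtain ⟨m, hm, s, hs, rfl⟩ := exists_eq_add_of_mem_Ico ht
    have hs' := Set.Ico_subset_Icc_self hs
    rw [hpt m hm s hs'] at hx
    refine ⟨⟨m % 10, by rw [hlen]; omega⟩, turksHeadPosition m, s, hs', ?_, ?_⟩
    · rw [knot10_123_get, turksHeadLetter_mod m hm, hx]
      rfl
    · rw [knot10_123_get, turksHeadLetter_mod m hm, hx, hlen']
      rfl

theorem turksHeadPoint_injOn : Set.InjOn turksHeadPoint (Set.Ico 0 30) := by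
  intro t ht t' ht' h
  obtain ⟨x, hx⟩ : ∃ x : S3, x.1 = turksHeadPoint t :=
    ⟨⟨_, turksHeadPoint_mem_sphere ht⟩, rfl⟩
  obtain ⟨m, hm, s, hs, rfl⟩ := exists_eq_add_of_mem_Ico ht
  obtain ⟨m', hm', s', hs', rfl⟩ := exists_eq_add_of_mem_Ico ht'
  have hz : x.1 0 = strand (turksHeadLetter m) (turksHeadPosition m) s := by
    rw [hx]
    exact turksHeadCoord_add hm (Set.Ico_subset_Icc_self hs)
  have hz' : x.1 0 = strand (turksHeadLetter m') (turksHeadPosition m') s' := by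
    rw [hx, h]
    exact turksHeadCoord_add hm' (Set.Ico_subset_Icc_self hs')
  have hat : ∀ (m : ℕ) (s : ℝ), x.1 = turksHeadPoint (m + s) →
      AtTime 10 x ((⟨m % 10, Nat.mod_lt _ (by norm_num)⟩ : Fin 10) + s) := by
    intro m s hx
    rw [AtTime, hx]
    change _ * _ = _
    rw [exp_angle_mod]
    rfl
  have hnorm : ‖x.1 0‖ < 1 := hz ▸ strand_norm_lt _ _ _
  rcases AtTime.unique' hnorm (Set.Ico_subset_Icc_self hs) (Set.Ico_subset_Icc_self hs')
    (hat m s hx) (hat m' s' (hx.trans h)) with ⟨h1, rfl⟩ | ⟨h1, -⟩ | ⟨-, h1, -⟩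
  · have h1' : m % 10 = m' % 10 := congrArg Fin.val h1
    have hl : turksHeadLetter m = turksHeadLetter m' := by
      rw [← turksHeadLetter_mod m hm, h1', turksHeadLetter_mod m' hm']
    rw [hz, ← hl] at hz'
    rw [turksHeadPosition_injective m hm m' hm' h1' (strand_injective _ _ hz')]
  · exact absurd h1 hs.2.ne
  · exact absurd h1 hs'.2.ne

theorem isKnot_knot10_123 : IsKnot knot10_123 := by
  have : Fact ((0 : ℝ) < 30) := ⟨by norm_num⟩
  have hcoe : ∀ q : AddCircle (30 : ℝ), ∃ t ∈ Set.Ico (0 : ℝ) 30, (t : AddCircle (30 : ℝ)) = q :=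
    fun q => AddCircle.eq_coe_Ico q
  have hcont := AddCircle.liftIco_zero_continuous (p := (30 : ℝ)) turksHeadPoint_zero.symm
    continuous_turksHeadPoint.continuousOn
  have hval : ∀ t ∈ Set.Ico (0 : ℝ) 30,
      AddCircle.liftIco 30 0 turksHeadPoint (t : AddCircle (30 : ℝ)) = turksHeadPoint t :=
    fun t ht => AddCircle.liftIco_zero_coe_apply ht
  have hmem : ∀ q, AddCircle.liftIco 30 0 turksHeadPoint q ∈
      Metric.sphere (0 : EuclideanSpace ℂ (Fin 2)) 1 := by
    intro q
    obtain ⟨t, ht, rfl⟩ := hcoe q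
    rw [hval t ht]
    exact turksHeadPoint_mem_sphere ht
  let f : AddCircle (30 : ℝ) → S3 := fun q => ⟨_, hmem q⟩
  have hf : Continuous f := hcont.subtype_mk hmem
  have hinj : Function.Injective f := by
    intro q q' h
    obtain ⟨t, ht, rfl⟩ := hcoe q
    obtain ⟨t', ht', rfl⟩ := hcoe q'
    have h1 := congrArg Subtype.val h
    simp only [f] at h1
    rw [hval t ht, hval t' ht'] at h1
    rw [turksHeadPoint_injOn ht ht' h1]
  let e := AddCircle.homeomorphCircle (T := (30 : ℝ)) (by norm_num)
  -- A continuous injection of a compact space into a Hausdorff space is an embedding.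
  refine ⟨f ∘ e.symm, (hf.isClosedEmbedding hinj).isEmbedding.comp e.symm.isEmbedding, ?_⟩
  rw [e.symm.surjective.range_comp]
  ext x
  rw [mem_knot10_123_iff]
  constructor
  · rintro ⟨q, rfl⟩
    obtain ⟨t, ht, rfl⟩ := hcoe q
    exact ⟨t, ht, hval t ht⟩
  · rintro ⟨t, ht, hx⟩
    exact ⟨t, Subtype.ext ((hval t ht).trans hx.symm)⟩

/-! ### The group of triples that are fixed by a braid -/

/-- The group with three generators whose representations are the triples that are fixed by `w`. -/
abbrev BraidFixedGroup (w : BraidWord) : Type :=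
  PresentedGroup (Set.range fun i => braidAct w FreeGroup.of i * (FreeGroup.of i)⁻¹)

theorem braidAct_braidFixedGroup_of (w : BraidWord) :
    braidAct w (fun i => (PresentedGroup.of i : BraidFixedGroup w)) = PresentedGroup.of := by
  have h := braidAct_map (PresentedGroup.mk
    (Set.range fun i => braidAct w FreeGroup.of i * (FreeGroup.of i)⁻¹)) w FreeGroup.of
  refine h.trans (funext fun i => ?_)
  have h1 := PresentedGroup.one_of_mem (rels := Set.range fun i =>
    braidAct w FreeGroup.of i * (FreeGroup.of i)⁻¹) ⟨i, rfl⟩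
  rw [map_mul, map_inv, mul_inv_eq_one] at h1
  exact h1

theorem lift_braidFixedGroup_rel {M : Type} [Group M] {w : BraidWord} {g : Fin 3 → M}
    (hg : braidAct w g = g) : ∀ r ∈ Set.range fun i => braidAct w FreeGroup.of i *
      (FreeGroup.of i)⁻¹, FreeGroup.lift g r = 1 := by
  rintro _ ⟨i, rfl⟩
  have h := congrFun (braidAct_map (FreeGroup.lift g) w FreeGroup.of) i
  simp only [FreeGroup.lift_apply_of] at h
  rw [map_mul, map_inv, FreeGroup.lift_apply_of, mul_inv_eq_one, ← h]
  exact congrFun hg i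

open Classical in
/-- The representation of a triple, which is trivial if the triple is not fixed. -/
def braidFixedLift {M : Type} [Group M] (w : BraidWord) (g : Fin 3 → M) : BraidFixedGroup w →* M :=
  if hg : braidAct w g = g then PresentedGroup.toGroup (lift_braidFixedGroup_rel hg) else 1

theorem braidFixedLift_of {M : Type} [Group M] {w : BraidWord} {g : Fin 3 → M}
    (hg : braidAct w g = g) (i : Fin 3) : braidFixedLift w g (PresentedGroup.of i) = g i := by
  rw [braidFixedLift, dif_pos hg]
  exact PresentedGroup.toGroup.of _

/-- Separate homomorphisms for the single triples would not be known to depend analytically on the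
parameter. The holonomy is therefore taken once, with values in the universal group, whose three
generators make every entry of the composites analytic. -/
theorem one_lt_topologicalKrullDim_knotGroup : 1 < topologicalKrullDim
    (CharVar (KnotGroup (closedBraid (braidB ++ braidStar braidB))
      (axisPoint (braidB ++ braidStar braidB)))) := by
  obtain ⟨φ, ε, hε, hφ, hgood⟩ := exists_good_family
  obtain ⟨Φ, hΦ⟩ := exists_hom_of_braidAct_eq (w := braidB ++ braidStar braidB) (by decide)
    (braidAct_braidFixedGroup_of (braidB ++ braidStar braidB))
  have hof : ∀ a ∈ (Metric.ball 0 ε ×ˢ Metric.ball Complex.I ε : Set (ℂ × ℂ)), ∀ i,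
      braidFixedLift (braidB ++ braidStar braidB) (familyTriple φ a) (PresentedGroup.of i) =
        familyTriple φ a i := fun a ha =>
    braidFixedLift_of (isTwisted_familyTriple (hgood a ha)).braidAct_eq
  have han := isAnalyticAtElement_family (Metric.isOpen_ball.prod Metric.isOpen_ball) hφ hgood
    (PresentedGroup.closure_range_of _)
    (ρ := fun a => braidFixedLift (braidB ++ braidStar braidB) (familyTriple φ a)) hof
  have h2 := two_le_topologicalKrullDim_of_family hε hgood
    (wirtinger (braidB ++ braidStar braidB))
    (fun a => (braidFixedLift (braidB ++ braidStar braidB) (familyTriple φ a)).comp Φ) Set.univ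
    (fun a ha i => by rw [MonoidHom.comp_apply, hΦ, hof a ha]) (fun γ => han (Φ γ))
    (fun _ _ => Set.mem_univ _)
  refine lt_of_lt_of_le ?_ (h2.trans (topologicalKrullDim_subspace_le _ _))
  norm_num

end

/-! ### Twisted triples and the 𝒳-largeness of 10₁₂₃ -/

theorem mainTheorem5 :
    closedBraid (braidB ++ braidStar braidB) = knot10_123 ∧
    (∃ U : Set (CharVar (FreeGroup (Fin 3))),
      IsLocallyClosed U ∧ 2 ≤ topologicalKrullDim U ∧
      ∀ G : Fin 3 → SL2C, CharVar.mk (FreeGroup.lift G) ∈ U →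
        RepVar.IsIrred (FreeGroup.lift G) ∧
        (G 0 : Matrix (Fin 2) (Fin 2) ℂ).trace = (G 1 : Matrix (Fin 2) (Fin 2) ℂ).trace ∧
        (G 1 : Matrix (Fin 2) (Fin 2) ℂ).trace = (G 2 : Matrix (Fin 2) (Fin 2) ℂ).trace ∧
        ((G 0 * G 1 * G 2 : SL2C) : Matrix (Fin 2) (Fin 2) ℂ).trace ≠ 2 ∧
        ((G 0 * G 1 * G 2 : SL2C) : Matrix (Fin 2) (Fin 2) ℂ).trace ≠ -2 ∧
        (∃ A : SL2C, ∀ i, braidAct braidB G i = A * (G i.rev)⁻¹ * A⁻¹) ∧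
        (∀ A : SL2C, (∀ i, braidAct braidB G i = A * (G i.rev)⁻¹ * A⁻¹) → A ^ 2 = -1) ∧
        ∃ ρ : KnotGroup (closedBraid (braidB ++ braidStar braidB))
            (axisPoint (braidB ++ braidStar braidB)) →* SL2C,
          ∀ i, ρ (wirtinger (braidB ++ braidStar braidB) i) = G i) ∧
    IsXLarge (closedBraid (braidB ++ braidStar braidB))
      (axisPoint (braidB ++ braidStar braidB)) := by
  -- The word bb* is letter by letter (σ₁σ₂⁻¹)⁵, so the closures agree without any isotopy.
  have hK : closedBraid (braidB ++ braidStar braidB) = knot10_123 := by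
    rw [knot10_123]
    congr 1
  refine ⟨hK, ⟨twistedLocus, isLocallyClosed_twistedLocus,
    two_le_topologicalKrullDim_twistedLocus, fun G hG => ?_⟩, ?_,
    one_lt_topologicalKrullDim_knotGroup⟩
  · have h := (mk_lift_mem_twistedLocus G).1 hG
    exact ⟨h.isIrred, h.single 0 1, h.single 1 2, h.prod_ne, h.prod_ne', h.exists_conj,
      fun A hA => h.sq_eq hA, exists_hom_of_braidAct_eq (by decide) h.braidAct_eq⟩
  · rw [hK]
    exact isKnot_knot10_123
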